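/- On $\mathbb R^3\times\mathbb R^3$ write $z=x-y$ and, for $x\neq y$, consider the biform $$\alpha = 2\,\frac{\big(\sum_i z^i dx^i\big)\otimes\big(\sum_j z^j dy^j\big)}{|z|^2}-\sum_{i=1}^3 dx^i\otimes dy^i .$$ For a biform $\beta=\sum\beta_{ij}(x,y)\,dx^i\otimes dy^j$ let $$d_1d_2\beta=\sum \frac{\partial^2\beta_{ij}}{\partial x^k\partial y^l}\,(dx^k\wedge dx^i)\otimes(dy^l\wedge dy^j).$$ The norm $|\beta|$ at $(x,y)$ is the supremum of $|\beta_{(x,y)}(u,v)|$ over vectors with $|u|,|v|\le 1$. Put $*z=z^1dx^2\wedge dx^3+z^2dx^3\wedge dx^1+z^3dx^1\wedge dx^2$, and similarly in $y$. Then: (i) $|\alpha|=1$ at all $(x,y)$ with $x\ne y$. (ii) For every circle $C\subset\mathbb R^3$, $|\alpha_{|C\times C}|=1$ at all $(x,y)\in C\times C$ with $x\neq y$. (iii) $\alpha$ is smooth on $\{x\ne y\}$, and $$d_1d_2\alpha = 4\pi\,\delta_2(x-y)\,B-4\,\frac{*(x-y)}{|x-y|^2}\otimes\frac{*(y-x)}{|y-x|^2},$$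 $$B=dx^2\wedge dx^3\otimes dy^2\wedge dy^3+dx^3\wedge dx^1\otimes dy^3\wedge dy^1+dx^1\wedge dx^2\otimes dy^1\wedge dy^2 ,$$ in the following sense. Off the diagonal the identity, without the $\delta_2$ term, holds pointwise on $\mathbb R^3\times\mathbb R^3$. The term with $\delta_2$, a two-dimensional Dirac distribution, is understood on surfaces: for every smooth injective immersion $\varphi:U\to\mathbb R^3$ of an open set $U\subset\mathbb R^2$, the identity between the pull-backs by $(s,t)\mapsto(\varphi(s),\varphi(t))$ holds in the sense of distributions on $U\times U$, where $\delta_2(\varphi(s)-\varphi(t))=\delta(s-t)/J(s)$ and $J=|\partial_1\varphi\times\partial_2\varphi|$ is the area density of $\varphi$. (iv) Let $d\sigma$ be the standard area form of the unit sphere $S^2\subset\mathbb R^3$. Then $$d_1d_2\alpha_{|S^2\times S^2}=\big(4\pi\,\delta(x-y)-1\big)\,d\sigma(x)\otimes d\sigma(y)$$ pointwise for $x\neq y$, and in the sense of distributions on $S^2\times S^2$. (v) Let $\Omega\subset S^2$ be an open set with smooth boundary, $|\Omega|$ its area and $|\partial\Omega|$ the length (one-dimensional Hausdorff measure) of its boundary.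 Then $|\partial\Omega|<\infty$ and, with $\partial\Omega$ positively oriented, $$|\partial\Omega|^2\ \ge\ \int_{\partial\Omega}\int_{\partial\Omega}\alpha\ =\ 4\pi\int_\Omega d\sigma-\int_\Omega d\sigma\int_\Omega d\sigma\ =\ (4\pi-|\Omega|)\,|\Omega| .$$ The inequality $|\partial\Omega|^2\ge(4\pi-|\Omega|)|\Omega|$ is sharp: for every $A\in(0,4\pi)$ there is such an $\Omega$ with $|\Omega|=A$ and $|\partial\Omega|^2=(4\pi-A)A$. -/

import Mathlib

open MeasureTheory Measure Set Topology
open scoped ContDiff RealInnerProductSpace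

noncomputable section

namespace SphIso

/-- Euclidean space `ℝ³`. -/
abbrev E : Type := EuclideanSpace ℝ (Fin 3)

/-- The parameter plane `ℝ²`. -/
abbrev P : Type := EuclideanSpace ℝ (Fin 2)

/-- The unit sphere `S² ⊂ ℝ³`. -/
abbrev S2 : Type := Metric.sphere (0 : E) 1

/-- The standard basis vectors of `ℝ³`. -/
def e (k : Fin 3) : E := EuclideanSpace.single k 1

/-- The standard basis vectors of `ℝ²`. -/
def f (a : Fin 2) : P := EuclideanSpace.single a 1

/-- The vector product of `ℝ³`. -/
def cross (u v : E) : E := WithLp.toLp 2 (crossProduct u.ofLp v.ofLp)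

/-! ### Biforms on `ℝ³ × ℝ³` and their differentials -/

/-- A biform `β = ∑ β_ij(x, y) dx^i ⊗ dy^j` on `ℝ³ × ℝ³`; `β x y u v = ∑ β_ij(x, y) u^i v^j`.
The norm of the value `β x y` is the comass, the supremum of `|β x y u v|` over `|u|, |v| ≤ 1`. -/
abbrev BiformField : Type := E → E → E →L[ℝ] E →L[ℝ] ℝ

/-- The coordinate 1-form `dx^i`, `u ↦ u^i`. -/
def dx (i : Fin 3) : E →L[ℝ] ℝ := EuclideanSpace.proj i

/-- The tensor product `(a ⊗ b)(u, v) = a(u) b(v)` of two covectors. -/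
def tensor (a b : E →L[ℝ] ℝ) : E →L[ℝ] E →L[ℝ] ℝ := a.smulRight b

/-- The biform `α = 2 (∑ z^i dx^i) ⊗ (∑ z^j dy^j) / |z|² - ∑ dx^i ⊗ dy^i`, where `z = x - y`. -/
def alpha : BiformField := fun x y =>
  (2 / ‖x - y‖ ^ 2) • tensor (∑ i, (x - y) i • dx i) (∑ j, (x - y) j • dx j)
    - ∑ i, tensor (dx i) (dx i)

/-- `d₂ β = ∑ ∂β_ij/∂y^l dx^i ⊗ (dy^l ∧ dy^j)`, evaluated at `(u; v, v')`. -/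
def d2 (β : BiformField) (x y u v v' : E) : ℝ :=
  fderiv ℝ (fun y' => β x y' u v') y v - fderiv ℝ (fun y' => β x y' u v) y v'

/-- `d₁ d₂ β = ∑ ∂²β_ij/∂x^k∂y^l (dx^k ∧ dx^i) ⊗ (dy^l ∧ dy^j)`, evaluated at `(u, u'; v, v')`. -/
def d1d2 (β : BiformField) (x y u u' v v' : E) : ℝ :=
  fderiv ℝ (fun x' => d2 β x' y u' v v') x u - fderiv ℝ (fun x' => d2 β x' y u v v') x u'

/-- The 2-form `dx^i ∧ dx^j` evaluated at `(u, u')`. -/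
def wedge (i j : Fin 3) (u u' : E) : ℝ := u i * u' j - u j * u' i

/-- `dx²∧dx³ ⊗ dy²∧dy³ + dx³∧dx¹ ⊗ dy³∧dy¹ + dx¹∧dx² ⊗ dy¹∧dy²` at `(u, u'; v, v')`. -/
def areaBracket (u u' v v' : E) : ℝ :=
  wedge 1 2 u u' * wedge 1 2 v v' + wedge 2 0 u u' * wedge 2 0 v v'
    + wedge 0 1 u u' * wedge 0 1 v v'

/-- `w¹ dx²∧dx³ + w² dx³∧dx¹ + w³ dx¹∧dx²` at `(u, u')`. -/
def fluxForm (w u u' : E) : ℝ :=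
  w 0 * wedge 1 2 u u' + w 1 * wedge 2 0 u u' + w 2 * wedge 0 1 u u'

/-- The regular part of `d₁ d₂ α`, evaluated at `(u, u'; v, v')`. -/
def regularPart (x y u u' v v' : E) : ℝ :=
  -4 * ((fluxForm (x - y) u u' / ‖x - y‖ ^ 2) * (fluxForm (y - x) v v' / ‖y - x‖ ^ 2))

/-! ### Circles in `ℝ³` -/

/-- The point of parameter `θ` on the circle of centre `c` and radius `r` in the plane through `c`
that is spanned by the orthonormal vectors `u, v`. -/
def circlePoint (c u v : E) (r θ : ℝ) : E := c + r • (Real.cos θ • u + Real.sin θ • v)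

/-- The tangent line (a one-dimensional vector space) of that circle at the same point. -/
def circleTangent (u v : E) (θ : ℝ) : Submodule ℝ E :=
  Submodule.span ℝ {-(Real.sin θ) • u + Real.cos θ • v}

/-! ### The distribution `d₁ d₂` of the restriction of `α` to a surface patch -/

/-- `φ` is a smooth injective immersion of the open set `U ⊆ ℝ²` into `ℝ³`. -/
structure IsPatch (U : Set P) (φ : P → E) : Prop where
  isOpen : IsOpen U
  smooth : ContDiffOn ℝ ∞ φ U
  injOn : InjOn φ U
  immersion : ∀ s ∈ U, Function.Injective (fderiv ℝ φ s)

/-- Partial derivatives of the parametrization. -/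
def pd (φ : P → E) (a : Fin 2) (s : P) : E := fderiv ℝ φ s (f a)

/-- The coefficient of `ds^a ⊗ dt^b` in the pull-back of `α` by `(s, t) ↦ (φ s, φ t)`. -/
def pullCoeff (φ : P → E) (a b : Fin 2) (s t : P) : ℝ :=
  alpha (φ s) (φ t) (pd φ a s) (pd φ b t)

/-- `∂²ψ/∂s^a∂t^b`. -/
def mixedPartial (ψ : P × P → ℝ) (a b : Fin 2) (s t : P) : ℝ :=
  fderiv ℝ (fun s' => fderiv ℝ (fun t' => ψ (s', t')) t (f b)) s (f a)

/-- The integrand of the weak form of `d₁ d₂` on a patch: integrating by parts once in `s` and once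
in `t`, the pairing of `d₁ d₂ (∑ A_ab ds^a ⊗ dt^b)` with a test function `ψ` is the integral of
`A₂₂ ∂_{s¹}∂_{t¹}ψ - A₂₁ ∂_{s¹}∂_{t²}ψ - A₁₂ ∂_{s²}∂_{t¹}ψ + A₁₁ ∂_{s²}∂_{t²}ψ`. -/
def patchWeakIntegrand (φ : P → E) (ψ : P × P → ℝ) (q : P × P) : ℝ :=
  pullCoeff φ 1 1 q.1 q.2 * mixedPartial ψ 0 0 q.1 q.2
    - pullCoeff φ 1 0 q.1 q.2 * mixedPartial ψ 0 1 q.1 q.2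
    - pullCoeff φ 0 1 q.1 q.2 * mixedPartial ψ 1 0 q.1 q.2
    + pullCoeff φ 0 0 q.1 q.2 * mixedPartial ψ 1 1 q.1 q.2

/-- `ψ` times the pull-back of the regular part of `d₁ d₂ α`. -/
def patchRegularIntegrand (φ : P → E) (ψ : P × P → ℝ) (q : P × P) : ℝ :=
  ψ q * regularPart (φ q.1) (φ q.2) (pd φ 0 q.1) (pd φ 1 q.1) (pd φ 0 q.2) (pd φ 1 q.2)

/-- `ψ` tested against `δ₂(x - y)` times the bracket `areaBracket`. Here `δ₂` is the Dirac
distribution of the surface with respect to its area element `J(s) ds¹ds²`,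
`J = |∂₁φ × ∂₂φ|`, so that `δ₂(φ s - φ t) = δ(s - t) / J(s)`. -/
def patchDiracIntegrand (φ : P → E) (ψ : P × P → ℝ) (s : P) : ℝ :=
  ψ (s, s) * (areaBracket (pd φ 0 s) (pd φ 1 s) (pd φ 0 s) (pd φ 1 s)
    / ‖cross (pd φ 0 s) (pd φ 1 s)‖)

/-! ### The sphere -/

/-- The standard area measure of `S²` (of total mass `4π`). -/
def σ : Measure S2 := (volume : Measure E).toSphere

/-- The area form `dσ` of `S²`, oriented by the outer normal, on tangent vectors at `x`. -/
def areaForm (x : S2) (u u' : E) : ℝ := ⟪(x : E), cross u u'⟫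

/-- The integrand of the weak form of `d₁ d₂ α` on `S² × S²`. For a function `g` and a 1-form `β`
on `S²` one has `dg ∧ β = β(x × ∇g) dσ`, hence `∫ g dβ = -∫ β(x × ∇g) dσ`, and the `k`-th component
of `x × ∇g` is the derivative of `g` along `e_k × x`. Doing this in `x` and in `y`, the pairing of
`d₁ d₂ α` with a test function `ψ` is the integral of the function below. -/
def sphereWeakIntegrand (ψ : E × E → ℝ) (q : S2 × S2) : ℝ :=
  ∑ k : Fin 3, ∑ l : Fin 3, alpha (q.1 : E) (q.2 : E) (e k) (e l) *
    fderiv ℝ (fun x' : E => fderiv ℝ (fun y' : E => ψ (x', y')) (q.2 : E) (cross (e l) (q.2 : E)))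
      (q.1 : E) (cross (e k) (q.1 : E))

/-- `ρ` is a smooth function that describes `Ω` near the boundary point `p`: near `p` the set `Ω`
is `{ρ < 0}`, `ρ p = 0`, and the gradient of `ρ` along `S²` does not vanish at `p`. -/
def IsLocalDefining (Ω : Set S2) (p : S2) (ρ : E → ℝ) : Prop :=
  ContDiff ℝ ∞ ρ ∧ ρ (p : E) = 0 ∧ (∀ᶠ x : S2 in 𝓝 p, x ∈ Ω ↔ ρ (x : E) < 0) ∧
    cross (p : E) (gradient ρ (p : E)) ≠ 0

/-- Open subsets of `S²` with smooth boundary (not necessarily connected). -/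
def IsSmoothDomain (Ω : Set S2) : Prop :=
  IsOpen Ω ∧ ∀ p ∈ frontier Ω, ∃ ρ : E → ℝ, IsLocalDefining Ω p ρ

open Classical in
/-- The positively oriented unit tangent vector of `∂Ω` at `p`: it is `p × ν`, where `ν` is the
outward unit conormal, the normalized gradient along `S²` of a local defining function. It does
not depend on the choice of that function. -/
def posTangent (Ω : Set S2) (p : S2) : E :=
  if h : ∃ ρ : E → ℝ, IsLocalDefining Ω p ρ then
    ‖cross (p : E) (gradient h.choose (p : E))‖⁻¹ • cross (p : E) (gradient h.choose (p : E))
  else 0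

/-- The area `|Ω|`. -/
def area (Ω : Set S2) : ℝ := (σ Ω).toReal

/-- Arc length on `∂Ω`: one-dimensional Hausdorff measure restricted to the boundary. -/
def arcLength (Ω : Set S2) : Measure S2 := (μH[1] : Measure S2).restrict (frontier Ω)

/-- The length `|∂Ω|`. -/
def bdryLength (Ω : Set S2) : ℝ := ((μH[1] : Measure S2) (frontier Ω)).toReal

/-- The integrand of `∫_∂Ω ∫_∂Ω α`. -/
def bdryIntegrand (Ω : Set S2) (q : S2 × S2) : ℝ :=
  alpha (q.1 : E) (q.2 : E) (posTangent Ω q.1) (posTangent Ω q.2)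

end SphIso

end

open SphIso

noncomputable section

namespace SphIso

/-! ### Vector algebra in `ℝ³` -/

/-! For `x ≠ y` one has `α(u, v) = ⟪R v, u⟫`, where `R` is minus the reflection in the plane
orthogonal to `z = x - y`. Since `R` is orthogonal, the comass is one. A chord of a circle makes
equal angles with the tangents at its ends, so `R` carries one tangent line to the other; this is
the statement on circles.

For the differential, `|z|²` in the denominator is replaced by `|z|² + c`. For `c > 0` the biform
`alphaReg` is smooth and still bounded by `1` (`norm_regField_le`), so dominated convergence governs
`c → 0`. Both `d₁` and `d₂` become curls of explicit fields (`curl_regField`, `curl_regFlux`). On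
surface elements with normals `N`, `N'` the outcome is the kernel `4c⟪N, N'⟫/(|z|² + c)² + 4⟪z,
N⟫⟪z, N'⟫/(|z|² + c)²`. Its second part tends to the regular part of `d₁ d₂ α`. Its first part dies
off the diagonal and concentrates on it: rescaled by `√c`, a surface becomes its tangent plane, and
`∫ 4/(|w|² + 1)² = 4π` over the plane (`integral_bubble`) is the constant of the Dirac term.

On the sphere the normals are `x` and `y`, with `⟪z, x⟫ = |z|²/2 = -⟪z, y⟫`, and the kernel becomes
`peak - damping` with `damping → 1`. The mass of `peak` comes for free: Stokes' theorem on the whole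
sphere gives `∫ peak = ∫ damping → 4π` (`integral_peak`).

Stokes' theorem on `Ω`, once in `x` and once in `y` (`integral_bdryReg`), turns the double boundary
integral into the integral of `peak - damping` over `Ω × Ω`, with limit `4π|Ω| - |Ω|²`. The comass
bound compares it with `|∂Ω|²`. The boundary of a cap is a circle, on which `α` of the oriented unit
tangents equals `1`; hence equality, and caps attain every area by continuity.

Stokes' theorem is needed for the measures `toSphere` and `μH[1]`. Charts with coordinates `(⟪x, q⟫,
ρ x)` straighten the boundary to the axis. Their area density comes from the volume of cones
(`map_sigma_restrict`), their length element from the Hausdorff measure of `C¹` curves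
(`hausdorffMeasure_curve`); Green's formula in a half plane and a partition of unity do the rest. -/

theorem inner_eq_coord (x y : E) : ⟪x, y⟫ = x 0 * y 0 + x 1 * y 1 + x 2 * y 2 := by
  simp [PiLp.inner_apply, Fin.sum_univ_three, mul_comm]

theorem norm_sq_eq_coord (x : E) : ‖x‖ ^ 2 = x 0 ^ 2 + x 1 ^ 2 + x 2 ^ 2 := by
  rw [← real_inner_self_eq_norm_sq, inner_eq_coord]; ring

@[simp] theorem cross_zero_apply (u v : E) : cross u v 0 = u 1 * v 2 - u 2 * v 1 := by
  simp [cross, cross_apply]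

@[simp] theorem cross_one_apply (u v : E) : cross u v 1 = u 2 * v 0 - u 0 * v 2 := by
  simp [cross, cross_apply]

@[simp] theorem cross_two_apply (u v : E) : cross u v 2 = u 0 * v 1 - u 1 * v 0 := by
  simp [cross, cross_apply]

theorem ext_coord {x y : E} (h0 : x 0 = y 0) (h1 : x 1 = y 1) (h2 : x 2 = y 2) : x = y := by
  ext i; fin_cases i <;> assumption

@[simp] theorem e_apply (i j : Fin 3) : e i j = if j = i then 1 else 0 := by
  simp [e]

/-- The vector product as a continuous bilinear map. -/
def crossL : E →L[ℝ] E →L[ℝ] E :=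
  (LinearMap.mk₂ ℝ cross
    (fun _ _ _ => ext_coord (by simp; ring) (by simp; ring) (by simp; ring))
    (fun _ _ _ => ext_coord (by simp; ring) (by simp; ring) (by simp; ring))
    (fun _ _ _ => ext_coord (by simp; ring) (by simp; ring) (by simp; ring))
    (fun _ _ _ => ext_coord (by simp; ring) (by simp; ring)
      (by simp; ring))).toContinuousBilinearMap

@[simp] theorem crossL_apply (u v : E) : crossL u v = cross u v := rfl

theorem continuous_cross : Continuous fun p : E × E => cross p.1 p.2 :=
  crossL.continuous₂

theorem contDiff_cross {n : WithTop ℕ∞} : ContDiff ℝ n fun p : E × E => cross p.1 p.2 :=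
  crossL.isBoundedBilinearMap.contDiff

theorem cross_smul_left (c : ℝ) (u v : E) : cross (c • u) v = c • cross u v :=
  (crossL.map_smul₂ c u v)

theorem cross_smul_right (c : ℝ) (u v : E) : cross u (c • v) = c • cross u v :=
  ((crossL u).map_smul c v)

theorem inner_cross_cross (a b u v : E) :
    ⟪cross a b, cross u v⟫ = ⟪a, u⟫ * ⟪b, v⟫ - ⟪a, v⟫ * ⟪b, u⟫ := by
  simp only [inner_eq_coord, cross_zero_apply, cross_one_apply, cross_two_apply]; ring

theorem norm_cross_sq (a b : E) : ‖cross a b‖ ^ 2 = ‖a‖ ^ 2 * ‖b‖ ^ 2 - ⟪a, b⟫ ^ 2 := by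
  rw [← real_inner_self_eq_norm_sq, inner_cross_cross, real_inner_self_eq_norm_sq,
    real_inner_self_eq_norm_sq, real_inner_comm b a]; ring

theorem inner_cross_comm (a b c : E) : ⟪a, cross b c⟫ = ⟪cross a b, c⟫ := by
  simp only [inner_eq_coord, cross_zero_apply, cross_one_apply, cross_two_apply]; ring

theorem inner_cross_left (a b : E) : ⟪a, cross a b⟫ = 0 := by
  simp only [inner_eq_coord, cross_zero_apply, cross_one_apply, cross_two_apply]; ring

theorem inner_cross_right (a b : E) : ⟪b, cross a b⟫ = 0 := by
  simp only [inner_eq_coord, cross_zero_apply, cross_one_apply, cross_two_apply]; ring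

/-- A vector that is orthogonal to `a` and `b` is parallel to `a × b`. -/
theorem cross_cross_of_orthogonal {a b w : E} (ha : ⟪w, a⟫ = 0) (hb : ⟪w, b⟫ = 0) :
    cross w (cross a b) = 0 := by
  have h : cross w (cross a b) = ⟪w, b⟫ • a - ⟪w, a⟫ • b := by
    simp only [inner_eq_coord]
    exact ext_coord (by simp; ring) (by simp; ring) (by simp; ring)
  simp [h, ha, hb]

/-- Follows from `a × (w × a) = |a|² w - ⟪w, a⟫ a`. Combined with `cross_cross_of_orthogonal`, it
recovers a vector orthogonal to two given ones from a single further inner product. -/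
theorem norm_sq_smul_of_cross_eq_zero {a w : E} (h : cross w a = 0) :
    ‖a‖ ^ 2 • w = ⟪w, a⟫ • a := by
  have h1 : cross a (cross w a) = ‖a‖ ^ 2 • w - ⟪w, a⟫ • a := by
    simp only [inner_eq_coord, norm_sq_eq_coord]
    exact ext_coord (by simp; ring) (by simp; ring) (by simp; ring)
  rw [h, show cross a 0 = 0 from (crossL a).map_zero] at h1
  exact (sub_eq_zero.1 h1.symm)

theorem sum_smul_e (a : E) : a = a 0 • e 0 + a 1 • e 1 + a 2 • e 2 :=
  ext_coord (by simp) (by simp) (by simp)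

/-! ### The curl of a vector field -/

/-- The curl of a vector field on `ℝ³`. -/
def curl (F : E → E) (x : E) : E := ∑ k, cross (e k) (fderiv ℝ F x (e k))

/-- The right side is the exterior derivative, on `(a, b)`, of the 1-form dual to a field with
differential `D`. Alternating forms on `ℝ³` are fluxes of vectors, so `d` can be handled as a curl
throughout. -/
theorem inner_sum_cross (D : E →L[ℝ] E) (a b : E) :
    ⟪∑ k, cross (e k) (D (e k)), cross a b⟫ = ⟪D a, b⟫ - ⟪D b, a⟫ := by
  have ha : D a = a 0 • D (e 0) + a 1 • D (e 1) + a 2 • D (e 2) := by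
    conv_lhs => rw [sum_smul_e a]
    simp only [map_add, map_smul]
  have hb : D b = b 0 • D (e 0) + b 1 • D (e 1) + b 2 • D (e 2) := by
    conv_lhs => rw [sum_smul_e b]
    simp only [map_add, map_smul]
  rw [ha, hb]
  simp [inner_eq_coord, Fin.sum_univ_three]
  ring

theorem inner_curl_cross (F : E → E) (x a b : E) :
    ⟪curl F x, cross a b⟫ = ⟪fderiv ℝ F x a, b⟫ - ⟪fderiv ℝ F x b, a⟫ :=
  inner_sum_cross _ a b

theorem curl_eq_of_hasFDerivAt {F : E → E} {D : E →L[ℝ] E} {x R : E} (hF : HasFDerivAt F D x)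
    (h : ∀ a b, ⟪D a, b⟫ - ⟪D b, a⟫ = ⟪R, cross a b⟫) : curl F x = R := by
  have key : ∀ a b, ⟪curl F x, cross a b⟫ = ⟪R, cross a b⟫ := fun a b => by
    rw [inner_curl_cross, hF.fderiv, h]
  -- These three products of basis vectors are again the basis vectors, so the pairings read off all
  -- coordinates.
  have h0 := key (e 1) (e 2)
  have h1 := key (e 2) (e 0)
  have h2 := key (e 0) (e 1)
  simp [inner_eq_coord] at h0 h1 h2
  exact ext_coord h0 h1 h2

theorem curl_smul {χ : E → ℝ} {F : E → E} {x : E} (hχ : DifferentiableAt ℝ χ x)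
    (hF : DifferentiableAt ℝ F x) :
    curl (fun x => χ x • F x) x
      = χ x • curl F x + ∑ k, fderiv ℝ χ x (e k) • cross (e k) (F x) := by
  simp only [curl, fderiv_fun_smul hχ hF, Finset.smul_sum, ← Finset.sum_add_distrib]
  refine Finset.sum_congr rfl fun k _ => ?_
  simp only [← crossL_apply]
  simp only [_root_.add_apply, _root_.smul_apply, ContinuousLinearMap.smulRight_apply, map_add, map_smul]

theorem continuous_curl {F : E → E} (hF : ContDiff ℝ 1 F) : Continuous (curl F) := by
  have : Continuous (fderiv ℝ F) := hF.continuous_fderiv one_ne_zero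
  unfold curl
  refine continuous_finsetSum _ fun k _ => ?_
  exact continuous_cross.comp (continuous_const.prodMk (this.clm_apply continuous_const))

/-! ### Regularizations of `α` -/

/-- The biform `α` with `|z|²` replaced by `|z|² + c` in the denominator. -/
def alphaReg (c : ℝ) (x y u v : E) : ℝ :=
  2 / (‖x - y‖ ^ 2 + c) * ⟪x - y, u⟫ * ⟪x - y, v⟫ - ⟪u, v⟫

/-- Also valid for `x = y`, where both denominators are zero and the quotients are zero by
convention. -/
theorem alpha_apply (x y u v : E) : alpha x y u v = alphaReg 0 x y u v := by
  simp [alpha, alphaReg, tensor, dx, inner_eq_coord, Fin.sum_univ_three]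
  ring

theorem alphaReg_swap (c : ℝ) (x y u v : E) : alphaReg c x y u v = alphaReg c y x v u := by
  simp only [alphaReg, norm_sub_rev x y, inner_eq_coord, PiLp.sub_apply]; ring

/-- The vector field in `x` dual to `alphaReg c x y · v`. -/
def regField (c : ℝ) (y v x : E) : E := (2 / (‖x - y‖ ^ 2 + c) * ⟪x - y, v⟫) • (x - y) - v

theorem inner_regField (c : ℝ) (x y u v : E) : ⟪regField c y v x, u⟫ = alphaReg c x y u v := by
  simp only [regField, alphaReg, inner_sub_left, real_inner_smul_left, real_inner_comm u v]
  ring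

/-- For `c = 0` and `x ≠ y` the last factor is zero, as befits minus a reflection. For `c > 0` the
subtracted term is nonnegative, so that `v ↦ regField c y v x` contracts. -/
theorem norm_regField_sq (c : ℝ) (x y v : E) :
    ‖regField c y v x‖ ^ 2 = ‖v‖ ^ 2
      - 4 * ⟪x - y, v⟫ ^ 2 / (‖x - y‖ ^ 2 + c) * (1 - ‖x - y‖ ^ 2 / (‖x - y‖ ^ 2 + c)) := by
  rw [regField, norm_sub_sq_real, norm_smul, mul_pow, Real.norm_eq_abs, sq_abs,
    real_inner_smul_left]
  ring

theorem norm_regField_le {c : ℝ} (hc : 0 ≤ c) (x y v : E) : ‖regField c y v x‖ ≤ ‖v‖ := by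
  refine le_of_sq_le_sq ?_ (norm_nonneg _)
  rw [norm_regField_sq]
  have h : ‖x - y‖ ^ 2 / (‖x - y‖ ^ 2 + c) ≤ 1 :=
    div_le_one_of_le₀ (by linarith) (by positivity)
  have : 0 ≤ 4 * ⟪x - y, v⟫ ^ 2 / (‖x - y‖ ^ 2 + c) * (1 - ‖x - y‖ ^ 2 / (‖x - y‖ ^ 2 + c)) :=
    mul_nonneg (by positivity) (by linarith)
  linarith

theorem abs_alphaReg_le {c : ℝ} (hc : 0 ≤ c) (x y u v : E) :
    |alphaReg c x y u v| ≤ ‖u‖ * ‖v‖ := by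
  rw [← inner_regField, mul_comm]
  exact (abs_real_inner_le_norm _ _).trans
    (mul_le_mul_of_nonneg_right (norm_regField_le hc x y v) (norm_nonneg u))

theorem norm_alpha {x y : E} (h : x ≠ y) : ‖alpha x y‖ = 1 := by
  refine le_antisymm ?_ ?_
  · refine ContinuousLinearMap.opNorm_le_bound₂ _ zero_le_one fun u v => ?_
    rw [alpha_apply, Real.norm_eq_abs, one_mul]
    exact abs_alphaReg_le le_rfl x y u v
  · have hz : ‖x - y‖ ^ 2 ≠ 0 := by simpa [sub_eq_zero] using h
    have he : ‖e 0‖ = 1 := by simp [e]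
    have hw : ‖regField 0 y (e 0) x‖ = 1 := by
      have := norm_regField_sq 0 x y (e 0)
      rw [add_zero, div_self hz, he] at this
      rw [sub_self, mul_zero, sub_zero, one_pow] at this
      exact (pow_eq_one_iff_of_nonneg (norm_nonneg _) two_ne_zero).1 this
    -- The unit vector `e 0` and its image under the orthogonal map give the value `1`.
    have := (alpha x y).le_opNorm₂ (regField 0 y (e 0) x) (e 0)
    rw [alpha_apply, ← inner_regField, real_inner_self_eq_norm_sq, hw, he] at this
    simpa using this

/-! ### Circles -/

/-- The chord makes equal angles with the two tangents, so the reflection defined by the chord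
exchanges the tangent lines. -/
theorem abs_alpha_circle {c u v : E} {r : ℝ} (hu : ‖u‖ = 1) (hv : ‖v‖ = 1) (huv : ⟪u, v⟫ = 0)
    {s t : ℝ} (hne : circlePoint c u v r s ≠ circlePoint c u v r t)
    {τ τ' : E} (hτ : τ ∈ circleTangent u v s) (hτ' : τ' ∈ circleTangent u v t)
    (h1 : ‖τ‖ = 1) (h1' : ‖τ'‖ = 1) :
    |alpha (circlePoint c u v r s) (circlePoint c u v r t) τ τ'| = 1 := by
  obtain ⟨a, rfl⟩ := Submodule.mem_span_singleton.1 hτ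
  obtain ⟨b, rfl⟩ := Submodule.mem_span_singleton.1 hτ'
  have huu : ⟪u, u⟫ = 1 := by rw [real_inner_self_eq_norm_sq, hu]; norm_num
  have hvv : ⟪v, v⟫ = 1 := by rw [real_inner_self_eq_norm_sq, hv]; norm_num
  have hvu : ⟪v, u⟫ = 0 := by rw [real_inner_comm]; exact huv
  have hin : ∀ p q p' q' : ℝ, ⟪p • u + q • v, p' • u + q' • v⟫ = p * p' + q * q' := by
    intro p q p' q'
    simp only [inner_add_left, inner_add_right, real_inner_smul_left, real_inner_smul_right,
      huu, hvv, huv, hvu]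
    ring
  have hn : ∀ θ : ℝ, ‖-(Real.sin θ) • u + Real.cos θ • v‖ = 1 := by
    intro θ
    have h := hin (-(Real.sin θ)) (Real.cos θ) (-(Real.sin θ)) (Real.cos θ)
    rw [real_inner_self_eq_norm_sq] at h
    have h' := Real.sin_sq_add_cos_sq θ
    have h2 : ‖-(Real.sin θ) • u + Real.cos θ • v‖ ^ 2 = 1 := by rw [h]; linarith
    exact (pow_eq_one_iff_of_nonneg (norm_nonneg _) two_ne_zero).1 h2
  rw [norm_smul, hn, mul_one, Real.norm_eq_abs] at h1 h1'
  have hz : circlePoint c u v r s - circlePoint c u v r t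
      = (r * (Real.cos s - Real.cos t)) • u + (r * (Real.sin s - Real.sin t)) • v := by
    simp only [circlePoint]; module
  have hz0 : ‖circlePoint c u v r s - circlePoint c u v r t‖ ^ 2 ≠ 0 := by
    simpa [sub_eq_zero] using hne
  have hzz := hin (r * (Real.cos s - Real.cos t)) (r * (Real.sin s - Real.sin t))
    (r * (Real.cos s - Real.cos t)) (r * (Real.sin s - Real.sin t))
  rw [← hz, real_inner_self_eq_norm_sq] at hzz
  have h1s := Real.sin_sq_add_cos_sq s
  have h1t := Real.sin_sq_add_cos_sq t
  -- For tangents in the same sense of rotation the value is `1`; arbitrary unit tangents add only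
  -- factors of absolute value one.
  have key : alphaReg 0 (circlePoint c u v r s) (circlePoint c u v r t)
      (-(Real.sin s) • u + Real.cos s • v) (-(Real.sin t) • u + Real.cos t • v) = 1 := by
    rw [alphaReg, add_zero, div_mul_eq_mul_div, div_mul_eq_mul_div, sub_eq_iff_eq_add,
      div_eq_iff hz0, hzz, hz, hin, hin, hin]
    set p := Real.cos s
    set q := Real.sin s
    set p' := Real.cos t
    set q' := Real.sin t
    have e1 : p ^ 2 = 1 - q ^ 2 := by linarith
    have e2 : p' ^ 2 = 1 - q' ^ 2 := by linarith
    ring_nf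
    -- Squares and cubes of the cosines are lowered by `cos² = 1 - sin²`, after which both sides
    -- agree as polynomials.
    simp only [show p ^ 3 = p * p ^ 2 by ring, show p' ^ 3 = p' * p' ^ 2 by ring, e1, e2]
    ring_nf
  rw [alpha_apply, ← inner_regField]
  have : regField 0 (circlePoint c u v r t) (b • (-(Real.sin t) • u + Real.cos t • v))
      (circlePoint c u v r s) = b • regField 0 (circlePoint c u v r t)
        (-(Real.sin t) • u + Real.cos t • v) (circlePoint c u v r s) := by
    simp only [regField, real_inner_smul_right]
    module
  rw [this, real_inner_smul_left, real_inner_smul_right, inner_regField, key, mul_one, abs_mul,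
    h1, h1', mul_one]

/-! ### Curls of the regularized fields -/

/-- The vector field in `y` dual to the flux of `curl (regField c y ·)` at `x` through `N`. -/
def regFlux (c : ℝ) (x N y : E) : E := (2 / (‖x - y‖ ^ 2 + c)) • cross (x - y) N

theorem hasFDerivAt_two_div (c : ℝ) {x y : E} (h : ‖x - y‖ ^ 2 + c ≠ 0) :
    HasFDerivAt (fun x => 2 / (‖x - y‖ ^ 2 + c))
      ((-4 / (‖x - y‖ ^ 2 + c) ^ 2) • innerSL ℝ (x - y)) x := by
  have h1 : HasDerivAt (fun r : ℝ => 2 / (r + c)) (-2 / (‖x - y‖ ^ 2 + c) ^ 2) (‖x - y‖ ^ 2) := by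
    have := (hasDerivAt_const (‖x - y‖ ^ 2) (2 : ℝ)).fun_div
      ((hasDerivAt_id (‖x - y‖ ^ 2)).add_const c) h
    simpa using this
  have h2 : HasFDerivAt (fun x : E => ‖x - y‖ ^ 2)
      (2 • (innerSL ℝ (x - y)).comp (ContinuousLinearMap.id ℝ E)) x :=
    ((hasFDerivAt_id x).sub_const y).norm_sq
  refine (h1.comp_hasFDerivAt x h2).congr_fderiv ?_
  ext w
  simp
  ring

theorem hasFDerivAt_regField (c : ℝ) (v : E) {x y : E} (h : ‖x - y‖ ^ 2 + c ≠ 0) :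
    HasFDerivAt (regField c y v)
      ((2 / (‖x - y‖ ^ 2 + c) * ⟪x - y, v⟫) • ContinuousLinearMap.id ℝ E +
        ((2 / (‖x - y‖ ^ 2 + c)) • innerSL ℝ v +
          ⟪x - y, v⟫ • ((-4 / (‖x - y‖ ^ 2 + c) ^ 2) • innerSL ℝ (x - y))).smulRight (x - y)) x := by
  have h1 := hasFDerivAt_two_div c h
  have h2 : HasFDerivAt (fun x : E => ⟪x - y, v⟫) (innerSL ℝ v) x := by
    have := (innerSL ℝ v).hasFDerivAt.comp x ((hasFDerivAt_id x).sub_const y)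
    simpa [Function.comp_def, real_inner_comm] using this
  exact ((h1.mul h2).smul ((hasFDerivAt_id x).sub_const y)).sub_const v

theorem curl_regField (c : ℝ) (v : E) {x y : E} (h : ‖x - y‖ ^ 2 + c ≠ 0) :
    curl (regField c y v) x = (2 / (‖x - y‖ ^ 2 + c)) • cross v (x - y) := by
  refine curl_eq_of_hasFDerivAt (hasFDerivAt_regField c v h) fun a b => ?_
  rw [real_inner_smul_left, inner_cross_cross]
  simp only [_root_.add_apply, _root_.smul_apply, ContinuousLinearMap.smulRight_apply,
    ContinuousLinearMap.id_apply, innerSL_apply_apply, inner_add_left, real_inner_smul_left,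
    smul_eq_mul, real_inner_comm b a]
  ring

/-- The triple product is cyclic. The flux through `N` is thus again a field paired with `v`, and
the second differential becomes a second curl. -/
theorem inner_curl_regField (c : ℝ) (v N : E) {x y : E} (h : ‖x - y‖ ^ 2 + c ≠ 0) :
    ⟪curl (regField c y v) x, N⟫ = ⟪regFlux c x N y, v⟫ := by
  rw [curl_regField c v h, regFlux, real_inner_smul_left, real_inner_smul_left,
    ← inner_cross_comm, real_inner_comm]

theorem regFlux_eq_neg (c : ℝ) (x N : E) :
    regFlux c x N = fun y => (2 / (‖y - x‖ ^ 2 + c)) • cross N (y - x) := by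
  ext1 y
  rw [regFlux, norm_sub_rev]
  congr 1
  exact ext_coord (by simp; ring) (by simp; ring) (by simp; ring)

theorem hasFDerivAt_regFlux (c : ℝ) (N : E) {x y : E} (h : ‖y - x‖ ^ 2 + c ≠ 0) :
    HasFDerivAt (regFlux c x N)
      ((2 / (‖y - x‖ ^ 2 + c)) • crossL N +
        ((-4 / (‖y - x‖ ^ 2 + c) ^ 2) • innerSL ℝ (y - x)).smulRight (cross N (y - x))) y := by
  rw [regFlux_eq_neg]
  have h2 : HasFDerivAt (fun y : E => cross N (y - x)) (crossL N) y := by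
    exact (crossL N).hasFDerivAt.comp y ((hasFDerivAt_id y).sub_const x)
  exact (hasFDerivAt_two_div c h).smul h2

/-- The source of both parts of `d₁ d₂ α`: the first term, with its factor `c`, concentrates on the
diagonal, and the second is all that remains at `c = 0`. -/
theorem curl_regFlux (c : ℝ) (N : E) {x y : E} (h : ‖x - y‖ ^ 2 + c ≠ 0) :
    curl (regFlux c x N) y = (4 * c / (‖x - y‖ ^ 2 + c) ^ 2) • N
      + (4 * ⟪x - y, N⟫ / (‖x - y‖ ^ 2 + c) ^ 2) • (x - y) := by
  rw [norm_sub_rev] at h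
  refine curl_eq_of_hasFDerivAt (hasFDerivAt_regFlux c N h) fun a b => ?_
  rw [norm_sub_rev x y, ← neg_sub y x]
  -- Eliminating `c` in favour of `R = |y - x|² + c` leaves a rational identity whose only
  -- denominators are powers of `R`.
  have h3 : c = (‖y - x‖ ^ 2 + c) - ‖y - x‖ ^ 2 := by ring
  generalize hr : ‖y - x‖ ^ 2 + c = R at *
  rw [h3, norm_sq_eq_coord]
  generalize y - x = z
  simp [inner_add_left, real_inner_smul_left, inner_eq_coord]
  field_simp
  ring

theorem two_le_infty : (2 : WithTop ℕ∞) ≤ ∞ := by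
  exact WithTop.coe_le_coe.2 (le_top : (2 : ℕ∞) ≤ ⊤)

/-! ### `d₁ d₂ α` off the diagonal -/

theorem norm_sub_sq_add_zero_ne {x y : E} (h : x ≠ y) : ‖x - y‖ ^ 2 + 0 ≠ 0 := by
  simpa [sub_eq_zero] using h

theorem inner_fderiv {X : Type*} [NormedAddCommGroup X] [NormedSpace ℝ X] {F : X → E} {x : X}
    (hF : DifferentiableAt ℝ F x) (v : E) (a : X) :
    fderiv ℝ (fun x' => ⟪F x', v⟫) x a = ⟪fderiv ℝ F x a, v⟫ := by
  rw [fderiv_inner_apply ℝ hF (differentiableAt_const v)]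
  simp

/-- By the symmetry `alphaReg_swap`, the derivative in `y` is a curl of `regField` with the roles of
`x` and `y` exchanged. -/
theorem d2_alpha {x y : E} (h : x ≠ y) (u v v' : E) :
    d2 alpha x y u v v' = ⟪regFlux 0 y (cross v v') x, u⟫ := by
  have h' : ‖y - x‖ ^ 2 + 0 ≠ 0 := norm_sub_sq_add_zero_ne h.symm
  have key : ∀ w, (fun y' => alpha x y' u w) = fun y' => ⟪regField 0 x u y', w⟫ := fun w => by
    ext1 y'
    rw [inner_regField, alpha_apply, alphaReg_swap]
  have hd := (hasFDerivAt_regField 0 u h').differentiableAt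
  rw [d2, key, key, inner_fderiv hd, inner_fderiv hd, ← inner_curl_cross,
    inner_curl_regField 0 u _ h']

theorem fluxForm_eq (w u u' : E) : fluxForm w u u' = ⟪w, cross u u'⟫ := by
  simp [fluxForm, wedge, inner_eq_coord]

theorem areaBracket_eq (u u' v v' : E) :
    areaBracket u u' v v' = ⟪cross u u', cross v v'⟫ := by
  simp [areaBracket, wedge, inner_eq_coord]

theorem regularPart_eq (x y u u' v v' : E) : regularPart x y u u' v v'
    = 4 * ⟪x - y, cross u u'⟫ * ⟪x - y, cross v v'⟫ / (‖x - y‖ ^ 2) ^ 2 := by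
  rw [regularPart, fluxForm_eq, fluxForm_eq, norm_sub_rev y x, ← neg_sub x y, inner_neg_left]
  ring

theorem d1d2_alpha {x y : E} (h : x ≠ y) (u u' v v' : E) :
    d1d2 alpha x y u u' v v' = regularPart x y u u' v v' := by
  have h' : ‖y - x‖ ^ 2 + 0 ≠ 0 := norm_sub_sq_add_zero_ne h.symm
  have key : ∀ w, fderiv ℝ (fun x' => d2 alpha x' y w v v') x
      = fderiv ℝ (fun x' => ⟪regFlux 0 y (cross v v') x', w⟫) x := fun w => by
    -- The formula for `d2` holds on the open set `x' ≠ y`, which suffices to differentiate it at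
    -- `x`.
    refine Filter.EventuallyEq.fderiv_eq ?_
    filter_upwards [isOpen_ne.mem_nhds h] with x' hx'
    rw [d2_alpha hx']
  have hd := (hasFDerivAt_regFlux 0 (cross v v')
    (norm_sub_sq_add_zero_ne h)).differentiableAt
  rw [d1d2, key, key, inner_fderiv hd, inner_fderiv hd, ← inner_curl_cross,
    curl_regFlux 0 _ h', regularPart_eq, norm_sub_rev y x, ← neg_sub x y]
  simp only [inner_neg_left, inner_add_left, real_inner_smul_left]
  simp
  ring

theorem contDiffOn_alpha : ContDiffOn ℝ ∞ (fun q : E × E => alpha q.1 q.2) {q | q.1 ≠ q.2} := by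
  intro q hq
  have hq' : ‖q.1 - q.2‖ ^ 2 ≠ 0 := by simpa [sub_eq_zero] using hq
  refine ContDiffAt.contDiffWithinAt ?_
  have hz : ContDiffAt ℝ ∞ (fun q : E × E => q.1 - q.2) q := by fun_prop
  have h1 : ContDiffAt ℝ ∞ (fun q : E × E => 2 / ‖q.1 - q.2‖ ^ 2) q :=
    contDiffAt_const.div (hz.norm_sq ℝ) hq'
  have h2 : ContDiff ℝ ∞ (fun q : E × E => ∑ i, (q.1 - q.2) i • dx i) :=
    ContDiff.sum fun i _ => ((dx i).contDiff.comp (contDiff_fst.sub contDiff_snd)).smul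
      contDiff_const
  unfold alpha tensor
  exact (h1.smul (h2.smulRight h2).contDiffAt).sub contDiffAt_const

/-- Both factors lie in the plane orthogonal to `x`, so their product lies on the line of `x`. -/
theorem cross_eq_smul_of_tangent {x u u' : E} (hx : ‖x‖ = 1) (h : ⟪x, u⟫ = 0) (h' : ⟪x, u'⟫ = 0) :
    cross u u' = ⟪x, cross u u'⟫ • x := by
  have h1 := norm_sq_smul_of_cross_eq_zero (cross_cross_of_orthogonal h h')
  have h2 : ‖cross u u'‖ ^ 2 • x = ⟪x, cross u u'⟫ • cross u u' := h1
  have h3 : cross x (cross u u') = 0 := cross_cross_of_orthogonal h h'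
  have h4 : cross (cross u u') x = 0 := by
    have : cross (cross u u') x = - cross x (cross u u') :=
      ext_coord (by simp; ring) (by simp; ring) (by simp; ring)
    rw [this, h3, neg_zero]
  have := norm_sq_smul_of_cross_eq_zero h4
  rwa [hx, one_pow, one_smul, real_inner_comm] at this

theorem norm_sub_sq_of_sphere {x y : E} (hx : ‖x‖ = 1) (hy : ‖y‖ = 1) :
    ‖x - y‖ ^ 2 = 2 - 2 * ⟪x, y⟫ := by
  rw [norm_sub_sq_real, hx, hy]; ring

/-- The normals are `x` and `y`, and `⟪x - y, x⟫ = |x - y|²/2 = -⟪x - y, y⟫`; the powers of `|x -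
y|` cancel and leave `-1`. -/
theorem d1d2_alpha_sphere {x y : S2} (h : x ≠ y) {u u' v v' : E} (hu : ⟪(x : E), u⟫ = 0)
    (hu' : ⟪(x : E), u'⟫ = 0) (hv : ⟪(y : E), v⟫ = 0) (hv' : ⟪(y : E), v'⟫ = 0) :
    d1d2 alpha x y u u' v v' = -(areaForm x u u' * areaForm y v v') := by
  have hx : ‖(x : E)‖ = 1 := norm_eq_of_mem_sphere x
  have hy : ‖(y : E)‖ = 1 := norm_eq_of_mem_sphere y
  have hne : (x : E) ≠ y := fun h' => h (Subtype.ext h')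
  have hz : ‖(x : E) - y‖ ^ 2 ≠ 0 := by simpa [sub_eq_zero] using hne
  rw [d1d2_alpha hne, regularPart_eq, areaForm, areaForm, cross_eq_smul_of_tangent hx hu hu',
    cross_eq_smul_of_tangent hy hv hv']
  simp only [real_inner_smul_right, inner_sub_left, real_inner_self_eq_norm_sq, hx, hy,
    real_inner_comm (x : E) y]
  rw [div_eq_iff (pow_ne_zero 2 hz), norm_sub_sq_of_sphere hx hy]
  ring

/-! ### Charts of the sphere adapted to a function -/

/-- The open square of half side `δ` around the origin of `ℝ²`. -/
def square (δ : ℝ) : Set (ℝ × ℝ) := Ioo (-δ) δ ×ˢ Ioo (-δ) δ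

theorem isOpen_square (δ : ℝ) : IsOpen (square δ) := isOpen_Ioo.prod isOpen_Ioo

theorem square_eq_ball (δ : ℝ) : square δ = Metric.ball (0 : ℝ × ℝ) δ := by
  rw [square, show (0 : ℝ × ℝ) = (0, 0) from rfl, ← ball_prod_same, Real.ball_eq_Ioo]
  simp

/-- `Ψ` parametrizes the part of the sphere in the open set `O` by the coordinates
`x ↦ (⟪x, q⟫, ρ x)`. -/
structure IsChart (ρ : E → ℝ) (q : E) (Ψ : ℝ × ℝ → E) (δ : ℝ) (O : Set E) : Prop where
  pos : 0 < δ
  isOpen : IsOpen O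
  contDiff : ContDiff ℝ ∞ ρ
  contDiffOn : ContDiffOn ℝ 2 Ψ (square δ)
  norm_eq : ∀ w ∈ square δ, ‖Ψ w‖ = 1
  inner_eq : ∀ w ∈ square δ, ⟪Ψ w, q⟫ = w.1
  apply_eq : ∀ w ∈ square δ, ρ (Ψ w) = w.2
  mem : ∀ w ∈ square δ, Ψ w ∈ O
  coord_mem : ∀ x ∈ O, ‖x‖ = 1 → (⟪x, q⟫, ρ x) ∈ square δ
  apply_coord : ∀ x ∈ O, ‖x‖ = 1 → Ψ (⟪x, q⟫, ρ x) = x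
  cross_pos : ∀ x ∈ O, 0 < ⟪cross x (gradient ρ x), q⟫

theorem continuous_gradient {ρ : E → ℝ} (hρ : ContDiff ℝ ∞ ρ) : Continuous (gradient ρ) :=
  (InnerProductSpace.toDual ℝ E).symm.continuous.comp (hρ.continuous_fderiv (by simp))

theorem inner_gradient {ρ : E → ℝ} (x v : E) : ⟪gradient ρ x, v⟫ = fderiv ℝ ρ x v :=
  inner_gradient_left

/-- Embedding of the coordinate plane of a chart at height one. -/
def coordPlane (w : ℝ × ℝ) : E := !₂[1, w.2, w.1]

theorem contDiff_coordPlane : ContDiff ℝ ∞ coordPlane := by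
  rw [contDiff_euclidean]
  intro i
  fin_cases i <;> simp [coordPlane] <;> fun_prop

/-- The coordinates `(|x|², ρ x, ⟪x, q⟫)`. -/
def coordMap (ρ : E → ℝ) (q : E) (x : E) : E := !₂[‖x‖ ^ 2, ρ x, ⟪x, q⟫]

theorem contDiff_coordMap {ρ : E → ℝ} (hρ : ContDiff ℝ ∞ ρ) (q : E) :
    ContDiff ℝ ∞ (coordMap ρ q) := by
  rw [contDiff_euclidean]
  intro i
  fin_cases i
  · exact contDiff_norm_sq ℝ
  · exact hρ
  · exact contDiff_id.inner ℝ contDiff_const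

/-- The three coordinates have gradients `2p`, `∇ρ(p)` and `q = p × ∇ρ(p)` at `p`. A vector
orthogonal to the first two is parallel to `q ≠ 0`, and orthogonality to `q` then kills it. -/
theorem injective_fderiv_coordMap {ρ : E → ℝ} (hρ : ContDiff ℝ ∞ ρ) {p : E}
    (hq : cross p (gradient ρ p) ≠ 0) :
    Function.Injective (fderiv ℝ (coordMap ρ (cross p (gradient ρ p))) p) := by
  set q := cross p (gradient ρ p) with hqdef
  rw [injective_iff_map_eq_zero]
  intro w hw
  have hd : DifferentiableAt ℝ (coordMap ρ q) p :=
    (contDiff_coordMap hρ q).differentiable (by simp) p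
  have hi : ∀ i : Fin 3, fderiv ℝ (fun x => coordMap ρ q x i) p w = 0 := by
    intro i
    have h1 := ((dx i).hasFDerivAt.comp p
      hd.hasFDerivAt).fderiv
    have h2 : fderiv ℝ (fun x => coordMap ρ q x i) p
      = (dx i).comp (fderiv ℝ (coordMap ρ q) p) := h1
    rw [h2, ContinuousLinearMap.comp_apply, hw, map_zero]
  have h0 : fderiv ℝ (fun x : E => ‖x‖ ^ 2) p w = 0 := hi 0
  have h1 : fderiv ℝ ρ p w = 0 := hi 1
  have h2 : fderiv ℝ (fun x => ⟪x, q⟫) p w = 0 := hi 2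
  have h0' := ((hasFDerivAt_id p).norm_sq).fderiv
  simp only [id] at h0'
  rw [h0'] at h0
  rw [← inner_gradient, real_inner_comm] at h1
  rw [inner_fderiv (F := fun x : E => x) differentiableAt_id] at h2
  simp at h0 h2
  have h3 := norm_sq_smul_of_cross_eq_zero
    (cross_cross_of_orthogonal ((real_inner_comm _ _).trans h0) h1)
  rw [← hqdef, h2, zero_smul, smul_eq_zero] at h3
  rcases h3 with h3 | h3
  · exact absurd h3 (pow_ne_zero 2 (norm_ne_zero_iff.2 hq))
  · exact h3

/-- The inverse function theorem for `coordMap`, restricted to the slice `|x|² = 1`. -/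
theorem exists_isChart {ρ : E → ℝ} (hρ : ContDiff ℝ ∞ ρ) {p : E} (hp : ‖p‖ = 1) (h0 : ρ p = 0)
    (hq : cross p (gradient ρ p) ≠ 0) {N : Set E} (hN : N ∈ 𝓝 p) :
    ∃ Ψ δ O, p ∈ O ∧ O ⊆ N ∧ IsChart ρ (cross p (gradient ρ p)) Ψ δ O := by
  have hinj := injective_fderiv_coordMap hρ hq
  set q := cross p (gradient ρ p) with hqdef
  let D := (LinearEquiv.ofInjectiveEndo (fderiv ℝ (coordMap ρ q) p : E →ₗ[ℝ] E)
    hinj).toContinuousLinearEquiv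
  have hF : ContDiffAt ℝ 2 (coordMap ρ q) p :=
    (contDiff_coordMap hρ q).contDiffAt.of_le two_le_infty
  have hD : HasFDerivAt (coordMap ρ q) (D : E →L[ℝ] E) p := by
    have h := (hF.differentiableAt (by norm_num)).hasFDerivAt
    exact h
  let H := hF.toOpenPartialHomeomorph (coordMap ρ q) hD (by norm_num)
  have hHc : ∀ x, H x = coordMap ρ q x := fun x => rfl
  have hpS : p ∈ H.source := hF.mem_toOpenPartialHomeomorph_source hD (by norm_num)
  have hFp : coordMap ρ q p = coordPlane 0 := by
    have : ⟪p, q⟫ = 0 := inner_cross_left _ _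
    simp [coordMap, coordPlane, hp, h0, this]
  have hpT : coordPlane 0 ∈ H.target := hFp ▸ H.map_source hpS
  have hG : ContDiffAt ℝ 2 H.symm (coordPlane 0) := by
    have := hF.to_localInverse hD (by norm_num)
    rwa [hFp] at this
  have hGp : H.symm (coordPlane 0) = p := by rw [← hFp, ← hHc]; exact H.left_inv hpS
  let V : Set E := {x | 0 < ⟪cross x (gradient ρ x), q⟫} ∩ interior N
  have hposO : IsOpen V :=
    (isOpen_lt continuous_const ((continuous_cross.comp
      (continuous_id.prodMk (continuous_gradient hρ))).inner continuous_const)).inter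
      isOpen_interior
  have hposp : p ∈ V := by
    refine ⟨?_, mem_interior_iff_mem_nhds.2 hN⟩
    change 0 < ⟪q, q⟫
    rw [real_inner_self_eq_norm_sq]
    positivity
  have hcP : Continuous coordPlane := contDiff_coordPlane.continuous
  have hnear : ∀ᶠ w in 𝓝 (0 : ℝ × ℝ), coordPlane w ∈ H.target ∧
      ContDiffAt ℝ 2 H.symm (coordPlane w) ∧
      H.symm (coordPlane w) ∈ V := by
    refine hcP.continuousAt.eventually (p := fun z => z ∈ H.target ∧ ContDiffAt ℝ 2 H.symm z ∧
      H.symm z ∈ V) ?_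
    refine Filter.Eventually.and (H.open_target.mem_nhds hpT) ((hG.eventually (by simp)).and ?_)
    refine hG.continuousAt.eventually_mem ?_
    rw [hGp]
    exact hposO.mem_nhds hposp
  obtain ⟨δ, hδ, hball⟩ := Metric.eventually_nhds_iff_ball.1 hnear
  rw [← square_eq_ball] at hball
  have hcont : Continuous fun x : E => ((⟪x, q⟫, ρ x) : ℝ × ℝ) :=
    (continuous_id.inner continuous_const).prodMk hρ.continuous
  have key : ∀ w ∈ square δ, ‖H.symm (coordPlane w)‖ = 1 ∧
      ⟪H.symm (coordPlane w), q⟫ = w.1 ∧ ρ (H.symm (coordPlane w)) = w.2 := by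
    intro w hw
    have h1 : coordMap ρ q (H.symm (coordPlane w)) = coordPlane w :=
      H.right_inv (hball w hw).1
    have e0 := congrArg (fun z : E => z 0) h1
    have e1 := congrArg (fun z : E => z 1) h1
    have e2 := congrArg (fun z : E => z 2) h1
    change ‖_‖ ^ 2 = (1 : ℝ) at e0
    exact ⟨(pow_eq_one_iff_of_nonneg (norm_nonneg _) two_ne_zero).1 e0, e2, e1⟩
  have hplane : ∀ x, ‖x‖ = 1 → coordPlane (⟪x, q⟫, ρ x) = coordMap ρ q x := fun x hx => by
    simp [coordMap, coordPlane, hx]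
  -- Requiring the coordinates to lie in the square makes the chart a bijection onto the part of the
  -- sphere in `O`.
  refine ⟨H.symm ∘ coordPlane, δ, (H.source ∩ V) ∩
    (fun x => ((⟪x, q⟫, ρ x) : ℝ × ℝ)) ⁻¹' square δ, ⟨⟨hpS, hposp⟩, ?_⟩,
    fun x hx => interior_subset hx.1.2.2, hδ,
    (H.open_source.inter hposO).inter ((isOpen_square δ).preimage hcont), hρ, ?_,
    fun w hw => (key w hw).1, fun w hw => (key w hw).2.1, fun w hw => (key w hw).2.2, ?_,
    fun x hx _ => hx.2, ?_, fun x hx => hx.1.2.1⟩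
  · have : ⟪p, q⟫ = 0 := inner_cross_left _ _
    simp [square, h0, this, hδ]
  · intro w hw
    exact (((hball w hw).2.1).comp w
      (contDiff_coordPlane.contDiffAt.of_le two_le_infty)).contDiffWithinAt
  · intro w hw
    refine ⟨⟨H.map_target (hball w hw).1, (hball w hw).2.2⟩, ?_⟩
    simp only [mem_preimage, Function.comp, (key w hw).2.1, (key w hw).2.2]
    exact hw
  · intro x hx hx1
    simp only [Function.comp, hplane x hx1]
    exact H.left_inv hx.1.1

namespace IsChart

variable {ρ : E → ℝ} {q : E} {Ψ : ℝ × ℝ → E} {δ : ℝ} {O : Set E}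

/-- The first partial derivative of a chart. -/
def du (Ψ : ℝ × ℝ → E) (w : ℝ × ℝ) : E := fderiv ℝ Ψ w (1, 0)

/-- The second partial derivative of a chart. -/
def dv (Ψ : ℝ × ℝ → E) (w : ℝ × ℝ) : E := fderiv ℝ Ψ w (0, 1)

/-- The reciprocal of the Jacobian of a chart. -/
def invJac (ρ : E → ℝ) (q : E) (x : E) : ℝ := ⟪cross x (gradient ρ x), q⟫

theorem contDiffAt (h : IsChart ρ q Ψ δ O) {w : ℝ × ℝ} (hw : w ∈ square δ) :
    ContDiffAt ℝ 2 Ψ w :=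
  h.contDiffOn.contDiffAt ((isOpen_square δ).mem_nhds hw)

theorem hasFDerivAt (h : IsChart ρ q Ψ δ O) {w : ℝ × ℝ} (hw : w ∈ square δ) :
    HasFDerivAt Ψ (fderiv ℝ Ψ w) w :=
  ((h.contDiffAt hw).differentiableAt (by norm_num)).hasFDerivAt

theorem inner_self_fderiv (h : IsChart ρ q Ψ δ O) {w : ℝ × ℝ} (hw : w ∈ square δ) (k : ℝ × ℝ) :
    ⟪Ψ w, fderiv ℝ Ψ w k⟫ = 0 := by
  have h1 := (h.hasFDerivAt hw).norm_sq
  have h2 : HasFDerivAt (fun w => ‖Ψ w‖ ^ 2) (0 : ℝ × ℝ →L[ℝ] ℝ) w := by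
    refine (hasFDerivAt_const (1 : ℝ) w).congr_of_eventuallyEq ?_
    filter_upwards [(isOpen_square δ).mem_nhds hw] with w' hw'
    rw [h.norm_eq w' hw', one_pow]
  have := congrArg (fun L => L k) (h1.unique h2)
  simpa using this

theorem inner_fderiv_q (h : IsChart ρ q Ψ δ O) {w : ℝ × ℝ} (hw : w ∈ square δ) (k : ℝ × ℝ) :
    ⟪fderiv ℝ Ψ w k, q⟫ = k.1 := by
  rw [← inner_fderiv (h.hasFDerivAt hw).differentiableAt]
  have h2 : HasFDerivAt (fun w => ⟪Ψ w, q⟫) (ContinuousLinearMap.fst ℝ ℝ ℝ) w := by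
    refine (hasFDerivAt_fst (p := w)).congr_of_eventuallyEq ?_
    filter_upwards [(isOpen_square δ).mem_nhds hw] with w' hw'
    rw [h.inner_eq w' hw']
  rw [h2.fderiv]; rfl

theorem inner_gradient_fderiv (h : IsChart ρ q Ψ δ O) {w : ℝ × ℝ} (hw : w ∈ square δ)
    (k : ℝ × ℝ) : ⟪gradient ρ (Ψ w), fderiv ℝ Ψ w k⟫ = k.2 := by
  have h1 := ((h.contDiff.differentiable (by simp) (Ψ w)).hasFDerivAt).comp w (h.hasFDerivAt hw)
  have h2 : HasFDerivAt (ρ ∘ Ψ) (ContinuousLinearMap.snd ℝ ℝ ℝ) w := by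
    refine (hasFDerivAt_snd (p := w)).congr_of_eventuallyEq ?_
    filter_upwards [(isOpen_square δ).mem_nhds hw] with w' hw'
    exact h.apply_eq w' hw'
  have := congrArg (fun L => L k) (h1.unique h2)
  rw [inner_gradient]
  simpa using this

theorem invJac_pos (h : IsChart ρ q Ψ δ O) {w : ℝ × ℝ} (hw : w ∈ square δ) :
    0 < invJac ρ q (Ψ w) := h.cross_pos _ (h.mem w hw)

/-- Along the first coordinate `|Ψ|` and `ρ` are constant, so `du` is parallel to `Ψ × ∇ρ`; the
factor is fixed by `⟪du, q⟫ = 1`. -/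
theorem du_eq (h : IsChart ρ q Ψ δ O) {w : ℝ × ℝ} (hw : w ∈ square δ) :
    du Ψ w = (invJac ρ q (Ψ w))⁻¹ • cross (Ψ w) (gradient ρ (Ψ w)) := by
  have hm := h.invJac_pos hw
  have h1 := norm_sq_smul_of_cross_eq_zero (cross_cross_of_orthogonal
    ((real_inner_comm _ _).trans (h.inner_self_fderiv hw (1, 0)))
    ((real_inner_comm _ _).trans (h.inner_gradient_fderiv hw (1, 0))))
  set c := cross (Ψ w) (gradient ρ (Ψ w)) with hc
  have hc0 : ‖c‖ ^ 2 ≠ 0 := by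
    refine pow_ne_zero 2 (norm_ne_zero_iff.2 fun hz => ?_)
    rw [invJac, ← hc, hz, inner_zero_left] at hm
    exact lt_irrefl _ hm
  have h2 := congrArg (fun z => ⟪z, q⟫) h1
  simp only [real_inner_smul_left, h.inner_fderiv_q hw] at h2
  rw [mul_one] at h2
  have h3 : ‖c‖ ^ 2 • du Ψ w = ‖c‖ ^ 2 • ((invJac ρ q (Ψ w))⁻¹ • c) := by
    rw [du, h1, h2, invJac, ← hc, smul_smul, mul_assoc, mul_inv_cancel₀, mul_one]
    rw [invJac, ← hc] at hm
    exact hm.ne'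
  exact smul_right_injective E hc0 h3

/-- The minus sign means that the chart reverses orientation. It offsets the sign in
`green_halfPlane`, so that the boundary of `ρ < 0` is run in the direction `du`. -/
theorem inner_cross_du_dv (h : IsChart ρ q Ψ δ O) {w : ℝ × ℝ} (hw : w ∈ square δ) :
    ⟪Ψ w, cross (du Ψ w) (dv Ψ w)⟫ = -(invJac ρ q (Ψ w))⁻¹ := by
  have h1 := h.inner_self_fderiv hw (0, 1)
  have h2 := h.inner_gradient_fderiv hw (0, 1)
  change ⟪Ψ w, dv Ψ w⟫ = 0 at h1
  change ⟪gradient ρ (Ψ w), dv Ψ w⟫ = 1 at h2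
  have h3 := h.norm_eq w hw
  rw [h.du_eq hw, cross_smul_left, real_inner_smul_right, inner_cross_comm]
  have h4 : ⟪cross (Ψ w) (cross (Ψ w) (gradient ρ (Ψ w))), dv Ψ w⟫
      = ⟪Ψ w, gradient ρ (Ψ w)⟫ * ⟪Ψ w, dv Ψ w⟫ - ‖Ψ w‖ ^ 2 * ⟪gradient ρ (Ψ w), dv Ψ w⟫ := by
    simp only [inner_eq_coord, norm_sq_eq_coord, cross_zero_apply, cross_one_apply,
      cross_two_apply]; ring
  rw [h4, h1, h2, h3]; ring

theorem cross_du_dv (h : IsChart ρ q Ψ δ O) {w : ℝ × ℝ} (hw : w ∈ square δ) :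
    cross (du Ψ w) (dv Ψ w) = -(invJac ρ q (Ψ w))⁻¹ • Ψ w := by
  rw [cross_eq_smul_of_tangent (h.norm_eq w hw) (u := du Ψ w) (u' := dv Ψ w)
    (h.inner_self_fderiv hw _) (h.inner_self_fderiv hw _), h.inner_cross_du_dv hw]

theorem injOn (h : IsChart ρ q Ψ δ O) : InjOn Ψ (square δ) := fun w hw w' hw' he =>
  Prod.ext (by rw [← h.inner_eq w hw, he, h.inner_eq w' hw'])
    (by rw [← h.apply_eq w hw, he, h.apply_eq w' hw'])

theorem coord_apply (h : IsChart ρ q Ψ δ O) {w : ℝ × ℝ} (hw : w ∈ square δ) :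
    ((⟪Ψ w, q⟫, ρ (Ψ w)) : ℝ × ℝ) = w :=
  Prod.ext (h.inner_eq w hw) (h.apply_eq w hw)

end IsChart

/-! ### The area measure in a chart -/

/-- The coordinates of `ℝ³` as an element of `ℝ × ℝ²`. -/
def splitCoord (w : E) : ℝ × (ℝ × ℝ) := (w 0, (w 1, w 2))

theorem measurePreserving_splitCoord : MeasurePreserving splitCoord := by
  have h1 : MeasurePreserving (fun w : E => w.ofLp) := PiLp.volume_preserving_ofLp (Fin 3)
  have h2 := volume_preserving_piFinSuccAbove (fun _ : Fin 3 => ℝ) 0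
  have h3 := (MeasurePreserving.id (volume : Measure ℝ)).prod (volume_preserving_finTwoArrow ℝ)
  exact h3.comp (h2.comp h1)

theorem det_of_columns (D : E →L[ℝ] E) : D.det = ⟪D (e 0), cross (D (e 1)) (D (e 2))⟫ := by
  have h : D.det = (LinearMap.toMatrix (EuclideanSpace.basisFun (Fin 3) ℝ).toBasis
    (EuclideanSpace.basisFun (Fin 3) ℝ).toBasis (D : E →ₗ[ℝ] E)).det := by
    rw [LinearMap.det_toMatrix]
  rw [h, Matrix.det_fin_three]
  simp only [LinearMap.toMatrix_apply, inner_eq_coord, cross_zero_apply, cross_one_apply,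
    cross_two_apply]
  simp [e]
  ring

namespace IsChart

variable {ρ : E → ℝ} {q : E} {Ψ : ℝ × ℝ → E} {δ : ℝ} {O : Set E}

theorem measurableSet_inter_preimage (h : IsChart ρ q Ψ δ O) {B : Set E} (hB : MeasurableSet B) :
    MeasurableSet (Ψ ⁻¹' B ∩ square δ) := by
  have h1 : Measurable ((square δ).domRestrict Ψ) :=
    (continuousOn_iff_continuous_domRestrict.1 h.contDiffOn.continuousOn).measurable
  have h2 := (isOpen_square δ).measurableSet.subtype_image (h1 hB)
  convert h2 using 1
  ext w
  simp [and_comm, Set.domRestrict]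

/-- The cone over a chart. -/
def coneMap (Ψ : ℝ × ℝ → E) (w : E) : E := w 0 • Ψ (w 1, w 2)

theorem hasFDerivAt_coneMap (h : IsChart ρ q Ψ δ O) {w : E} (hw : (w 1, w 2) ∈ square δ) :
    HasFDerivAt (coneMap Ψ) (w 0 • (fderiv ℝ Ψ (w 1, w 2)).comp ((dx 1).prod (dx 2))
      + (dx 0).smulRight (Ψ (w 1, w 2))) w :=
  ((dx 0).hasFDerivAt (x := w)).smul
    ((h.hasFDerivAt hw).comp w ((dx 1).prod (dx 2)).hasFDerivAt)

theorem det_coneMap (h : IsChart ρ q Ψ δ O) {w : E} (hw : (w 1, w 2) ∈ square δ) :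
    (w 0 • (fderiv ℝ Ψ (w 1, w 2)).comp ((dx 1).prod (dx 2))
      + (dx 0).smulRight (Ψ (w 1, w 2))).det = -(w 0 ^ 2 * (invJac ρ q (Ψ (w 1, w 2)))⁻¹) := by
  rw [det_of_columns]
  have e0 : (w 0 • (fderiv ℝ Ψ (w 1, w 2)).comp ((dx 1).prod (dx 2))
      + (dx 0).smulRight (Ψ (w 1, w 2))) (e 0) = Ψ (w 1, w 2) := by
    simp [dx, show ((0 : ℝ), (0 : ℝ)) = 0 from rfl]
  have e1 : (w 0 • (fderiv ℝ Ψ (w 1, w 2)).comp ((dx 1).prod (dx 2))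
      + (dx 0).smulRight (Ψ (w 1, w 2))) (e 1) = w 0 • du Ψ (w 1, w 2) := by
    simp [dx, du]
  have e2 : (w 0 • (fderiv ℝ Ψ (w 1, w 2)).comp ((dx 1).prod (dx 2))
      + (dx 0).smulRight (Ψ (w 1, w 2))) (e 2) = w 0 • dv Ψ (w 1, w 2) := by
    simp [dx, dv]
  rw [e0, e1, e2, cross_smul_left, cross_smul_right, real_inner_smul_right,
    real_inner_smul_right, h.inner_cross_du_dv hw]
  ring

theorem injOn_coneMap (h : IsChart ρ q Ψ δ O) :
    InjOn (coneMap Ψ) (splitCoord ⁻¹' (Ioo 0 1 ×ˢ square δ)) := by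
  intro w hw w' hw' he
  have hn := congrArg norm he
  simp only [coneMap, norm_smul, Real.norm_eq_abs] at hn
  have p0 : 0 < w 0 := hw.1.1
  have p0' : 0 < w' 0 := hw'.1.1
  have h1 : w 0 = w' 0 := by
    have a := h.norm_eq _ hw.2
    have b := h.norm_eq _ hw'.2
    simp only [splitCoord] at a b
    rwa [a, b, mul_one, mul_one, abs_of_pos p0, abs_of_pos p0'] at hn
  simp only [coneMap, h1] at he
  have h2 := h.injOn hw.2 hw'.2 (smul_right_injective E p0'.ne' he)
  simp only [splitCoord, Prod.mk.injEq] at h2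
  exact ext_coord h1 h2.1 h2.2

/-- The Jacobian of the cone separates into `r²` and the area density. The factor `∫₀¹ r² dr = 1/3`
cancels against the dimension in the definition of `toSphere`. -/
theorem volume_cone (h : IsChart ρ q Ψ δ O) {Q : Set (ℝ × ℝ)} (hQ : MeasurableSet Q)
    (hQs : Q ⊆ square δ) :
    volume (coneMap Ψ '' (splitCoord ⁻¹' (Ioo 0 1 ×ˢ Q)))
      = 3⁻¹ * ∫⁻ w in Q, ENNReal.ofReal (invJac ρ q (Ψ w))⁻¹ := by
  have hm : MeasurableSet (Ioo (0 : ℝ) 1 ×ˢ Q) := measurableSet_Ioo.prod hQ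
  have hsub : splitCoord ⁻¹' (Ioo 0 1 ×ˢ Q) ⊆ splitCoord ⁻¹' (Ioo 0 1 ×ˢ square δ) :=
    preimage_mono (prod_mono Subset.rfl hQs)
  have hms := measurePreserving_splitCoord.measurable hm
  rw [← lintegral_abs_det_fderiv_eq_addHaar_image volume hms
    (fun w hw => (h.hasFDerivAt_coneMap (hQs hw.2)).hasFDerivWithinAt)
    (h.injOn_coneMap.mono hsub)]
  have hmJ : AEMeasurable (fun w => ENNReal.ofReal (invJac ρ q (Ψ w))⁻¹) (volume.restrict Q) := by
    refine AEMeasurable.ennreal_ofReal (AEMeasurable.inv ?_)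
    refine ContinuousOn.aemeasurable ?_ hQ
    have hc : Continuous (invJac ρ q) := (continuous_cross.comp
      (continuous_id.prodMk (continuous_gradient h.contDiff))).inner continuous_const
    exact hc.comp_continuousOn (h.contDiffOn.continuousOn.mono hQs)
  calc ∫⁻ w in splitCoord ⁻¹' (Ioo 0 1 ×ˢ Q), ENNReal.ofReal |(w 0 • (fderiv ℝ Ψ
        (w 1, w 2)).comp ((dx 1).prod (dx 2)) + (dx 0).smulRight (Ψ (w 1, w 2))).det|
      = ∫⁻ w in splitCoord ⁻¹' (Ioo 0 1 ×ˢ Q), (fun z : ℝ × (ℝ × ℝ) =>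
          ENNReal.ofReal (z.1 ^ 2) * ENNReal.ofReal (invJac ρ q (Ψ z.2))⁻¹) (splitCoord w) := by
        refine setLIntegral_congr_fun hms fun w hw => ?_
        have hp := inv_pos.2 (h.invJac_pos (hQs hw.2))
        simp only [splitCoord] at hp ⊢
        rw [h.det_coneMap (hQs hw.2), abs_neg, abs_of_nonneg (by positivity),
          ENNReal.ofReal_mul (by positivity)]
    _ = ∫⁻ z in Ioo 0 1 ×ˢ Q, ENNReal.ofReal (z.1 ^ 2) *
          ENNReal.ofReal (invJac ρ q (Ψ z.2))⁻¹ := by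
        have hmp := measurePreserving_splitCoord.restrict_preimage hm
        rw [← hmp.map_eq, lintegral_map' _ hmp.measurable.aemeasurable]
        rw [hmp.map_eq, show (volume : Measure (ℝ × (ℝ × ℝ))) = volume.prod volume from rfl,
          ← Measure.prod_restrict]
        exact AEMeasurable.mul (by fun_prop) hmJ.comp_snd
    _ = 3⁻¹ * ∫⁻ w in Q, ENNReal.ofReal (invJac ρ q (Ψ w))⁻¹ := by
        rw [show (volume : Measure (ℝ × (ℝ × ℝ))) = volume.prod volume from rfl,
          ← Measure.prod_restrict, lintegral_prod_mul (f := fun x : ℝ => ENNReal.ofReal (x ^ 2)) (by fun_prop) hmJ]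
        congr 1
        rw [← ofReal_integral_eq_lintegral_ofReal]
        · rw [← integral_Ioc_eq_integral_Ioo, ← intervalIntegral.integral_of_le zero_le_one,
            integral_pow]
          norm_num
          rw [one_div, ENNReal.ofReal_inv_of_pos (by norm_num)]
          norm_num
        · exact (Continuous.integrableOn_Icc (by fun_prop)).mono_set Ioo_subset_Icc_self
        · exact Filter.Eventually.of_forall fun x => sq_nonneg x

theorem aemeasurable (h : IsChart ρ q Ψ δ O) : AEMeasurable Ψ (volume.restrict (square δ)) :=
  h.contDiffOn.continuousOn.aemeasurable (isOpen_square δ).measurableSet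

open scoped Pointwise in
/-- In a chart the area measure has density `1 / invJac`. -/
theorem map_sigma_restrict (h : IsChart ρ q Ψ δ O) :
    (σ.map ((↑) : S2 → E)).restrict O = ((volume.restrict (square δ)).withDensity
      fun w => ENNReal.ofReal (invJac ρ q (Ψ w))⁻¹).map Ψ := by
  refine Measure.ext fun B hB => ?_
  have hQ := h.measurableSet_inter_preimage hB
  rw [Measure.restrict_apply hB, Measure.map_apply measurable_subtype_coe
    (hB.inter h.isOpen.measurableSet), Measure.map_apply_of_aemeasurable
    (h.aemeasurable.mono_ac (withDensity_absolutelyContinuous _ _)) hB, withDensity_apply',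
    Measure.restrict_restrict' (isOpen_square δ).measurableSet, σ,
    Measure.toSphere_apply' _ (measurable_subtype_coe (hB.inter h.isOpen.measurableSet))]
  -- `toSphere` measures a set by three times the volume of the cone over it; in a chart this cone
  -- is parametrized by `coneMap`.
  have hcone : Ioo (0 : ℝ) 1 • (((↑) : S2 → E) '' ((↑) ⁻¹' (B ∩ O)))
      = coneMap Ψ '' (splitCoord ⁻¹' (Ioo 0 1 ×ˢ (Ψ ⁻¹' B ∩ square δ))) := by
    ext x
    simp only [Set.mem_smul, mem_image, mem_preimage]
    constructor
    · rintro ⟨r, hr, _, ⟨y, hy, rfl⟩, rfl⟩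
      have hy1 : ‖(y : E)‖ = 1 := norm_eq_of_mem_sphere y
      have hc := h.apply_coord _ hy.2 hy1
      refine ⟨!₂[r, ⟪(y : E), q⟫, ρ y], ⟨hr, ?_, h.coord_mem _ hy.2 hy1⟩, ?_⟩
      · change Ψ (⟪(y : E), q⟫, ρ y) ∈ B
        rw [hc]; exact hy.1
      · change r • Ψ (⟪(y : E), q⟫, ρ y) = _
        rw [hc]
    · rintro ⟨w, ⟨hr, hB', hs⟩, rfl⟩
      exact ⟨w 0, hr, Ψ (w 1, w 2), ⟨⟨Ψ (w 1, w 2), mem_sphere_zero_iff_norm.2 (h.norm_eq _ hs)⟩,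
        ⟨hB', h.mem _ hs⟩, rfl⟩, rfl⟩
  rw [hcone, h.volume_cone hQ inter_subset_right, ← mul_assoc]
  simp only [finrank_euclideanSpace, Fintype.card_fin]
  rw [show ((3 : ℕ) : ENNReal) * 3⁻¹ = 1 from ENNReal.mul_inv_cancel (by simp) (by simp), one_mul]

/-- Integrals of functions on the sphere that vanish outside a chart. -/
theorem integral_sigma (h : IsChart ρ q Ψ δ O) {f : E → ℝ} (hf : StronglyMeasurable f)
    (h0 : ∀ x : S2, (x : E) ∉ O → f x = 0) :
    ∫ x : S2, f x ∂σ = ∫ w in square δ, (invJac ρ q (Ψ w))⁻¹ * f (Ψ w) := by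
  have h1 : ∫ x : S2, f x ∂σ = ∫ x in O, f x ∂(σ.map ((↑) : S2 → E)) := by
    rw [setIntegral_map h.isOpen.measurableSet hf.aestronglyMeasurable
      measurable_subtype_coe.aemeasurable, setIntegral_eq_integral_of_forall_compl_eq_zero]
    exact fun x hx => h0 x hx
  have hm : AEMeasurable (fun w => (invJac ρ q (Ψ w))⁻¹) (volume.restrict (square δ)) := by
    refine AEMeasurable.inv (ContinuousOn.aemeasurable ?_ (isOpen_square δ).measurableSet)
    have hc : Continuous (invJac ρ q) := (continuous_cross.comp
      (continuous_id.prodMk (continuous_gradient h.contDiff))).inner continuous_const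
    exact hc.comp_continuousOn h.contDiffOn.continuousOn
  rw [h1, h.map_sigma_restrict, integral_map
    (h.aemeasurable.mono_ac (withDensity_absolutelyContinuous _ _)) hf.aestronglyMeasurable,
    integral_withDensity_eq_integral_toReal_smul₀ hm.ennreal_ofReal (by simp)]
  refine setIntegral_congr_fun (isOpen_square δ).measurableSet fun w hw => ?_
  simp only [smul_eq_mul]
  rw [ENNReal.toReal_ofReal (inv_pos.2 (h.invJac_pos hw)).le]

end IsChart

/-! ### Hausdorff measure of curves -/

section Curve

open scoped NNReal ENNReal

variable {γ : ℝ → E} {A B : Set ℝ}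

/-- Being `η`-close to affine with velocity `v`, the curve is Lipschitz with constant `|v| + η`.
Replacing `|v|` by `|γ'| + η` costs the second `η`. -/
theorem hausdorffMeasure_image_le_of_approx {v : E} {η : ℝ≥0} (hB : MeasurableSet B)
    (happ : ∀ s ∈ B, ∀ t ∈ B, ‖γ s - γ t - (s - t) • v‖ ≤ η * |s - t|)
    (hder : ∀ s ∈ B, ‖deriv γ s - v‖ ≤ η) :
    μH[1] (γ '' B) ≤ (∫⁻ s in B, ‖deriv γ s‖ₑ) + 2 * η * volume B := by
  have hlip : LipschitzOnWith (‖v‖₊ + η) γ B := by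
    refine LipschitzOnWith.of_dist_le_mul fun s hs t ht => ?_
    rw [dist_eq_norm, Real.dist_eq]
    have h1 : γ s - γ t = (γ s - γ t - (s - t) • v) + (s - t) • v := by abel
    calc ‖γ s - γ t‖ ≤ ‖γ s - γ t - (s - t) • v‖ + ‖(s - t) • v‖ := by
          conv_lhs => rw [h1]
          exact norm_add_le _ _
      _ ≤ η * |s - t| + |s - t| * ‖v‖ := by
          rw [norm_smul, Real.norm_eq_abs]; gcongr; exact happ s hs t ht
      _ = _ := by simp; ring
  have h1 := hlip.hausdorffMeasure_image_le zero_le_one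
  rw [hausdorffMeasure_real, ENNReal.rpow_one] at h1
  refine h1.trans ?_
  calc ((‖v‖₊ + η : ℝ≥0) : ℝ≥0∞) * volume B = ∫⁻ _ in B, (‖v‖ₑ + η) := by
        rw [setLIntegral_const, ENNReal.coe_add]; rfl
    _ ≤ ∫⁻ s in B, (‖deriv γ s‖ₑ + 2 * η) := by
        refine setLIntegral_mono' hB fun s hs => ?_
        have h2 : ‖v‖ₑ ≤ ‖deriv γ s‖ₑ + η := by
          have : v = deriv γ s - (deriv γ s - v) := by abel
          calc ‖v‖ₑ ≤ ‖deriv γ s‖ₑ + ‖deriv γ s - v‖ₑ := by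
                conv_lhs => rw [this]
                exact enorm_sub_le
            _ ≤ _ := by
                gcongr
                rw [enorm_le_coe]
                exact_mod_cast hder s hs
        calc ‖v‖ₑ + η ≤ ‖deriv γ s‖ₑ + η + η := by gcongr
          _ = _ := by ring
    _ = _ := by rw [lintegral_add_right _ measurable_const, setLIntegral_const]

theorem le_hausdorffMeasure_image_of_approx {v : E} {η : ℝ≥0} (hB : MeasurableSet B)
    (happ : ∀ s ∈ B, ∀ t ∈ B, ‖γ s - γ t - (s - t) • v‖ ≤ η * |s - t|)
    (hder : ∀ s ∈ B, ‖deriv γ s - v‖ ≤ η) (hinj : InjOn γ B) :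
    ∫⁻ s in B, ‖deriv γ s‖ₑ ≤ μH[1] (γ '' B) + 2 * η * volume B := by
  have hle : ∫⁻ s in B, ‖deriv γ s‖ₑ ≤ (‖v‖ₑ + η) * volume B := by
    rw [← setLIntegral_const]
    refine setLIntegral_mono' hB fun s hs => ?_
    have : deriv γ s = v + (deriv γ s - v) := by abel
    calc ‖deriv γ s‖ₑ ≤ ‖v‖ₑ + ‖deriv γ s - v‖ₑ := by
          conv_lhs => rw [this]
          exact enorm_add_le _ _
      _ ≤ _ := by
          gcongr
          rw [enorm_le_coe]
          exact_mod_cast hder s hs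
  refine hle.trans ?_
  -- For `|v| ≤ η` the integral is at most `2η|B|` already. Otherwise the inverse of `γ` on `γ '' B`
  -- is Lipschitz with constant `(|v| - η)⁻¹`.
  rcases le_or_gt ‖v‖₊ η with hv | hv
  · refine le_trans ?_ le_add_self
    gcongr
    rw [two_mul]
    gcongr
    exact_mod_cast hv
  · have hpos : 0 < ‖v‖₊ - η := tsub_pos_of_lt hv
    have hlip : LipschitzOnWith (‖v‖₊ - η)⁻¹ (Function.invFunOn γ B) (γ '' B) := by
      refine LipschitzOnWith.of_dist_le_mul ?_
      rintro _ ⟨s, hs, rfl⟩ _ ⟨t, ht, rfl⟩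
      rw [hinj.leftInvOn_invFunOn hs, hinj.leftInvOn_invFunOn ht, Real.dist_eq, dist_eq_norm,
        NNReal.coe_inv, inv_mul_eq_div, le_div_iff₀ (by exact_mod_cast hpos),
        NNReal.coe_sub hv.le, coe_nnnorm]
      have h1 : (s - t) • v = (γ s - γ t) - (γ s - γ t - (s - t) • v) := by abel
      have h2 : |s - t| * ‖v‖ ≤ ‖γ s - γ t‖ + η * |s - t| := by
        rw [← Real.norm_eq_abs, ← norm_smul, h1]
        refine (norm_sub_le _ _).trans ?_
        gcongr
        exact happ s hs t ht
      linarith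
    have h1 := hlip.hausdorffMeasure_image_le zero_le_one
    rw [hinj.invFunOn_image Subset.rfl, hausdorffMeasure_real, ENNReal.rpow_one] at h1
    have h2 : (((‖v‖₊ - η : ℝ≥0)) : ℝ≥0∞) * volume B ≤ μH[1] (γ '' B) := by
      calc _ ≤ (((‖v‖₊ - η : ℝ≥0)) : ℝ≥0∞) * ((((‖v‖₊ - η)⁻¹ : ℝ≥0) : ℝ≥0∞) * μH[1] (γ '' B)) := by
            gcongr
        _ = _ := by
            rw [← mul_assoc, ← ENNReal.coe_mul, mul_inv_cancel₀ hpos.ne', ENNReal.coe_one, one_mul]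
    calc (‖v‖ₑ + η) * volume B = (((‖v‖₊ - η : ℝ≥0)) : ℝ≥0∞) * volume B + 2 * η * volume B := by
          rw [← add_mul]
          congr 1
          have : (‖v‖₊ : ℝ≥0) + η = (‖v‖₊ - η) + 2 * η := by
            rw [two_mul, ← add_assoc, tsub_add_cancel_of_le hv.le]
          rw [show ‖v‖ₑ = ((‖v‖₊ : ℝ≥0) : ℝ≥0∞) from rfl, ← ENNReal.coe_add, this]
          push_cast; rfl
      _ ≤ _ := by gcongr

theorem exists_approx_nhds {I : Set ℝ} (hI : IsOpen I) (hγ : ContDiffOn ℝ 1 γ I) {η : ℝ≥0}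
    (hη : 0 < η) {s₀ : ℝ} (hs₀ : s₀ ∈ I) :
    ∃ U, IsOpen U ∧ s₀ ∈ U ∧
      (∀ s ∈ U, ∀ t ∈ U, ‖γ s - γ t - (s - t) • deriv γ s₀‖ ≤ η * |s - t|) ∧
      ∀ s ∈ U, ‖deriv γ s - deriv γ s₀‖ ≤ η := by
  have hc : ContDiffAt ℝ 1 γ s₀ := hγ.contDiffAt (hI.mem_nhds hs₀)
  have hs := hc.hasStrictDerivAt one_ne_zero
  obtain ⟨V, hV, happ⟩ := hs.hasStrictFDerivAt.approximates_deriv_on_nhds (c := η) (Or.inr hη)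
  have hd : ContinuousAt (deriv γ) s₀ :=
    (hγ.continuousOn_deriv_of_isOpen hI le_rfl).continuousAt (hI.mem_nhds hs₀)
  have hW := hd.eventually (Metric.closedBall_mem_nhds (deriv γ s₀) (NNReal.coe_pos.2 hη))
  obtain ⟨U, hU, hUo, hsU⟩ := mem_nhds_iff.1 (Filter.inter_mem hV hW)
  refine ⟨U, hUo, hsU, fun s hs t ht => ?_, fun s hs => ?_⟩
  · simpa using happ s (hU hs).1 t (hU ht).1
  · simpa [dist_eq_norm] using (hU hs).2

/-- Countably many of the neighbourhoods from `exists_approx_nhds` cover `A` by the Lindelöf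
property; `disjointed` turns the cover into a partition. -/
theorem exists_approx_partition {I : Set ℝ} (hI : IsOpen I) (hγ : ContDiffOn ℝ 1 γ I) {η : ℝ≥0}
    (hη : 0 < η) (hA : MeasurableSet A) (hAI : A ⊆ I) :
    ∃ (B : ℕ → Set ℝ) (v : ℕ → E), (∀ n, MeasurableSet (B n)) ∧ Pairwise (Function.onFun Disjoint B) ∧
      (⋃ n, B n) = A ∧
      (∀ n, ∀ s ∈ B n, ∀ t ∈ B n, ‖γ s - γ t - (s - t) • v n‖ ≤ η * |s - t|) ∧
      ∀ n, ∀ s ∈ B n, ‖deriv γ s - v n‖ ≤ η := by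
  rcases A.eq_empty_or_nonempty with rfl | hne
  · exact ⟨fun _ => ∅, fun _ => 0, by simp, fun _ _ _ => disjoint_bot_left, by simp, by simp,
      by simp⟩
  choose! U hUo hsU happ hder using fun s hs => exists_approx_nhds hI hγ hη (s₀ := s) hs
  obtain ⟨T, hTA, hTc, hTU⟩ := TopologicalSpace.countable_cover_nhdsWithin (s := A) (f := U)
    fun s hs => mem_nhdsWithin_of_mem_nhds ((hUo s (hAI hs)).mem_nhds (hsU s (hAI hs)))
  have hTne : T.Nonempty := by
    obtain ⟨a, ha⟩ := hne
    obtain ⟨s, hs, -⟩ := mem_iUnion₂.1 (hTU ha)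
    exact ⟨s, hs⟩
  obtain ⟨g, rfl⟩ := hTc.exists_eq_range hTne
  have hgI : ∀ n, g n ∈ I := fun n => hAI (hTA (mem_range_self n))
  have hsub : ∀ n, A ∩ disjointed (fun n => U (g n)) n ⊆ U (g n) := fun n =>
    inter_subset_right.trans (disjointed_subset _ _)
  refine ⟨fun n => A ∩ disjointed (fun n => U (g n)) n, fun n => deriv γ (g n),
    fun n => hA.inter (.disjointed (fun n => (hUo _ (hgI n)).measurableSet) n),
    fun m n hmn => ((disjoint_disjointed _ hmn).mono inter_subset_right inter_subset_right), ?_,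
    fun n s hs t ht => happ _ (hgI n) s (hsub n hs) t (hsub n ht),
    fun n s hs => hder _ (hgI n) s (hsub n hs)⟩
  rw [← inter_iUnion, iUnion_disjointed, inter_eq_left]
  simpa using hTU

/-- The length of a `C¹` curve without self-intersections, for the Hausdorff measure. -/
theorem hausdorffMeasure_curve {I : Set ℝ} (hI : IsOpen I) (hfin : volume I ≠ ⊤)
    (hγ : ContDiffOn ℝ 1 γ I) (hinj : InjOn γ I) (hA : MeasurableSet A) (hAI : A ⊆ I) :
    μH[1] (γ '' A) = ∫⁻ s in A, ‖deriv γ s‖ₑ := by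
  have hv : volume A ≠ ⊤ := ne_top_of_le_ne_top hfin (measure_mono hAI)
  -- The local estimates add up over the partition, with total error `2η|A|`, which is arbitrarily
  -- small because `A` has finite measure.
  have main : ∀ η : ℝ≥0, 0 < η →
      μH[1] (γ '' A) ≤ (∫⁻ s in A, ‖deriv γ s‖ₑ) + 2 * η * volume A ∧
      (∫⁻ s in A, ‖deriv γ s‖ₑ) ≤ μH[1] (γ '' A) + 2 * η * volume A := by
    intro η hη
    obtain ⟨B, v, hBm, hBd, rfl, happ, hder⟩ := exists_approx_partition hI hγ hη hA hAI
    have hBI : ∀ n, B n ⊆ I := fun n => (subset_iUnion B n).trans hAI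
    have e1 : μH[1] (γ '' ⋃ n, B n) = ∑' n, μH[1] (γ '' B n) := by
      rw [image_iUnion, measure_iUnion]
      · intro m n hmn
        exact (hBd hmn).image hinj (hBI m) (hBI n)
      · exact fun n => (hBm n).image_of_continuousOn_injOn (hγ.continuousOn.mono (hBI n))
          (hinj.mono (hBI n))
    have e2 : ∫⁻ s in ⋃ n, B n, ‖deriv γ s‖ₑ = ∑' n, ∫⁻ s in B n, ‖deriv γ s‖ₑ :=
      lintegral_iUnion hBm hBd _
    have e3 : 2 * (η : ℝ≥0∞) * volume (⋃ n, B n) = ∑' n, 2 * (η : ℝ≥0∞) * volume (B n) := by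
      rw [measure_iUnion hBd hBm, ENNReal.tsum_mul_left]
    rw [e1, e2, e3, ← ENNReal.tsum_add, ← ENNReal.tsum_add]
    exact ⟨ENNReal.tsum_le_tsum fun n =>
        hausdorffMeasure_image_le_of_approx (hBm n) (happ n) (hder n),
      ENNReal.tsum_le_tsum fun n => le_hausdorffMeasure_image_of_approx (hBm n) (happ n) (hder n)
        (hinj.mono (hBI n))⟩
  have hsmall : ∀ ε : ℝ≥0, 0 < ε → ∃ η : ℝ≥0, 0 < η ∧ 2 * (η : ℝ≥0∞) * volume A ≤ ε := by
    intro ε hε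
    lift volume A to ℝ≥0 using hv with a
    -- The summand `1` keeps the denominator positive when `A` is null.
    refine ⟨ε / (2 * (a + 1)), by positivity, ?_⟩
    norm_cast
    rw [← NNReal.coe_le_coe]
    push_cast
    have ha := a.2
    rw [mul_div_assoc', div_mul_eq_mul_div, div_le_iff₀ (by positivity)]
    nlinarith [ε.2, mul_nonneg ε.2 ha]
  refine le_antisymm ?_ ?_ <;> refine ENNReal.le_of_forall_pos_le_add fun ε hε _ => ?_ <;>
    obtain ⟨η, hη, hle⟩ := hsmall ε hε
  · exact (main η hη).1.trans (by gcongr)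
  · exact (main η hη).2.trans (by gcongr)

end Curve

/-! ### Green's formula in a half plane -/

/-- Integration by parts against the constant function `1`. -/
theorem integral_fderiv_eq_zero {X : Type*} [NormedAddCommGroup X] [NormedSpace ℝ X]
    [FiniteDimensional ℝ X] [MeasurableSpace X] [BorelSpace X] (μ : Measure X) [μ.IsAddHaarMeasure]
    {f : X → ℝ} (hf : ContDiff ℝ 1 f) (hc : HasCompactSupport f) (v : X) :
    ∫ x, fderiv ℝ f x v ∂μ = 0 := by
  have hd : Continuous fun x => fderiv ℝ f x v :=
    (hf.continuous_fderiv one_ne_zero).clm_apply continuous_const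
  have hcd : HasCompactSupport fun x => fderiv ℝ f x v := hc.fderiv_apply (𝕜 := ℝ) v
  have h := integral_mul_fderiv_eq_neg_fderiv_mul_of_integrable (μ := μ) (f := fun _ : X => (1 : ℝ))
    (g := f) (v := v) (by simp) (by simpa using hd.integrable_of_hasCompactSupport hcd)
    (by simpa using hf.continuous.integrable_of_hasCompactSupport hc)
    (fun x _ => differentiableAt_const _) (fun x _ => hf.differentiable one_ne_zero x)
  simpa using h

theorem integrable_fderiv_apply {X : Type*} [NormedAddCommGroup X] [NormedSpace ℝ X]
    [FiniteDimensional ℝ X] [MeasurableSpace X] [BorelSpace X] (μ : Measure X) [μ.IsAddHaarMeasure]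
    {f : X → ℝ} (hf : ContDiff ℝ 1 f) (hc : HasCompactSupport f) (v : X) :
    Integrable (fun x => fderiv ℝ f x v) μ :=
  ((hf.continuous_fderiv one_ne_zero).clm_apply continuous_const).integrable_of_hasCompactSupport
    (hc.fderiv_apply (𝕜 := ℝ) v)

theorem hasCompactSupport_slice_left {X Y : Type*} [TopologicalSpace X] [TopologicalSpace Y]
    [T2Space X] [T2Space Y] {g : X × Y → ℝ} (hc : HasCompactSupport g) (y : Y) :
    HasCompactSupport fun x => g (x, y) :=
  HasCompactSupport.intro (hc.image continuous_fst) fun _ hx =>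
    image_eq_zero_of_notMem_tsupport fun h => hx ⟨_, h, rfl⟩

theorem hasCompactSupport_slice_right {X Y : Type*} [TopologicalSpace X] [TopologicalSpace Y]
    [T2Space X] [T2Space Y] {g : X × Y → ℝ} (hc : HasCompactSupport g) (x : X) :
    HasCompactSupport fun y => g (x, y) :=
  HasCompactSupport.intro (hc.image continuous_snd) fun _ hy =>
    image_eq_zero_of_notMem_tsupport fun h => hy ⟨_, h, rfl⟩

/-- The derivative of `a` integrates to zero over every horizontal line. On vertical half lines that
of `b` leaves its value on the axis, as the support is compact. -/
theorem green_halfPlane {a b : ℝ × ℝ → ℝ} (ha : ContDiff ℝ 1 a) (hac : HasCompactSupport a)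
    (hb : ContDiff ℝ 1 b) (hbc : HasCompactSupport b) :
    ∫ w in {w : ℝ × ℝ | w.2 < 0}, (fderiv ℝ a w (1, 0) - fderiv ℝ b w (0, 1))
      = -∫ s, b (s, 0) := by
  have hset : {w : ℝ × ℝ | w.2 < 0} = univ ×ˢ Iio 0 := by ext; simp
  have hIa := integrable_fderiv_apply volume ha hac (1, 0)
  have hIb := integrable_fderiv_apply volume hb hbc (0, 1)
  rw [hset, integral_sub hIa.integrableOn hIb.integrableOn]
  have h1 : ∫ w in univ ×ˢ Iio (0 : ℝ), fderiv ℝ a w (1, 0) = 0 := by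
    have hsw := (integrable_swap_iff.2 hIa).integrableOn (s := Iio (0 : ℝ) ×ˢ univ)
    rw [volume_eq_prod, ← setIntegral_prod_swap, setIntegral_prod (fun z : ℝ × ℝ => fderiv ℝ a z.swap (1, 0)) hsw]
    refine integral_eq_zero_of_ae (Filter.Eventually.of_forall fun t => ?_)
    simp only [Prod.swap, Measure.restrict_univ]
    have hs : ∀ s, fderiv ℝ (fun s => a (s, t)) s 1 = fderiv ℝ a (s, t) (1, 0) := fun s => by
      have hp : HasFDerivAt (fun s : ℝ => (s, t)) ((ContinuousLinearMap.id ℝ ℝ).prod 0) s :=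
        (hasFDerivAt_id s).prodMk (hasFDerivAt_const t s)
      have h := HasFDerivAt.comp (g := a) s (ha.differentiable one_ne_zero (s, t)).hasFDerivAt hp
      have h' : fderiv ℝ (fun s => a (s, t)) s = _ := h.fderiv
      rw [h']; simp
    simp only [← hs]
    exact integral_fderiv_eq_zero volume (ha.comp (contDiff_id.prodMk contDiff_const))
      (hasCompactSupport_slice_left hac t) 1
  have h2 : ∫ w in univ ×ˢ Iio (0 : ℝ), fderiv ℝ b w (0, 1) = ∫ s, b (s, 0) := by
    rw [volume_eq_prod, setIntegral_prod _ hIb.integrableOn, Measure.restrict_univ]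
    refine integral_congr_ae (Filter.Eventually.of_forall fun s => ?_)
    have hs : ∀ t, deriv (fun t => b (s, t)) t = fderiv ℝ b (s, t) (0, 1) := fun t => by
      have h := (hb.differentiable one_ne_zero (s, t)).hasFDerivAt.comp t
        ((hasFDerivAt_const s t).prodMk (hasFDerivAt_id t))
      have h' : fderiv ℝ (fun t => b (s, t)) t = _ := h.fderiv
      rw [← fderiv_apply_one_eq_deriv, h']; simp
    simp only [← hs]
    rw [← integral_Iic_eq_integral_Iio]
    exact HasCompactSupport.integral_Iic_deriv_eq (hb.comp (contDiff_const.prodMk contDiff_id))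
      (hasCompactSupport_slice_right hbc s) 0
  rw [h1, h2, zero_sub]

theorem contDiff_of_contDiffOn_of_eq_zero {X : Type*} [NormedAddCommGroup X] [NormedSpace ℝ X]
    {F : Type*} [NormedAddCommGroup F] [NormedSpace ℝ F] {n : WithTop ℕ∞} {f : X → F}
    {U K : Set X} (hU : IsOpen U) (hK : IsClosed K) (hKU : K ⊆ U)
    (hf : ContDiffOn ℝ n f U) (h0 : ∀ x ∉ K, f x = 0) : ContDiff ℝ n f := by
  refine contDiff_iff_contDiffAt.2 fun x => ?_
  by_cases hx : x ∈ K
  · exact hf.contDiffAt (hU.mem_nhds (hKU hx))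
  · refine contDiffAt_const (c := (0 : F)) |>.congr_of_eventuallyEq ?_
    filter_upwards [hK.isOpen_compl.mem_nhds hx] with y hy using h0 y hy

/-! ### Stokes' theorem in a chart -/

theorem curl_eq_zero_of_notMem_tsupport {G : E → E} {x : E} (hx : x ∉ tsupport G) :
    curl G x = 0 := by
  have : fderiv ℝ G x = 0 := by
    by_contra h
    exact hx (support_fderiv_subset ℝ h)
  simp only [curl, this, _root_.zero_apply]
  exact Finset.sum_eq_zero fun k _ => (crossL (e k)).map_zero

namespace IsChart

variable {ρ : E → ℝ} {q : E} {Ψ : ℝ × ℝ → E} {δ : ℝ} {O : Set E} {G : E → E}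

/-- The component of the pull-back of a vector field in the direction `k`. -/
def pull (G : E → E) (Ψ : ℝ × ℝ → E) (δ : ℝ) (k w : ℝ × ℝ) : ℝ :=
  (square δ).indicator (fun w => ⟪G (Ψ w), fderiv ℝ Ψ w k⟫) w

/-- The trace of the support of a vector field in the coordinates of a chart. -/
def coordSupport (ρ : E → ℝ) (q : E) (G : E → E) : Set (ℝ × ℝ) :=
  (fun x : E => ((⟪x, q⟫, ρ x) : ℝ × ℝ)) '' (Metric.sphere 0 1 ∩ tsupport G)

theorem isCompact_coordSupport (h : IsChart ρ q Ψ δ O) : IsCompact (coordSupport ρ q G) :=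
  ((isCompact_sphere 0 1).inter_right (isClosed_tsupport G)).image
    ((continuous_id.inner continuous_const).prodMk h.contDiff.continuous)

theorem coordSupport_subset (h : IsChart ρ q Ψ δ O) (hG : tsupport G ⊆ O) :
    coordSupport ρ q G ⊆ square δ := by
  rintro _ ⟨x, ⟨hx, hxG⟩, rfl⟩
  exact h.coord_mem x (hG hxG) (by simpa using hx)

theorem apply_notMem_tsupport (h : IsChart ρ q Ψ δ O) {w : ℝ × ℝ} (hw : w ∈ square δ)
    (hwk : w ∉ coordSupport ρ q G) : Ψ w ∉ tsupport G := fun hG =>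
  hwk ⟨Ψ w, ⟨by simpa using h.norm_eq w hw, hG⟩, h.coord_apply hw⟩

theorem pull_eq_zero (h : IsChart ρ q Ψ δ O) (k : ℝ × ℝ) {w : ℝ × ℝ}
    (hw : w ∉ coordSupport ρ q G) : pull G Ψ δ k w = 0 := by
  by_cases hs : w ∈ square δ
  · rw [pull, indicator_of_mem hs, image_eq_zero_of_notMem_tsupport
      (h.apply_notMem_tsupport hs hw), inner_zero_left]
  · rw [pull, indicator_of_notMem hs]

theorem contDiff_pull (h : IsChart ρ q Ψ δ O) (hG : ContDiff ℝ 1 G) (hGO : tsupport G ⊆ O)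
    (k : ℝ × ℝ) : ContDiff ℝ 1 (pull G Ψ δ k) := by
  refine contDiff_of_contDiffOn_of_eq_zero (isOpen_square δ) h.isCompact_coordSupport.isClosed
    (h.coordSupport_subset hGO) ?_ fun w hw => h.pull_eq_zero k hw
  have h1 : ContDiffOn ℝ 1 (fun w => ⟪G (Ψ w), fderiv ℝ Ψ w k⟫) (square δ) :=
    (hG.comp_contDiffOn (h.contDiffOn.of_le one_le_two)).inner ℝ
      ((h.contDiffOn.fderiv_of_isOpen (isOpen_square δ) (by norm_num)).clm_apply contDiffOn_const)
  exact h1.congr fun w hw => indicator_of_mem hw _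

theorem hasCompactSupport_pull (h : IsChart ρ q Ψ δ O) (k : ℝ × ℝ) :
    HasCompactSupport (pull G Ψ δ k) :=
  HasCompactSupport.intro h.isCompact_coordSupport fun _ hw => h.pull_eq_zero k hw

theorem fderiv_pull (h : IsChart ρ q Ψ δ O) (hG : ContDiff ℝ 1 G) (k l : ℝ × ℝ) {w : ℝ × ℝ}
    (hw : w ∈ square δ) : fderiv ℝ (pull G Ψ δ k) w l
      = ⟪fderiv ℝ G (Ψ w) (fderiv ℝ Ψ w l), fderiv ℝ Ψ w k⟫
        + ⟪G (Ψ w), fderiv ℝ (fderiv ℝ Ψ) w l k⟫ := by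
  have h1 : pull G Ψ δ k =ᶠ[𝓝 w] fun w => ⟪G (Ψ w), fderiv ℝ Ψ w k⟫ := by
    filter_upwards [(isOpen_square δ).mem_nhds hw] with w' hw'
    exact indicator_of_mem hw' _
  have h2 : HasFDerivAt (fun w => G (Ψ w)) ((fderiv ℝ G (Ψ w)).comp (fderiv ℝ Ψ w)) w :=
    (hG.differentiable one_ne_zero _).hasFDerivAt.comp w (h.hasFDerivAt hw)
  have h3 : HasFDerivAt (fderiv ℝ Ψ) (fderiv ℝ (fderiv ℝ Ψ) w) w :=
    (((h.contDiffAt hw).fderiv_right (m := 1) (by norm_num)).differentiableAt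
      one_ne_zero).hasFDerivAt
  have h4 := h3.clm_apply (hasFDerivAt_const k w)
  rw [h1.fderiv_eq, fderiv_inner_apply ℝ h2.differentiableAt h4.differentiableAt, h2.fderiv,
    h4.fderiv]
  simp [add_comm]

/-- The exterior derivative commutes with pull-back: the terms with second derivatives of `Ψ` cancel
by symmetry, which is why charts are required to be `C²`. -/
theorem fderiv_pull_sub (h : IsChart ρ q Ψ δ O) (hG : ContDiff ℝ 1 G) {w : ℝ × ℝ}
    (hw : w ∈ square δ) :
    fderiv ℝ (pull G Ψ δ (0, 1)) w (1, 0) - fderiv ℝ (pull G Ψ δ (1, 0)) w (0, 1)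
      = -((invJac ρ q (Ψ w))⁻¹ * ⟪Ψ w, curl G (Ψ w)⟫) := by
  have hsymm : IsSymmSndFDerivAt ℝ Ψ w := (h.contDiffAt hw).isSymmSndFDerivAt (by simp)
  rw [h.fderiv_pull hG _ _ hw, h.fderiv_pull hG _ _ hw, hsymm.eq (1, 0) (0, 1),
    add_sub_add_right_eq_sub, ← inner_curl_cross]
  change ⟪curl G (Ψ w), cross (du Ψ w) (dv Ψ w)⟫ = _
  rw [h.cross_du_dv hw, real_inner_smul_right, real_inner_comm]
  ring

theorem fderiv_pull_eq_zero (h : IsChart ρ q Ψ δ O) (k l : ℝ × ℝ) {w : ℝ × ℝ}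
    (hw : w ∉ coordSupport ρ q G) : fderiv ℝ (pull G Ψ δ k) w l = 0 := by
  have : pull G Ψ δ k =ᶠ[𝓝 w] fun _ => 0 := by
    filter_upwards [h.isCompact_coordSupport.isClosed.isOpen_compl.mem_nhds hw] with w' hw'
    exact h.pull_eq_zero k hw'
  rw [this.fderiv_eq]; simp

/-- The set `A` of values of `ρ` is `univ` for the integral over the whole sphere and `Iio 0` for
the side of the boundary on which `Ω` lies. -/
theorem setIntegral_curl (h : IsChart ρ q Ψ δ O) (hG : ContDiff ℝ 1 G) (hGO : tsupport G ⊆ O)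
    {A : Set ℝ} (hA : MeasurableSet A) :
    ∫ x : S2, (ρ ⁻¹' A).indicator (fun x => ⟪x, curl G x⟫) x ∂σ
      = -∫ w in {w : ℝ × ℝ | w.2 ∈ A},
        (fderiv ℝ (pull G Ψ δ (0, 1)) w (1, 0) - fderiv ℝ (pull G Ψ δ (1, 0)) w (0, 1)) := by
  have hcont : Continuous fun x : E => ⟪x, curl G x⟫ :=
    continuous_id.inner (continuous_curl hG)
  rw [h.integral_sigma (hcont.stronglyMeasurable.indicator (h.contDiff.continuous.measurable hA))]
  · rw [← integral_neg, ← integral_indicator (isOpen_square δ).measurableSet,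
      ← integral_indicator (s := {w : ℝ × ℝ | w.2 ∈ A}) (measurable_snd hA)]
    refine integral_congr_ae (Filter.Eventually.of_forall fun w => ?_)
    by_cases hw : w ∈ square δ
    · rw [indicator_of_mem hw]
      by_cases hA' : w.2 ∈ A
      · rw [indicator_of_mem (show w ∈ {w : ℝ × ℝ | w.2 ∈ A} from hA'),
          indicator_of_mem (show Ψ w ∈ ρ ⁻¹' A by rwa [mem_preimage, h.apply_eq w hw]),
          h.fderiv_pull_sub hG hw, neg_neg]
      · rw [indicator_of_notMem (show w ∉ {w : ℝ × ℝ | w.2 ∈ A} from hA'),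
          indicator_of_notMem (show Ψ w ∉ ρ ⁻¹' A by rwa [mem_preimage, h.apply_eq w hw]),
          mul_zero]
    · have hk : w ∉ coordSupport ρ q G := fun hk => hw (h.coordSupport_subset hGO hk)
      rw [indicator_of_notMem hw]
      refine (indicator_apply_eq_zero.2 fun _ => ?_).symm
      rw [h.fderiv_pull_eq_zero _ _ hk, h.fderiv_pull_eq_zero _ _ hk]
      simp
  · intro x hx
    refine indicator_apply_eq_zero.2 fun _ => ?_
    rw [curl_eq_zero_of_notMem_tsupport fun hx' => hx (hGO hx'), inner_zero_right]

theorem integral_curl_eq_zero (h : IsChart ρ q Ψ δ O) (hG : ContDiff ℝ 1 G)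
    (hGO : tsupport G ⊆ O) : ∫ x : S2, ⟪(x : E), curl G x⟫ ∂σ = 0 := by
  have h1 := h.setIntegral_curl hG hGO MeasurableSet.univ
  simp only [preimage_univ, indicator_univ, mem_univ, Set.ofPred_true, Measure.restrict_univ] at h1
  rw [h1, integral_sub (integrable_fderiv_apply _ (h.contDiff_pull hG hGO _)
      (h.hasCompactSupport_pull _) _) (integrable_fderiv_apply _ (h.contDiff_pull hG hGO _)
      (h.hasCompactSupport_pull _) _), integral_fderiv_eq_zero _ (h.contDiff_pull hG hGO _)
      (h.hasCompactSupport_pull _), integral_fderiv_eq_zero _ (h.contDiff_pull hG hGO _)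
      (h.hasCompactSupport_pull _)]
  simp

theorem integral_curl_sublevel (h : IsChart ρ q Ψ δ O) (hG : ContDiff ℝ 1 G)
    (hGO : tsupport G ⊆ O) :
    ∫ x : S2, {x | ρ x < 0}.indicator (fun x => ⟪x, curl G x⟫) (x : E) ∂σ
      = ∫ s in Ioo (-δ) δ, ⟪G (Ψ (s, 0)), du Ψ (s, 0)⟫ := by
  have h1 := h.setIntegral_curl hG hGO (measurableSet_Iio (a := (0 : ℝ)))
  have h2 := green_halfPlane (h.contDiff_pull hG hGO (0, 1)) (h.hasCompactSupport_pull _)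
    (h.contDiff_pull hG hGO (1, 0)) (h.hasCompactSupport_pull _)
  change ∫ x : S2, (ρ ⁻¹' Iio 0).indicator (fun x => ⟪x, curl G x⟫) (x : E) ∂σ = _
  rw [h1]
  change -∫ w in {w : ℝ × ℝ | w.2 < 0}, _ = _
  rw [h2, neg_neg, ← integral_indicator measurableSet_Ioo]
  refine integral_congr_ae (Filter.Eventually.of_forall fun s => ?_)
  have hδ := h.pos
  by_cases hs : s ∈ Ioo (-δ) δ
  · rw [indicator_of_mem hs]
    exact indicator_of_mem (show (s, (0 : ℝ)) ∈ square δ from ⟨hs, by simpa using hδ⟩) _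
  · rw [indicator_of_notMem hs]
    exact indicator_of_notMem (fun h' : (s, (0 : ℝ)) ∈ square δ => hs h'.1) _

end IsChart

/-! ### The boundary of a smooth domain in a chart -/

/-- The unit vector in the direction of `x × ∇ρ(x)`. -/
def unitTangent (ρ : E → ℝ) (x : E) : E :=
  ‖cross x (gradient ρ x)‖⁻¹ • cross x (gradient ρ x)

namespace IsChart

variable {ρ : E → ℝ} {q : E} {Ψ : ℝ × ℝ → E} {δ : ℝ} {O : Set E} {Ω : Set S2}

theorem cross_ne_zero (h : IsChart ρ q Ψ δ O) {x : E} (hx : x ∈ O) :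
    cross x (gradient ρ x) ≠ 0 := fun h0 => by
  have := h.cross_pos x hx
  rw [h0, inner_zero_left] at this
  exact lt_irrefl _ this

/-- The open set `ρ > 0` misses `Ω`. A zero of `ρ` is a limit of points of `Ω`, reached by letting
the second chart coordinate increase to `0`. -/
theorem mem_frontier_iff (h : IsChart ρ q Ψ δ O) (hΩ : IsOpen Ω)
    (hloc : ∀ x : S2, (x : E) ∈ O → (x ∈ Ω ↔ ρ x < 0)) {x : S2} (hx : (x : E) ∈ O) :
    x ∈ frontier Ω ↔ ρ x = 0 := by
  rw [hΩ.frontier_eq, mem_sdiff, hloc x hx, not_lt]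
  constructor
  · rintro ⟨hcl, hge⟩
    refine le_antisymm (not_lt.1 fun hpos => ?_) hge
    have hU : IsOpen {y : S2 | (y : E) ∈ O ∧ 0 < ρ y} :=
      (h.isOpen.preimage continuous_subtype_val).inter
        (isOpen_lt continuous_const (h.contDiff.continuous.comp continuous_subtype_val))
    obtain ⟨y, ⟨hyO, hy⟩, hyΩ⟩ := mem_closure_iff.1 hcl _ hU ⟨hx, hpos⟩
    exact lt_asymm hy ((hloc y hyO).1 hyΩ)
  · intro h0
    refine ⟨?_, h0.ge⟩
    have hx1 : ‖(x : E)‖ = 1 := norm_eq_of_mem_sphere x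
    have hw := h.coord_mem x hx hx1
    have hΨ := h.apply_coord x hx hx1
    rw [h0] at hw hΨ
    rw [closure_subtype]
    have ht : Filter.Tendsto (fun t : ℝ => Ψ (⟪(x : E), q⟫, t)) (𝓝[<] 0) (𝓝 (x : E)) := by
      refine Filter.Tendsto.mono_left ?_ nhdsWithin_le_nhds
      have hc := (h.contDiffAt hw).continuousAt.tendsto.comp
        (f := fun t : ℝ => ((⟪(x : E), q⟫, t) : ℝ × ℝ)) (x := 𝓝 0)
        (Continuous.tendsto' (by fun_prop) _ _ rfl)
      rwa [hΨ] at hc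
    refine mem_closure_of_tendsto ht ?_
    filter_upwards [Ioo_mem_nhdsLT (show -δ < 0 by linarith [h.pos])] with t ht
    have hwt : (⟪(x : E), q⟫, t) ∈ square δ := ⟨hw.1, ht.1, ht.2.trans h.pos⟩
    refine ⟨⟨Ψ (⟪(x : E), q⟫, t), mem_sphere_zero_iff_norm.2 (h.norm_eq _ hwt)⟩, ?_, rfl⟩
    rw [hloc _ (h.mem _ hwt), h.apply_eq _ hwt]
    exact ht.2

theorem tendsto_nhdsWithin (h : IsChart ρ q Ψ δ O) {w : ℝ × ℝ} (hw : w ∈ square δ) :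
    Filter.Tendsto Ψ (𝓝 w) (𝓝[Metric.sphere 0 1] (Ψ w)) := by
  refine tendsto_nhdsWithin_iff.2 ⟨(h.contDiffAt hw).continuousAt, ?_⟩
  filter_upwards [(isOpen_square δ).mem_nhds hw] with w' hw'
  exact mem_sphere_zero_iff_norm.2 (h.norm_eq w' hw')

/-- Two local defining functions have the same oriented unit tangent. -/
theorem unitTangent_eq (h : IsChart ρ q Ψ δ O) (hΩ : IsOpen Ω)
    (hloc : ∀ x : S2, (x : E) ∈ O → (x ∈ Ω ↔ ρ x < 0)) {p : S2} (hp : (p : E) ∈ O)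
    (hpf : p ∈ frontier Ω) {ρ₂ : E → ℝ} (h₂ : IsLocalDefining Ω p ρ₂) :
    unitTangent ρ₂ p = unitTangent ρ p := by
  have hp1 : ‖(p : E)‖ = 1 := norm_eq_of_mem_sphere p
  have h0 : ρ p = 0 := (h.mem_frontier_iff hΩ hloc hp).1 hpf
  have hw := h.coord_mem p hp hp1
  have hΨ := h.apply_coord p hp hp1
  rw [h0] at hw hΨ
  obtain ⟨hsm, h20, hev, hne⟩ := h₂
  set w : ℝ × ℝ := (⟪(p : E), q⟫, 0) with hwdef
  have hev' : ∀ᶠ w' in 𝓝 w, w'.2 < 0 ↔ ρ₂ (Ψ w') < 0 := by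
    have h1 : ∀ᶠ y in 𝓝[Metric.sphere 0 1] (p : E), y ∈ O → (ρ y < 0 ↔ ρ₂ y < 0) := by
      rw [nhdsWithin_eq_map_subtype_coe p.2, Filter.eventually_map]
      filter_upwards [hev] with y hy hyO
      rw [← hy, hloc y hyO]
    rw [← hΨ] at h1
    filter_upwards [(h.tendsto_nhdsWithin hw).eventually h1, (isOpen_square δ).mem_nhds hw]
      with w' h1 h2
    rw [← h1 (h.mem w' h2), h.apply_eq w' h2]
  have hd : ∀ k, HasFDerivAt (ρ₂ ∘ Ψ) ((fderiv ℝ ρ₂ p).comp (fderiv ℝ Ψ w)) w ∧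
      ((fderiv ℝ ρ₂ p).comp (fderiv ℝ Ψ w)) k = ⟪gradient ρ₂ p, fderiv ℝ Ψ w k⟫ := fun k => by
    refine ⟨?_, by rw [inner_gradient]; rfl⟩
    have h1 := (hsm.differentiable (by simp) (Ψ w)).hasFDerivAt
    rw [hΨ] at h1
    refine HasFDerivAt.comp (g := ρ₂) w ?_ (h.hasFDerivAt hw)
    rwa [hΨ]
  have hline : ∀ k : ℝ × ℝ, HasDerivAt (fun t : ℝ => ρ₂ (Ψ (w + t • k)))
      ⟪gradient ρ₂ p, fderiv ℝ Ψ w k⟫ 0 := fun k => by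
    have h1 : HasDerivAt (fun t : ℝ => w + t • k) k 0 := by
      simpa using ((hasDerivAt_id (0 : ℝ)).smul_const k).const_add w
    have h2 := (hd k).1
    rw [← (hd k).2]
    refine HasFDerivAt.comp_hasDerivAt (0 : ℝ) (l := ρ₂ ∘ Ψ) ?_ h1
    simpa using h2
  have hlim : ∀ k : ℝ × ℝ, Filter.Tendsto (fun t : ℝ => w + t • k) (𝓝 0) (𝓝 w) := fun k =>
    Continuous.tendsto' (by fun_prop) _ _ (by simp)
  -- Points of the axis lie outside `Ω`, so `ρ₂ ≥ 0` there, with a minimum at `p`.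
  have hu : ⟪gradient ρ₂ p, du Ψ w⟫ = 0 := by
    refine IsLocalMin.hasDerivAt_eq_zero ?_ (hline (1, 0))
    filter_upwards [(hlim (1, 0)).eventually hev'] with t ht
    have : ¬ ρ₂ (Ψ (w + t • (1, 0))) < 0 := by rw [← ht]; simp [hwdef]
    simpa [hΨ, h20] using this
  -- For negative second coordinate the point is in `Ω` and `ρ₂ < 0`, so the left difference
  -- quotients are nonnegative.
  have hv : 0 ≤ ⟪gradient ρ₂ p, dv Ψ w⟫ := by
    have h1 := (hasDerivAt_iff_tendsto_slope.1 (hline (0, 1))).mono_left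
      (nhdsWithin_mono 0 (fun t (ht : t ∈ Iio (0 : ℝ)) => ne_of_lt ht))
    refine ge_of_tendsto h1 ?_
    filter_upwards [nhdsWithin_le_nhds ((hlim (0, 1)).eventually hev'), self_mem_nhdsWithin]
      with t ht ht0
    have h2 : ρ₂ (Ψ (w + t • (0, 1))) < 0 := by rw [← ht]; simpa [hwdef] using ht0
    have h3 : ρ₂ (Ψ (w + (0 : ℝ) • (0, 1))) = 0 := by simp [hΨ, h20]
    rw [slope_def_field, h3, sub_zero, sub_zero]
    exact div_nonneg_of_nonpos h2.le (le_of_lt ht0)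
  have hu1 : ⟪gradient ρ p, du Ψ w⟫ = 0 := by
    have := h.inner_gradient_fderiv hw (1, 0); rwa [hΨ] at this
  have hv1 : ⟪gradient ρ p, dv Ψ w⟫ = 1 := by
    have := h.inner_gradient_fderiv hw (0, 1); rwa [hΨ] at this
  set lam := ⟪gradient ρ₂ p, dv Ψ w⟫ with hlam
  -- `∇ρ₂ - λ∇ρ` is orthogonal to the tangent plane, hence parallel to `p`, and the products of `p`
  -- with the two gradients differ by the factor `λ`.
  have hz : cross (gradient ρ₂ p - lam • gradient ρ p) (cross (du Ψ w) (dv Ψ w)) = 0 := by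
    refine cross_cross_of_orthogonal ?_ ?_
    · rw [inner_sub_left, real_inner_smul_left, hu, hu1]; ring
    · rw [inner_sub_left, real_inner_smul_left, hv1, ← hlam]; ring
  rw [h.cross_du_dv hw, hΨ, cross_smul_right, smul_eq_zero] at hz
  have hm := h.invJac_pos hw
  rw [hΨ] at hm
  have hz' := hz.resolve_left (neg_ne_zero.2 (inv_pos.2 hm).ne')
  have hc : cross (p : E) (gradient ρ₂ p) = lam • cross (p : E) (gradient ρ p) := by
    have e0 := congrArg (fun z : E => z 0) hz'
    have e1 := congrArg (fun z : E => z 1) hz'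
    have e2 := congrArg (fun z : E => z 2) hz'
    simp at e0 e1 e2
    refine ext_coord ?_ ?_ ?_ <;> simp <;> linarith
  have hlam0 : 0 < lam := lt_of_le_of_ne hv fun h' => hne (by rw [hc, ← h', zero_smul])
  rw [unitTangent, unitTangent, hc, norm_smul, Real.norm_eq_abs, abs_of_pos hlam0, mul_inv,
    smul_smul, mul_comm lam⁻¹, mul_assoc, inv_mul_cancel₀ hlam0.ne', mul_one]

theorem posTangent_eq (h : IsChart ρ q Ψ δ O) (hΩ : IsOpen Ω)
    (hloc : ∀ x : S2, (x : E) ∈ O → (x ∈ Ω ↔ ρ x < 0)) {p : S2} (hp : (p : E) ∈ O)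
    (hpf : p ∈ frontier Ω) : posTangent Ω p = unitTangent ρ p := by
  have hex : ∃ ρ : E → ℝ, IsLocalDefining Ω p ρ := by
    refine ⟨ρ, h.contDiff, (h.mem_frontier_iff hΩ hloc hp).1 hpf, ?_, h.cross_ne_zero hp⟩
    filter_upwards [(h.isOpen.preimage continuous_subtype_val).mem_nhds hp] with x hx
      using hloc x hx
  rw [posTangent, dif_pos hex]
  exact h.unitTangent_eq hΩ hloc hp hpf hex.choose_spec

theorem mem_square_axis (h : IsChart ρ q Ψ δ O) {s : ℝ} (hs : s ∈ Ioo (-δ) δ) :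
    (s, (0 : ℝ)) ∈ square δ := ⟨hs, by simpa using h.pos⟩

theorem contDiffOn_axis (h : IsChart ρ q Ψ δ O) :
    ContDiffOn ℝ 1 (fun s => Ψ (s, 0)) (Ioo (-δ) δ) :=
  (h.contDiffOn.of_le one_le_two).comp (by fun_prop) fun _ hs => h.mem_square_axis hs

theorem deriv_axis (h : IsChart ρ q Ψ δ O) {s : ℝ} (hs : s ∈ Ioo (-δ) δ) :
    deriv (fun s => Ψ (s, 0)) s = du Ψ (s, 0) := by
  have h1 : HasDerivAt (fun s : ℝ => (s, (0 : ℝ))) (1, 0) s :=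
    (hasDerivAt_id s).prodMk (hasDerivAt_const s 0)
  exact ((h.hasFDerivAt (h.mem_square_axis hs)).comp_hasDerivAt s h1).deriv

theorem image_frontier (h : IsChart ρ q Ψ δ O) (hΩ : IsOpen Ω)
    (hloc : ∀ x : S2, (x : E) ∈ O → (x ∈ Ω ↔ ρ x < 0)) (B : Set E) :
    ((↑) : S2 → E) '' ((↑) ⁻¹' (B ∩ O) ∩ frontier Ω)
      = (fun s => Ψ (s, 0)) '' ((fun s => Ψ (s, 0)) ⁻¹' B ∩ Ioo (-δ) δ) := by
  ext x
  constructor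
  · rintro ⟨y, ⟨⟨hyB, hyO⟩, hyf⟩, rfl⟩
    have hy1 : ‖(y : E)‖ = 1 := norm_eq_of_mem_sphere y
    have h0 := (h.mem_frontier_iff hΩ hloc hyO).1 hyf
    have hw := h.coord_mem y hyO hy1
    have hΨ := h.apply_coord y hyO hy1
    rw [h0] at hw hΨ
    refine ⟨⟪(y : E), q⟫, ⟨?_, hw.1⟩, hΨ⟩
    rwa [mem_preimage, hΨ]
  · rintro ⟨s, ⟨hB, hs⟩, rfl⟩
    have hw := h.mem_square_axis hs
    refine ⟨⟨Ψ (s, 0), mem_sphere_zero_iff_norm.2 (h.norm_eq _ hw)⟩, ⟨⟨hB, h.mem _ hw⟩, ?_⟩, rfl⟩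
    rw [h.mem_frontier_iff hΩ hloc (h.mem _ hw)]
    exact h.apply_eq _ hw

theorem arcLength_preimage (h : IsChart ρ q Ψ δ O) (hΩ : IsOpen Ω)
    (hloc : ∀ x : S2, (x : E) ∈ O → (x ∈ Ω ↔ ρ x < 0)) {B : Set E} (hB : MeasurableSet B) :
    arcLength Ω ((↑) ⁻¹' (B ∩ O))
      = ∫⁻ s in (fun s => Ψ (s, 0)) ⁻¹' B ∩ Ioo (-δ) δ, ‖du Ψ (s, 0)‖ₑ := by
  have hm : MeasurableSet ((fun s => Ψ (s, 0)) ⁻¹' B ∩ Ioo (-δ) δ) := by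
    have := (h.measurableSet_inter_preimage hB).preimage
      (f := fun s : ℝ => (s, (0 : ℝ))) (by fun_prop)
    convert this using 1
    ext s
    simp [square, h.pos]
  have hinj : InjOn (fun s => Ψ (s, 0)) (Ioo (-δ) δ) := fun s hs t ht he =>
    congrArg Prod.fst (h.injOn (h.mem_square_axis hs) (h.mem_square_axis ht) he)
  rw [arcLength, Measure.restrict_apply (measurable_subtype_coe (hB.inter h.isOpen.measurableSet)),
    ← isometry_subtype_coe.hausdorffMeasure_image (Or.inl zero_le_one),
    h.image_frontier hΩ hloc, hausdorffMeasure_curve isOpen_Ioo (by simp) h.contDiffOn_axis hinj hm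
      inter_subset_right]
  exact setLIntegral_congr_fun hm fun s hs => by rw [h.deriv_axis hs.2]

theorem continuousOn_du_axis (h : IsChart ρ q Ψ δ O) :
    ContinuousOn (fun s => du Ψ (s, 0)) (Ioo (-δ) δ) :=
  (h.contDiffOn_axis.continuousOn_deriv_of_isOpen isOpen_Ioo le_rfl).congr
    fun _ hs => (h.deriv_axis hs).symm

theorem arcLength_finiteAt (h : IsChart ρ q Ψ δ O) (hΩ : IsOpen Ω)
    (hloc : ∀ x : S2, (x : E) ∈ O → (x ∈ Ω ↔ ρ x < 0)) {p : S2} (hp : (p : E) ∈ O) :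
    (arcLength Ω).FiniteAtFilter (𝓝 p) := by
  -- The smaller bound `r` confines the parameter to a compact interval, on which the speed is
  -- certainly integrable.
  obtain ⟨r, hr1, hr2⟩ : ∃ r, |⟪(p : E), q⟫| < r ∧ r < δ := exists_between (by
    have := (h.coord_mem p hp (norm_eq_of_mem_sphere p)).1
    exact abs_lt.2 this)
  have hB : IsOpen {x : E | |⟪x, q⟫| < r} :=
    isOpen_lt (continuous_id.inner continuous_const).abs continuous_const
  refine ⟨(↑) ⁻¹' ({x : E | |⟪x, q⟫| < r} ∩ O),
    ((hB.inter h.isOpen).preimage continuous_subtype_val).mem_nhds ⟨hr1, hp⟩, ?_⟩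
  rw [h.arcLength_preimage hΩ hloc hB.measurableSet]
  have hsub : (fun s => Ψ (s, 0)) ⁻¹' {x : E | |⟪x, q⟫| < r} ∩ Ioo (-δ) δ ⊆ Icc (-r) r := by
    rintro s ⟨hs, hsI⟩
    have : |⟪Ψ (s, 0), q⟫| < r := hs
    rw [h.inner_eq _ (h.mem_square_axis hsI)] at this
    exact ⟨(abs_lt.1 this).1.le, (abs_lt.1 this).2.le⟩
  have hIcc : Icc (-r) r ⊆ Ioo (-δ) δ := fun s hs => ⟨by linarith [hs.1], by linarith [hs.2]⟩
  refine (lintegral_mono_set hsub).trans_lt ?_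
  exact ((h.continuousOn_du_axis.mono hIcc).integrableOn_Icc).2

theorem map_arcLength_restrict (h : IsChart ρ q Ψ δ O) (hΩ : IsOpen Ω)
    (hloc : ∀ x : S2, (x : E) ∈ O → (x ∈ Ω ↔ ρ x < 0)) :
    ((arcLength Ω).map ((↑) : S2 → E)).restrict O = ((volume.restrict (Ioo (-δ) δ)).withDensity
      fun s => ‖du Ψ (s, 0)‖ₑ).map fun s => Ψ (s, 0) := by
  refine Measure.ext fun B hB => ?_
  have hγ : AEMeasurable (fun s => Ψ (s, 0)) (volume.restrict (Ioo (-δ) δ)) :=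
    h.contDiffOn_axis.continuousOn.aemeasurable measurableSet_Ioo
  rw [Measure.restrict_apply hB, Measure.map_apply measurable_subtype_coe
    (hB.inter h.isOpen.measurableSet), Measure.map_apply_of_aemeasurable
    (hγ.mono_ac (withDensity_absolutelyContinuous _ _)) hB, withDensity_apply',
    Measure.restrict_restrict' measurableSet_Ioo, h.arcLength_preimage hΩ hloc hB]

theorem integral_arcLength (h : IsChart ρ q Ψ δ O) (hΩ : IsOpen Ω)
    (hloc : ∀ x : S2, (x : E) ∈ O → (x ∈ Ω ↔ ρ x < 0)) {f : E → ℝ} (hf : StronglyMeasurable f)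
    (h0 : ∀ x : S2, (x : E) ∉ O → f x = 0) :
    ∫ x : S2, f x ∂(arcLength Ω) = ∫ s in Ioo (-δ) δ, ‖du Ψ (s, 0)‖ * f (Ψ (s, 0)) := by
  have h1 : ∫ x : S2, f x ∂(arcLength Ω) = ∫ x in O, f x ∂((arcLength Ω).map ((↑) : S2 → E)) := by
    rw [setIntegral_map h.isOpen.measurableSet hf.aestronglyMeasurable
      measurable_subtype_coe.aemeasurable, setIntegral_eq_integral_of_forall_compl_eq_zero]
    exact fun x hx => h0 x hx
  have hm : AEMeasurable (fun s => ‖du Ψ (s, 0)‖ₑ) (volume.restrict (Ioo (-δ) δ)) :=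
    (h.continuousOn_du_axis.aemeasurable measurableSet_Ioo).enorm
  have hγ : AEMeasurable (fun s => Ψ (s, 0)) (volume.restrict (Ioo (-δ) δ)) :=
    h.contDiffOn_axis.continuousOn.aemeasurable measurableSet_Ioo
  rw [h1, h.map_arcLength_restrict hΩ hloc, integral_map
    (hγ.mono_ac (withDensity_absolutelyContinuous _ _)) hf.aestronglyMeasurable,
    integral_withDensity_eq_integral_toReal_smul₀ hm (by simp)]
  simp

theorem measurable_unitTangent (hρ : ContDiff ℝ ∞ ρ) : Measurable (unitTangent ρ) := by
  have hc : Continuous fun x => cross x (gradient ρ x) :=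
    continuous_cross.comp (continuous_id.prodMk (continuous_gradient hρ))
  exact (hc.norm.measurable.inv).smul hc.measurable

/-- Stokes' theorem for vector fields supported in a chart. -/
theorem stokes (h : IsChart ρ q Ψ δ O) (hΩ : IsOpen Ω)
    (hloc : ∀ x : S2, (x : E) ∈ O → (x ∈ Ω ↔ ρ x < 0)) {G : E → E} (hG : ContDiff ℝ 1 G)
    (hGO : tsupport G ⊆ O) :
    ∫ x in Ω, ⟪(x : E), curl G x⟫ ∂σ = ∫ x : S2, ⟪G x, posTangent Ω x⟫ ∂(arcLength Ω) := by
  have hG0 : ∀ x : E, x ∉ O → G x = 0 := fun x hx =>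
    image_eq_zero_of_notMem_tsupport fun hx' => hx (hGO hx')
  have h1 : ∫ x in Ω, ⟪(x : E), curl G x⟫ ∂σ
      = ∫ x : S2, {x | ρ x < 0}.indicator (fun x => ⟪x, curl G x⟫) (x : E) ∂σ := by
    rw [← integral_indicator hΩ.measurableSet]
    refine integral_congr_ae (Filter.Eventually.of_forall fun x => ?_)
    by_cases hx : (x : E) ∈ O
    · by_cases hxΩ : x ∈ Ω
      · rw [indicator_of_mem hxΩ]
        exact (indicator_of_mem (M := ℝ) (show (x : E) ∈ {x | ρ x < 0} from (hloc x hx).1 hxΩ)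
          fun x : E => ⟪x, curl G x⟫).symm
      · rw [indicator_of_notMem hxΩ]
        exact (indicator_of_notMem (M := ℝ)
          (show (x : E) ∉ {x | ρ x < 0} from fun h' => hxΩ ((hloc x hx).2 h'))
          fun x : E => ⟪x, curl G x⟫).symm
    · have : ⟪(x : E), curl G x⟫ = 0 := by
        rw [curl_eq_zero_of_notMem_tsupport fun hx' => hx (hGO hx'), inner_zero_right]
      simp only [indicator]
      rw [this, ite_self, ite_self]
  have h2 : ∫ x : S2, ⟪G x, posTangent Ω x⟫ ∂(arcLength Ω)
      = ∫ x : S2, (fun x : E => ⟪G x, unitTangent ρ x⟫) x ∂(arcLength Ω) := by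
    refine setIntegral_congr_fun isClosed_frontier.measurableSet fun x hx => ?_
    by_cases hxO : (x : E) ∈ O
    · simp only [h.posTangent_eq hΩ hloc hxO hx]
    · simp only [hG0 x hxO, inner_zero_left]
  have hmeas : StronglyMeasurable fun x : E => ⟪G x, unitTangent ρ x⟫ :=
    (hG.continuous.measurable.inner (measurable_unitTangent h.contDiff)).stronglyMeasurable
  rw [h1, h.integral_curl_sublevel hG hGO, h2, h.integral_arcLength hΩ hloc hmeas
    fun x hx => by rw [hG0 x hx, inner_zero_left]]
  -- By `du_eq`, `du` is its length times the unit tangent, so the two integrands coincide.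
  refine setIntegral_congr_fun measurableSet_Ioo fun s hs => ?_
  have hw := h.mem_square_axis hs
  have hm := h.invJac_pos hw
  have hc := norm_ne_zero_iff.2 (h.cross_ne_zero (h.mem _ hw))
  simp only [h.du_eq hw, unitTangent, real_inner_smul_right, norm_smul, norm_inv, Real.norm_eq_abs,
    abs_of_pos hm]
  field_simp

end IsChart

/-! ### Stokes' theorem on smooth domains of the sphere -/

instance : IsFiniteMeasure σ := inferInstanceAs (IsFiniteMeasure (volume : Measure E).toSphere)

theorem integrable_sigma {f : S2 → ℝ} (hf : Continuous f) : Integrable f σ :=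
  hf.integrable_of_hasCompactSupport (HasCompactSupport.of_compactSpace f)

theorem eventually_sphere {p : S2} {Q : S2 → Prop} (h : ∀ᶠ x in 𝓝 p, Q x) :
    ∃ N ∈ 𝓝 (p : E), ∀ x : S2, (x : E) ∈ N → Q x := by
  rw [nhds_subtype_eq_comap, Filter.eventually_comap] at h
  exact ⟨_, h, fun x hx => hx x rfl⟩

theorem exists_chart_of_mem_frontier {Ω : Set S2} (hΩ : IsSmoothDomain Ω) {p : S2}
    (hp : p ∈ frontier Ω) : ∃ ρ q Ψ δ O, IsChart ρ q Ψ δ O ∧ (p : E) ∈ O ∧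
      ∀ x : S2, (x : E) ∈ O → (x ∈ Ω ↔ ρ x < 0) := by
  obtain ⟨ρ, hρ, h0, hev, hne⟩ := hΩ.2 p hp
  obtain ⟨N, hN, hNQ⟩ := eventually_sphere hev
  obtain ⟨Ψ, δ, O, hpO, hON, hch⟩ := exists_isChart hρ (norm_eq_of_mem_sphere p) h0 hne hN
  exact ⟨ρ, _, Ψ, δ, O, hch, hpO, fun x hx => hNQ x (hON hx)⟩

theorem gradient_inner_const (a : E) (c : ℝ) (x : E) :
    gradient (fun x : E => ⟪x, a⟫ - c) x = a := by
  refine ext_inner_right ℝ fun v => ?_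
  rw [inner_gradient, fderiv_sub_const, inner_fderiv (F := fun x : E => x) differentiableAt_id]
  simp [real_inner_comm]

theorem contDiff_inner_const (a : E) (c : ℝ) : ContDiff ℝ ∞ fun x : E => ⟪x, a⟫ - c :=
  (contDiff_id.inner ℝ contDiff_const).sub contDiff_const

/-- A chart without reference to a domain: the function is a coordinate `⟪x, e k⟫`, shifted to
vanish at `p`, for an axis that is not parallel to `p`. -/
theorem exists_chart (p : S2) {N : Set E} (hN : N ∈ 𝓝 (p : E)) :
    ∃ ρ q Ψ δ O, IsChart ρ q Ψ δ O ∧ (p : E) ∈ O ∧ O ⊆ N ∧ ρ p = 0 := by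
  have hp : ‖(p : E)‖ = 1 := norm_eq_of_mem_sphere p
  obtain ⟨k, hk⟩ : ∃ k, cross (p : E) (e k) ≠ 0 := by
    by_contra! hall
    have h1 := congrArg (fun z : E => z 2) (hall 0)
    have h2 := congrArg (fun z : E => z 0) (hall 1)
    have h3 := congrArg (fun z : E => z 1) (hall 2)
    simp at h1 h2 h3
    have := norm_sq_eq_coord (p : E)
    rw [hp, h1, h2, h3] at this
    norm_num at this
  have hg := gradient_inner_const (e k) ⟪(p : E), e k⟫ p
  obtain ⟨Ψ, δ, O, hpO, hON, hch⟩ := exists_isChart (contDiff_inner_const (e k) ⟪(p : E), e k⟫) hp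
    (sub_self _) (by rwa [hg]) hN
  exact ⟨_, _, Ψ, δ, O, hch, hpO, hON, sub_self _⟩

theorem IsChart.sigma_zero_set {ρ : E → ℝ} {q : E} {Ψ : ℝ × ℝ → E} {δ : ℝ} {O : Set E}
    (h : IsChart ρ q Ψ δ O) : σ {x : S2 | (x : E) ∈ O ∧ ρ x = 0} = 0 := by
  have hm : MeasurableSet {x : E | ρ x = 0} :=
    h.contDiff.continuous.measurable (measurableSet_singleton 0)
  have h1 : σ {x : S2 | (x : E) ∈ O ∧ ρ x = 0}
      = (σ.map ((↑) : S2 → E)).restrict O {x | ρ x = 0} := by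
    rw [Measure.restrict_apply hm, Measure.map_apply measurable_subtype_coe
      (hm.inter h.isOpen.measurableSet), inter_comm]
    rfl
  rw [h1, h.map_sigma_restrict, Measure.map_apply_of_aemeasurable
    (h.aemeasurable.mono_ac (withDensity_absolutelyContinuous _ _)) hm]
  refine withDensity_absolutelyContinuous _ _ ?_
  rw [Measure.restrict_apply' (isOpen_square δ).measurableSet]
  refine measure_mono_null (t := univ ×ˢ {0}) (fun w hw => ⟨mem_univ _, ?_⟩) ?_
  · rw [← h.apply_eq w hw.2]; exact hw.1
  · rw [volume_eq_prod, Measure.prod_prod]; simp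

theorem sigma_singleton (p : S2) : σ {p} = 0 := by
  obtain ⟨ρ, q, Ψ, δ, O, h, hpO, -, h0⟩ := exists_chart p Filter.univ_mem
  refine measure_mono_null (t := {x : S2 | (x : E) ∈ O ∧ ρ x = 0}) ?_ h.sigma_zero_set
  exact singleton_subset_iff.2 ⟨hpO, h0⟩

section SmoothDomain

variable {Ω : Set S2}

theorem continuousOn_posTangent (hΩ : IsSmoothDomain Ω) :
    ContinuousOn (posTangent Ω) (frontier Ω) := by
  intro p hp
  obtain ⟨ρ, q, Ψ, δ, O, h, hpO, hloc⟩ := exists_chart_of_mem_frontier hΩ hp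
  have hc : Continuous fun x : E => cross x (gradient ρ x) :=
    continuous_cross.comp (continuous_id.prodMk (continuous_gradient h.contDiff))
  have h1 : ContinuousAt (fun x : S2 => unitTangent ρ x) p := by
    have h2 : ContinuousAt (fun x : E => cross x (gradient ρ x)) p := hc.continuousAt
    have h3 : ContinuousAt (unitTangent ρ) p :=
      (h2.norm.inv₀ (norm_ne_zero_iff.2 (h.cross_ne_zero hpO))).smul h2
    exact h3.comp continuous_subtype_val.continuousAt
  refine h1.continuousWithinAt.congr_of_eventuallyEq ?_ (h.posTangent_eq hΩ.1 hloc hpO hp)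
  filter_upwards [self_mem_nhdsWithin, nhdsWithin_le_nhds
    ((h.isOpen.preimage continuous_subtype_val).mem_nhds hpO)] with x hx hxO
    using h.posTangent_eq hΩ.1 hloc hxO hx

theorem norm_posTangent_le (Ω : Set S2) (p : S2) : ‖posTangent Ω p‖ ≤ 1 := by
  rw [posTangent]
  split_ifs with h
  · rw [norm_smul, norm_inv, norm_norm]
    exact inv_mul_le_one
  · simp

theorem aestronglyMeasurable_posTangent (hΩ : IsSmoothDomain Ω) :
    AEStronglyMeasurable (posTangent Ω) (arcLength Ω) :=
  (continuousOn_posTangent hΩ).aestronglyMeasurable isClosed_frontier.measurableSet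

theorem hausdorffMeasure_frontier_lt_top (hΩ : IsSmoothDomain Ω) :
    (μH[1] : Measure S2) (frontier Ω) < ⊤ := by
  have hK : IsCompact (frontier Ω) := isClosed_frontier.isCompact
  have h1 : arcLength Ω (frontier Ω) < ⊤ := by
    refine hK.measure_lt_top_of_nhdsWithin fun p hp => ?_
    obtain ⟨ρ, q, Ψ, δ, O, h, hpO, hloc⟩ := exists_chart_of_mem_frontier hΩ hp
    exact (h.arcLength_finiteAt hΩ.1 hloc hpO).filter_mono nhdsWithin_le_nhds
  rwa [arcLength, Measure.restrict_apply_self] at h1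

theorem isFiniteMeasure_arcLength (hΩ : IsSmoothDomain Ω) : IsFiniteMeasure (arcLength Ω) :=
  ⟨by rw [arcLength, Measure.restrict_apply_univ]; exact hausdorffMeasure_frontier_lt_top hΩ⟩

theorem integrable_inner_posTangent (hΩ : IsSmoothDomain Ω) {F : E → E} (hF : Continuous F) :
    Integrable (fun x : S2 => ⟪F x, posTangent Ω x⟫) (arcLength Ω) := by
  have := isFiniteMeasure_arcLength hΩ
  obtain ⟨C, hC⟩ := isCompact_univ.exists_bound_of_continuousOn
    (hF.comp continuous_subtype_val : Continuous fun x : S2 => F x).continuousOn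
  refine Integrable.of_bound (C := C) ?_ (Filter.Eventually.of_forall fun x => ?_)
  · exact (hF.comp continuous_subtype_val).aestronglyMeasurable.inner
      (aestronglyMeasurable_posTangent hΩ)
  · refine (norm_inner_le_norm _ _).trans ?_
    calc ‖F x‖ * ‖posTangent Ω x‖ ≤ ‖F x‖ * 1 := by gcongr; exact norm_posTangent_le Ω x
      _ ≤ C := by rw [mul_one]; exact hC x (mem_univ _)

/-- At a frontier point this is Stokes' theorem in a straightening chart. Inside `Ω` the boundary
term is absent and the curl has integral zero; outside the closure both sides vanish. -/
theorem stokes_local (hΩ : IsSmoothDomain Ω) (p : S2) : ∃ O : Set E, IsOpen O ∧ (p : E) ∈ O ∧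
    ∀ G : E → E, ContDiff ℝ 1 G → tsupport G ⊆ O →
      ∫ x in Ω, ⟪(x : E), curl G x⟫ ∂σ = ∫ x : S2, ⟪G x, posTangent Ω x⟫ ∂(arcLength Ω) := by
  by_cases hp : p ∈ frontier Ω
  · obtain ⟨ρ, q, Ψ, δ, O, h, hpO, hloc⟩ := exists_chart_of_mem_frontier hΩ hp
    exact ⟨O, h.isOpen, hpO, fun G hG hGO => h.stokes hΩ.1 hloc hG hGO⟩
  have hbd : ∀ (N : Set E) (G : E → E), (∀ x : S2, (x : E) ∈ N → x ∉ frontier Ω) →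
      tsupport G ⊆ N → ∫ x : S2, ⟪G x, posTangent Ω x⟫ ∂(arcLength Ω) = 0 := by
    intro N G hN hG
    refine setIntegral_eq_zero_of_forall_eq_zero fun x hx => ?_
    rw [image_eq_zero_of_notMem_tsupport fun hx' => hN x (hG hx') hx, inner_zero_left]
  by_cases hpΩ : p ∈ Ω
  · obtain ⟨N, hN, hNQ⟩ := eventually_sphere (hΩ.1.mem_nhds hpΩ)
    obtain ⟨ρ, q, Ψ, δ, O, h, hpO, hON, -⟩ := exists_chart p hN
    refine ⟨O, h.isOpen, hpO, fun G hG hGO => ?_⟩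
    rw [hbd N G (fun x hx => ?_) (hGO.trans hON), ← h.integral_curl_eq_zero hG hGO]
    · refine setIntegral_eq_integral_of_forall_compl_eq_zero fun x hx => ?_
      rw [curl_eq_zero_of_notMem_tsupport fun hx' => hx (hNQ x (hON (hGO hx'))), inner_zero_right]
    · rw [hΩ.1.frontier_eq]
      exact fun h' => h'.2 (hNQ x hx)
  · have hpc : p ∈ (closure Ω)ᶜ := fun h' => hp (by rw [hΩ.1.frontier_eq]; exact ⟨h', hpΩ⟩)
    obtain ⟨N, hN, hNQ⟩ := eventually_sphere (isClosed_closure.isOpen_compl.mem_nhds hpc)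
    refine ⟨interior N, isOpen_interior, mem_interior_iff_mem_nhds.2 hN, fun G hG hGO => ?_⟩
    rw [hbd N G (fun x hx hf => hNQ x hx hf.1) (hGO.trans interior_subset)]
    refine setIntegral_eq_zero_of_forall_eq_zero fun x hx => ?_
    rw [curl_eq_zero_of_notMem_tsupport fun hx' => hNQ x (interior_subset (hGO hx'))
      (subset_closure hx), inner_zero_right]

theorem curl_sum {ι : Type*} (s : Finset ι) {F : ι → E → E} {x : E}
    (hF : ∀ i ∈ s, DifferentiableAt ℝ (F i) x) :
    curl (fun x => ∑ i ∈ s, F i x) x = ∑ i ∈ s, curl (F i) x := by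
  simp only [curl, fderiv_fun_sum hF]
  rw [Finset.sum_comm]
  refine Finset.sum_congr rfl fun k _ => ?_
  rw [_root_.sum_apply, ← crossL_apply, _root_.map_sum]
  rfl

/-- **Stokes' theorem** for smooth domains of the sphere. -/
theorem stokes (hΩ : IsSmoothDomain Ω) {F : E → E} (hF : ContDiff ℝ 1 F) :
    ∫ x in Ω, ⟪(x : E), curl F x⟫ ∂σ = ∫ x : S2, ⟪F x, posTangent Ω x⟫ ∂(arcLength Ω) := by
  choose O hOo hpO hO using stokes_local hΩ
  obtain ⟨t, ht⟩ := (isCompact_sphere (0 : E) 1).elim_finite_subcover O hOo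
    fun x hx => mem_iUnion.2 ⟨⟨x, hx⟩, hpO ⟨x, hx⟩⟩
  -- The complement of the sphere is added so that the partition of unity sums to one on all of
  -- `ℝ³`, where the curl is taken; its own member vanishes near the sphere.
  let U : Option t → Set E := fun i => i.elim (Metric.sphere (0 : E) 1)ᶜ fun p => O p
  have hUo : ∀ i, IsOpen (U i) := by
    rintro (_ | p)
    · exact Metric.isClosed_sphere.isOpen_compl
    · exact hOo p
  have hU : (univ : Set E) ⊆ ⋃ i, U i := by
    intro x _
    by_cases hx : x ∈ Metric.sphere (0 : E) 1
    · obtain ⟨p, hp, hxp⟩ := mem_iUnion₂.1 (ht hx)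
      exact mem_iUnion.2 ⟨some ⟨p, hp⟩, hxp⟩
    · exact mem_iUnion.2 ⟨none, hx⟩
  obtain ⟨χ, hχ⟩ := SmoothPartitionOfUnity.exists_isSubordinate (modelWithCornersSelf ℝ E)
    isClosed_univ U hUo hU
  have hχs : ∀ i, ContDiff ℝ ∞ (χ i) := fun i => (χ i).contMDiff.contDiff
  have hG : ∀ i, ContDiff ℝ 1 fun x => χ i x • F x := fun i =>
    ((hχs i).of_le (by simp)).smul hF
  have hsum : ∀ x, F x = ∑ i, χ i x • F x := fun x => by
    rw [← Finset.sum_smul, ← finsum_eq_sum_of_fintype, χ.sum_eq_one (mem_univ x), one_smul]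
  have hloc : ∀ i, ∫ x in Ω, ⟪(x : E), curl (fun x => χ i x • F x) x⟫ ∂σ
      = ∫ x : S2, ⟪χ i x • F x, posTangent Ω x⟫ ∂(arcLength Ω) := by
    rintro (_ | p)
    · have h0 : ∀ x : S2, (x : E) ∉ tsupport fun x => χ none x • F x := fun x hx =>
        hχ none (tsupport_smul_subset_left _ _ hx) x.2
      have h1 : ∀ x : S2, χ none (x : E) • F x = 0 := fun x =>
        image_eq_zero_of_notMem_tsupport (f := fun x : E => χ none x • F x) (h0 x)
      simp only [curl_eq_zero_of_notMem_tsupport (h0 _), h1, inner_zero_left, inner_zero_right,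
        integral_zero]
    · exact hO p _ (hG _) ((tsupport_smul_subset_left _ _).trans (hχ (some p)))
  have hcurl : ∀ x : E, curl F x = ∑ i, curl (fun x => χ i x • F x) x := fun x => by
    rw [← curl_sum _ fun i _ => (hG i).differentiable one_ne_zero x]
    congr 1
    exact funext hsum
  have hl : ∀ x : S2, ⟪(x : E), curl F x⟫ = ∑ i, ⟪(x : E), curl (fun x => χ i x • F x) x⟫ :=
    fun x => by rw [hcurl, inner_sum]
  have hr : ∀ x : S2, ⟪F x, posTangent Ω x⟫ = ∑ i, ⟪χ i x • F x, posTangent Ω x⟫ :=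
    fun x => by rw [← sum_inner, ← hsum]
  simp only [hl, hr]
  rw [integral_finsetSum, integral_finsetSum]
  · exact Finset.sum_congr rfl fun i _ => hloc i
  · exact fun i _ => integrable_inner_posTangent hΩ (hG i).continuous
  · exact fun i _ => (integrable_sigma ((continuous_id.inner (continuous_curl (hG i))).comp
      continuous_subtype_val)).integrableOn

theorem isSmoothDomain_univ : IsSmoothDomain (univ : Set S2) :=
  ⟨isOpen_univ, by simp⟩

theorem integral_curl_eq_zero {F : E → E} (hF : ContDiff ℝ 1 F) :
    ∫ x : S2, ⟪(x : E), curl F x⟫ ∂σ = 0 := by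
  have h := stokes isSmoothDomain_univ hF
  rw [Measure.restrict_univ] at h
  rw [h, arcLength, frontier_univ, Measure.restrict_empty, integral_zero_measure]

end SmoothDomain

/-! ### Regularized kernels on the sphere -/

instance : NullSingletonClass σ := ⟨sigma_singleton⟩

theorem sigma_real_univ : σ.real univ = 4 * Real.pi := by
  rw [σ, Measure.toSphere_real_apply_univ, measureReal_def, EuclideanSpace.volume_ball_fin_three]
  simp only [ENNReal.ofReal_one, one_pow, one_mul, finrank_euclideanSpace, Fintype.card_fin]
  rw [ENNReal.toReal_ofReal (by positivity)]
  push_cast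
  ring

/-- The singular part of the regularized kernel. -/
def peak (c : ℝ) (x y : E) : ℝ := 4 * c / (‖x - y‖ ^ 2 + c) ^ 2

/-- The regular part of the regularized kernel on the sphere. -/
def damping (c : ℝ) (x y : E) : ℝ := 1 - c ^ 2 / (‖x - y‖ ^ 2 + c) ^ 2

section Kernel

variable {c : ℝ}

theorem norm_sq_add_pos (hc : 0 < c) (z : E) : 0 < ‖z‖ ^ 2 + c := by positivity

theorem peak_nonneg (hc : 0 < c) (x y : E) : 0 ≤ peak c x y := by
  unfold peak; positivity

theorem damping_nonneg (hc : 0 < c) (x y : E) : 0 ≤ damping c x y := by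
  have : c ^ 2 / (‖x - y‖ ^ 2 + c) ^ 2 ≤ 1 := by
    refine div_le_one_of_le₀ ?_ (by positivity)
    gcongr
    nlinarith [sq_nonneg ‖x - y‖]
  unfold damping
  linarith

theorem damping_le_one (x y : E) : damping c x y ≤ 1 := by
  have : 0 ≤ c ^ 2 / (‖x - y‖ ^ 2 + c) ^ 2 := by positivity
  unfold damping
  linarith

theorem continuous_peak (hc : 0 < c) : Continuous fun q : E × E => peak c q.1 q.2 := by
  unfold peak
  refine Continuous.div (by fun_prop) (by fun_prop) fun q => ?_
  exact pow_ne_zero 2 (norm_sq_add_pos hc _).ne'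

theorem continuous_damping (hc : 0 < c) : Continuous fun q : E × E => damping c q.1 q.2 := by
  unfold damping
  refine continuous_const.sub (Continuous.div (by fun_prop) (by fun_prop) fun q => ?_)
  exact pow_ne_zero 2 (norm_sq_add_pos hc _).ne'

theorem continuous_peak_sphere (hc : 0 < c) : Continuous fun q : S2 × S2 => peak c q.1 q.2 :=
  (continuous_peak hc).comp (f := fun q : S2 × S2 => ((q.1 : E), (q.2 : E))) (by fun_prop)

theorem continuous_damping_sphere (hc : 0 < c) :
    Continuous fun q : S2 × S2 => damping c q.1 q.2 :=
  (continuous_damping hc).comp (f := fun q : S2 × S2 => ((q.1 : E), (q.2 : E))) (by fun_prop)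

theorem integrable_peak (hc : 0 < c) (x : S2) : Integrable (fun y : S2 => peak c x y) σ :=
  integrable_sigma ((continuous_peak_sphere hc).comp (f := fun y : S2 => (x, y)) (by fun_prop))

theorem integrable_damping (hc : 0 < c) (x : S2) : Integrable (fun y : S2 => damping c x y) σ :=
  integrable_sigma ((continuous_damping_sphere hc).comp (f := fun y : S2 => (x, y))
    (by fun_prop))

theorem contDiff_two_div (hc : 0 < c) {n : WithTop ℕ∞} (y : E) :
    ContDiff ℝ n fun x : E => 2 / (‖x - y‖ ^ 2 + c) :=
  contDiff_const.div (((contDiff_id.sub contDiff_const).norm_sq ℝ).add contDiff_const)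
    fun _ => (norm_sq_add_pos hc _).ne'

theorem contDiff_regField (hc : 0 < c) {n : WithTop ℕ∞} (y v : E) :
    ContDiff ℝ n (regField c y v) :=
  (((contDiff_two_div hc y).mul ((contDiff_id.sub contDiff_const).inner ℝ contDiff_const)).smul
    (contDiff_id.sub contDiff_const)).sub contDiff_const

theorem contDiff_regFlux (hc : 0 < c) {n : WithTop ℕ∞} (x N : E) :
    ContDiff ℝ n (regFlux c x N) := by
  rw [regFlux_eq_neg]
  exact (contDiff_two_div hc x).smul
    (contDiff_cross.comp (contDiff_const.prodMk (contDiff_id.sub contDiff_const)))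

theorem continuous_regFlux (hc : 0 < c) :
    Continuous fun p : E × E × E => regFlux c p.1 p.2.1 p.2.2 := by
  have h1 : Continuous fun p : E × E × E => 2 / (‖p.1 - p.2.2‖ ^ 2 + c) :=
    Continuous.div (by fun_prop) (by fun_prop) fun q => (norm_sq_add_pos hc _).ne'
  have h2 : Continuous fun p : E × E × E => cross (p.1 - p.2.2) p.2.1 :=
    continuous_cross.comp (f := fun p : E × E × E => (p.1 - p.2.2, p.2.1)) (by fun_prop)
  exact h1.smul h2

theorem tendsto_alphaReg (x y u v : E) :
    Filter.Tendsto (fun c => alphaReg c x y u v) (𝓝[>] 0) (𝓝 (alpha x y u v)) := by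
  rw [alpha_apply]
  rcases eq_or_ne x y with rfl | h
  · simp only [alphaReg, sub_self, inner_zero_left, mul_zero]
    exact tendsto_const_nhds
  · refine Filter.Tendsto.mono_left ?_ nhdsWithin_le_nhds
    have : ContinuousAt (fun c => alphaReg c x y u v) 0 := by
      unfold alphaReg
      refine ContinuousAt.sub (ContinuousAt.mul (ContinuousAt.mul (ContinuousAt.div
        continuousAt_const (by fun_prop) ?_) continuousAt_const) continuousAt_const)
        continuousAt_const
      exact norm_sub_sq_add_zero_ne h
    exact this

/-- With `r = |x - y|²` one has `⟪x, y⟫ = 1 - r/2`, and both sides equal `(4c - 2cr - r²)/(r + c)²`.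
-/
theorem inner_curl_regFlux_sphere (hc : 0 < c) {x y : E} (hx : ‖x‖ = 1) (hy : ‖y‖ = 1) :
    ⟪y, curl (regFlux c x x) y⟫ = peak c x y - damping c x y := by
  have hz := norm_sub_sq_of_sphere hx hy
  rw [curl_regFlux c x (norm_sq_add_pos hc _).ne', peak, damping, inner_add_right,
    real_inner_smul_right, real_inner_smul_right, inner_sub_left, inner_sub_right,
    real_inner_self_eq_norm_sq, real_inner_self_eq_norm_sq, hx, hy, real_inner_comm x y]
  have hne : (‖x - y‖ ^ 2 + c) ≠ 0 := (norm_sq_add_pos hc _).ne'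
  have h2 : ⟪x, y⟫ = 1 - ‖x - y‖ ^ 2 / 2 := by linarith
  rw [h2]
  field_simp
  ring

/-- The difference of the kernels is the flux of a curl through a closed surface. As `damping` tends
boundedly to `1`, the mass of `peak` tends to `4π`. -/
theorem integral_peak (hc : 0 < c) (x : S2) :
    ∫ y : S2, peak c x y ∂σ = ∫ y : S2, damping c x y ∂σ := by
  have h := integral_curl_eq_zero (contDiff_regFlux hc (n := 1) x x)
  have h1 : ∀ y : S2, ⟪(y : E), curl (regFlux c x x) y⟫ = peak c x y - damping c x y :=
    fun y => inner_curl_regFlux_sphere hc (norm_eq_of_mem_sphere x) (norm_eq_of_mem_sphere y)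
  simp only [h1] at h
  rw [integral_sub (integrable_peak hc x) (integrable_damping hc x)] at h
  linarith

theorem integral_damping_le (hc : 0 < c) (x : S2) :
    ∫ y : S2, damping c x y ∂σ ≤ 4 * Real.pi := by
  rw [← sigma_real_univ]
  have := integral_mono_of_nonneg (μ := σ) (f := fun y : S2 => damping c x y) (g := fun _ => 1)
    (Filter.Eventually.of_forall fun y => damping_nonneg hc _ _) (integrable_const 1)
    (Filter.Eventually.of_forall fun y => damping_le_one _ _)
  simpa using this

theorem tendsto_damping {x y : E} (h : x ≠ y) :
    Filter.Tendsto (fun c => damping c x y) (𝓝[>] 0) (𝓝 1) := by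
  refine Filter.Tendsto.mono_left ?_ nhdsWithin_le_nhds
  have hz : (‖x - y‖ ^ 2 + 0) ^ 2 ≠ 0 := pow_ne_zero 2 (norm_sub_sq_add_zero_ne h)
  have : ContinuousAt (fun c => damping c x y) 0 := by
    unfold damping
    exact continuousAt_const.sub (ContinuousAt.div (by fun_prop) (by fun_prop) hz)
  simpa [ContinuousAt, damping] using this

theorem tendsto_integral_damping {f : S2 → ℝ} (hf : Integrable f σ) (x : S2) :
    Filter.Tendsto (fun c => ∫ y : S2, damping c x y * f y ∂σ) (𝓝[>] 0) (𝓝 (∫ y, f y ∂σ)) := by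
  refine tendsto_integral_filter_of_dominated_convergence (fun y => ‖f y‖) ?_ ?_ hf.norm ?_
  · filter_upwards [self_mem_nhdsWithin] with c hc
    exact (integrable_damping hc x).aestronglyMeasurable.mul hf.aestronglyMeasurable
  · filter_upwards [self_mem_nhdsWithin] with c hc
    refine Filter.Eventually.of_forall fun y => ?_
    rw [norm_mul, Real.norm_eq_abs, abs_of_nonneg (damping_nonneg hc _ _)]
    exact mul_le_of_le_one_left (norm_nonneg _) (damping_le_one _ _)
  · filter_upwards [compl_mem_ae_iff.2 (sigma_singleton x)] with y hy
    have hne : (x : E) ≠ y := fun h => hy (Subtype.ext h).symm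
    simpa using (tendsto_damping hne).mul_const (f y)

/-- Divided by `4π`, the kernels form an approximate identity: nonnegative, of mass tending to one,
and uniformly small away from `x`. -/
theorem tendsto_integral_peak {f : S2 → ℝ} (hf : Integrable f σ) {x : S2}
    (hfx : ContinuousAt f x) :
    Filter.Tendsto (fun c => ∫ y : S2, peak c x y * f y ∂σ) (𝓝[>] 0)
      (𝓝 (4 * Real.pi * f x)) := by
  have hπ : (4 * Real.pi) ≠ 0 := by positivity
  have h := tendsto_integral_peak_smul_of_integrable_of_tendsto (μ := σ) (l := 𝓝[>] (0 : ℝ))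
    (φ := fun c (y : S2) => (4 * Real.pi)⁻¹ * peak c x y) (g := f) (x₀ := x) (a := f x)
    (t := univ) MeasurableSet.univ Filter.univ_mem (measure_ne_top _ _) ?_ ?_ ?_ ?_ hf hfx
  · have h' := h.const_mul (4 * Real.pi)
    refine h'.congr fun c => ?_
    rw [← integral_const_mul]
    refine integral_congr_ae (Filter.Eventually.of_forall fun y => ?_)
    simp only [smul_eq_mul]
    field_simp
  · filter_upwards [self_mem_nhdsWithin] with c hc y
    have := peak_nonneg hc x y
    positivity
  · intro u hu hxu
    rw [Metric.tendstoUniformlyOn_iff]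
    intro ε hε
    obtain ⟨d, hd, hball⟩ := Metric.isOpen_iff.1 hu x hxu
    -- At distance at least `d` from `x` the peak is at most `4c/d⁴`.
    have hlim : Filter.Tendsto (fun c : ℝ => (4 * Real.pi)⁻¹ * (4 * c / (d ^ 2) ^ 2)) (𝓝[>] 0)
        (𝓝 0) := by
      refine Filter.Tendsto.mono_left ?_ nhdsWithin_le_nhds
      exact Continuous.tendsto' (by fun_prop) _ _ (by simp)
    filter_upwards [self_mem_nhdsWithin, hlim.eventually (gt_mem_nhds hε)] with c hc hcε y hy
    have hcpos : (0 : ℝ) < c := hc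
    have hdy : d ≤ ‖(x : E) - y‖ := by
      rw [← dist_eq_norm]
      by_contra! hlt
      exact hy (hball (by rw [Metric.mem_ball, dist_comm]; exact hlt))
    rw [Pi.zero_apply, dist_zero_left, Real.norm_eq_abs,
      abs_of_nonneg (mul_nonneg (by positivity) (peak_nonneg hc _ _))]
    refine lt_of_le_of_lt ?_ hcε
    unfold peak
    gcongr
    nlinarith [pow_le_pow_left₀ hd.le hdy 2]
  · simp only [Measure.restrict_univ]
    have h1 : Filter.Tendsto (fun c => (4 * Real.pi)⁻¹ * ∫ y : S2, damping c x y * 1 ∂σ) (𝓝[>] 0)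
        (𝓝 ((4 * Real.pi)⁻¹ * ∫ _ : S2, (1 : ℝ) ∂σ)) :=
      (tendsto_integral_damping (integrable_const 1) x).const_mul _
    rw [integral_const, sigma_real_univ, smul_eq_mul, mul_one, inv_mul_cancel₀ hπ] at h1
    refine h1.congr' ?_
    filter_upwards [self_mem_nhdsWithin] with c hc
    simp only [mul_one]
    rw [integral_const_mul, integral_peak hc]
  · filter_upwards [self_mem_nhdsWithin] with c hc
    exact ((integrable_peak hc x).const_mul _).aestronglyMeasurable

/-- Serves twice: with `A = univ` and a smooth test function, and with `A = Ω` and the indicator of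
`Ω` in `y`. Hence continuity in `y` is asked only at the diagonal points over `A`. -/
theorem tendsto_integral_kernel {A : Set S2} (hA : MeasurableSet A) {f : S2 × S2 → ℝ}
    (hf : StronglyMeasurable f) {C : ℝ} (hC : ∀ q, |f q| ≤ C)
    (hcont : ∀ x ∈ A, ContinuousAt (fun y => f (x, y)) x) :
    Filter.Tendsto (fun c => ∫ x in A, ∫ y : S2, (peak c x y - damping c x y) * f (x, y) ∂σ ∂σ)
      (𝓝[>] 0) (𝓝 (4 * Real.pi * (∫ x in A, f (x, x) ∂σ) - ∫ x in A, ∫ y, f (x, y) ∂σ ∂σ)) := by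
  have hC0 : ∀ x : S2, 0 ≤ C := fun x => (abs_nonneg _).trans (hC (x, x))
  have hfx : ∀ x, Integrable (fun y => f (x, y)) σ := fun x =>
    Integrable.of_bound (C := C) (hf.comp_measurable measurable_prodMk_left).aestronglyMeasurable
      (Filter.Eventually.of_forall fun y => hC _)
  have hdiag : Integrable (fun x => f (x, x)) (σ.restrict A) :=
    Integrable.of_bound (C := C)
      (hf.comp_measurable (measurable_id.prodMk measurable_id)).aestronglyMeasurable
      (Filter.Eventually.of_forall fun y => hC _)
  have hint : Integrable (fun x => ∫ y, f (x, y) ∂σ) (σ.restrict A) := by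
    refine Integrable.of_bound (C := C * (4 * Real.pi))
      hf.integral_prod_right'.aestronglyMeasurable (Filter.Eventually.of_forall fun x => ?_)
    rw [← sigma_real_univ]
    exact norm_integral_le_of_norm_le_const (Filter.Eventually.of_forall fun y => hC _)
  rw [← integral_const_mul, ← integral_sub (hdiag.const_mul _) hint]
  -- `peak` and `damping` have the same mass, at most `4π` each, uniformly in `x` and `c`.
  refine tendsto_integral_filter_of_dominated_convergence (fun _ => C * (8 * Real.pi)) ?_ ?_
    (integrable_const _) ?_
  · filter_upwards [self_mem_nhdsWithin] with c hc
    refine StronglyMeasurable.aestronglyMeasurable ?_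
    exact StronglyMeasurable.integral_prod_right' (f := fun q : S2 × S2 =>
      (peak c q.1 q.2 - damping c q.1 q.2) * f q)
      (((continuous_peak_sphere hc).sub (continuous_damping_sphere hc)).stronglyMeasurable.mul hf)
  · filter_upwards [self_mem_nhdsWithin] with c hc
    refine Filter.Eventually.of_forall fun x => ?_
    calc ‖∫ y : S2, (peak c x y - damping c x y) * f (x, y) ∂σ‖
        ≤ ∫ y : S2, C * (peak c x y + damping c x y) ∂σ := by
          refine norm_integral_le_of_norm_le (((integrable_peak hc x).add (integrable_damping hc x)).const_mul C)
            (Filter.Eventually.of_forall fun y => ?_)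
          rw [norm_mul, mul_comm C]
          refine mul_le_mul ?_ (hC _) (norm_nonneg _) ?_
          · refine (norm_sub_le _ _).trans ?_
            rw [Real.norm_eq_abs, Real.norm_eq_abs, abs_of_nonneg (peak_nonneg hc _ _),
              abs_of_nonneg (damping_nonneg hc _ _)]
          · exact add_nonneg (peak_nonneg hc _ _) (damping_nonneg hc _ _)
      _ ≤ C * (8 * Real.pi) := by
          rw [integral_const_mul, integral_add (integrable_peak hc x) (integrable_damping hc x), integral_peak hc]
          have := integral_damping_le hc x
          have := hC0 x
          gcongr
          linarith
  · refine (ae_restrict_iff' hA).2 (Filter.Eventually.of_forall fun x hx => ?_)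
    refine ((tendsto_integral_peak (hfx x) (hcont x hx)).sub
      (tendsto_integral_damping (hfx x) x)).congr' ?_
    filter_upwards [self_mem_nhdsWithin] with c hc
    rw [← integral_sub]
    · exact integral_congr_ae (Filter.Eventually.of_forall fun y => by simp only [sub_mul])
    · exact (hfx x).bdd_mul (c := 4 * c / c ^ 2) (integrable_peak hc x).aestronglyMeasurable
        (Filter.Eventually.of_forall fun y => by
          have hcpos : (0 : ℝ) < c := hc
          rw [Real.norm_eq_abs, abs_of_nonneg (peak_nonneg hc _ _)]
          unfold peak
          gcongr
          nlinarith [sq_nonneg ‖(x : E) - y‖])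
    · exact (hfx x).bdd_mul (c := 1) (integrable_damping hc x).aestronglyMeasurable
        (Filter.Eventually.of_forall fun y => by
          rw [Real.norm_eq_abs, abs_of_nonneg (damping_nonneg hc _ _)]
          exact damping_le_one _ _)

end Kernel

/-! ### The distributional identity on the sphere -/

/-- If `L` is represented by `g`, both sides are the triple product `⟪x, g × G⟫`. -/
theorem sum_fderiv_mul (L : E →L[ℝ] ℝ) (x G : E) :
    ∑ k, L (e k) * ⟪x, cross (e k) G⟫ = ∑ k, G k * L (cross (e k) x) := by
  have h : ∀ w : E, L w = w 0 * L (e 0) + w 1 * L (e 1) + w 2 * L (e 2) := fun w => by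
    conv_lhs => rw [sum_smul_e w]
    simp only [map_add, map_smul, smul_eq_mul]
  simp only [Fin.sum_univ_three, h (cross _ x), inner_eq_coord]
  simp
  ring

/-- The curl of `g G` is `g curl G + ∇g × G` and has total flux zero. `sum_fderiv_mul` brings the
last term into the form of derivatives along the rotation fields `e k × x`. -/
theorem integral_rotation_by_parts {g : E → ℝ} {G : E → E} (hg : ContDiff ℝ 1 g)
    (hG : ContDiff ℝ 1 G) :
    ∫ x : S2, ∑ k, G x k * fderiv ℝ g x (cross (e k) x) ∂σ
      = -∫ x : S2, g x * ⟪(x : E), curl G x⟫ ∂σ := by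
  have h := integral_curl_eq_zero (hg.smul hG)
  have hL : Continuous (fderiv ℝ g) := hg.continuous_fderiv one_ne_zero
  have h1 : ∀ x : S2, ⟪(x : E), curl (fun x => g x • G x) x⟫
      = g x * ⟪(x : E), curl G x⟫ + ∑ k, G x k * fderiv ℝ g x (cross (e k) x) := fun x => by
    rw [curl_smul (hg.differentiable one_ne_zero _) (hG.differentiable one_ne_zero _),
      inner_add_right, real_inner_smul_right, inner_sum, ← sum_fderiv_mul]
    simp only [real_inner_smul_right]
  have h2 : Continuous fun x : E => ∑ k, G x k * fderiv ℝ g x (cross (e k) x) := by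
    refine continuous_finsetSum _ fun k _ => Continuous.mul ?_ ?_
    · exact (dx k).continuous.comp hG.continuous
    · exact hL.clm_apply (continuous_cross.comp (f := fun x => (e k, x)) (by fun_prop))
  have h3 : Continuous fun x : E => g x * ⟪x, curl G x⟫ :=
    hg.continuous.mul (continuous_id.inner (continuous_curl hG))
  have i2 : Integrable (fun x : S2 => ∑ k, G x k * fderiv ℝ g x (cross (e k) x)) σ :=
    integrable_sigma (h2.comp continuous_subtype_val)
  have i3 : Integrable (fun x : S2 => g x * ⟪(x : E), curl G x⟫) σ :=
    integrable_sigma (h3.comp continuous_subtype_val)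
  change ∫ x : S2, ⟪(x : E), curl (fun x => g x • G x) x⟫ ∂σ = 0 at h
  simp only [h1] at h
  rw [integral_add i3 i2] at h
  linarith

section SphereDistribution

variable {ψ : E × E → ℝ}

/-- The derivative of `ψ` in the second variable along the rotation about the axis `e l`. -/
def rotDeriv (ψ : E × E → ℝ) (l : Fin 3) (q : E × E) : ℝ :=
  fderiv ℝ ψ q (0, cross (e l) q.2)

theorem contDiff_rotDeriv (hψ : ContDiff ℝ ∞ ψ) (l : Fin 3) : ContDiff ℝ 1 (rotDeriv ψ l) := by
  have h1 : ContDiff ℝ 1 (fderiv ℝ ψ) :=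
    (hψ.of_le two_le_infty).fderiv_right (m := 1) (by norm_num)
  have h2 : ContDiff ℝ 1 fun q : E × E => ((0 : E), cross (e l) q.2) :=
    contDiff_const.prodMk (contDiff_cross.comp (contDiff_const.prodMk contDiff_snd))
  exact h1.clm_apply h2

theorem fderiv_slice_right {X Y : Type*} [NormedAddCommGroup X] [NormedSpace ℝ X]
    [NormedAddCommGroup Y] [NormedSpace ℝ Y] {ψ : X × Y → ℝ} {x : X} {y : Y}
    (hψ : DifferentiableAt ℝ ψ (x, y)) (v : Y) :
    fderiv ℝ (fun y' => ψ (x, y')) y v = fderiv ℝ ψ (x, y) (0, v) := by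
  have hp : HasFDerivAt (fun y' : Y => (x, y'))
      ((0 : Y →L[ℝ] X).prod (ContinuousLinearMap.id ℝ Y)) y :=
    (hasFDerivAt_const x y).prodMk (hasFDerivAt_id y)
  have h : fderiv ℝ (fun y' => ψ (x, y')) y = _ :=
    (HasFDerivAt.comp (g := ψ) y hψ.hasFDerivAt hp).fderiv
  rw [h]; rfl

theorem fderiv_slice_left {X Y : Type*} [NormedAddCommGroup X] [NormedSpace ℝ X]
    [NormedAddCommGroup Y] [NormedSpace ℝ Y] {ψ : X × Y → ℝ} {x : X} {y : Y}
    (hψ : DifferentiableAt ℝ ψ (x, y)) (v : X) :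
    fderiv ℝ (fun x' => ψ (x', y)) x v = fderiv ℝ ψ (x, y) (v, 0) := by
  have hp : HasFDerivAt (fun x' : X => (x', y))
      ((ContinuousLinearMap.id ℝ X).prod (0 : X →L[ℝ] Y)) x :=
    (hasFDerivAt_id x).prodMk (hasFDerivAt_const y x)
  have h : fderiv ℝ (fun x' => ψ (x', y)) x = _ :=
    (HasFDerivAt.comp (g := ψ) x hψ.hasFDerivAt hp).fderiv
  rw [h]; rfl

/-- The second derivative of `ψ` that occurs in the weak form. -/
def rotDeriv₂ (ψ : E × E → ℝ) (k l : Fin 3) (q : E × E) : ℝ :=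
  fderiv ℝ (rotDeriv ψ l) q (cross (e k) q.1, 0)

theorem continuous_rotDeriv₂ (hψ : ContDiff ℝ ∞ ψ) (k l : Fin 3) :
    Continuous (rotDeriv₂ ψ k l) := by
  refine ((contDiff_rotDeriv hψ l).continuous_fderiv one_ne_zero).clm_apply ?_
  exact (continuous_cross.comp (f := fun q : E × E => (e k, q.1)) (by fun_prop)).prodMk
    continuous_const

theorem rotDeriv_slice (hψ : ContDiff ℝ ∞ ψ) (l : Fin 3) (x y : E) :
    fderiv ℝ (fun y' : E => ψ (x, y')) y (cross (e l) y) = rotDeriv ψ l (x, y) :=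
  fderiv_slice_right (hψ.differentiable (by simp) _) _

theorem fderiv_rotDeriv_slice (hψ : ContDiff ℝ ∞ ψ) (k l : Fin 3) (x y : E) :
    fderiv ℝ (fun x' : E => rotDeriv ψ l (x', y)) x (cross (e k) x) = rotDeriv₂ ψ k l (x, y) :=
  fderiv_slice_left ((contDiff_rotDeriv hψ l).differentiable one_ne_zero _) _

/-- The weak form for the regularized biform. -/
def sphereWeakReg (c : ℝ) (ψ : E × E → ℝ) (q : S2 × S2) : ℝ :=
  ∑ k, ∑ l, alphaReg c q.1 q.2 (e k) (e l) * rotDeriv₂ ψ k l (q.1, q.2)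

theorem sphereWeakIntegrand_eq (hψ : ContDiff ℝ ∞ ψ) :
    sphereWeakIntegrand ψ = sphereWeakReg 0 ψ := by
  ext1 q
  simp only [sphereWeakIntegrand, sphereWeakReg, alpha_apply, rotDeriv_slice hψ,
    fderiv_rotDeriv_slice hψ]

theorem continuous_coe_prod : Continuous fun q : S2 × S2 => ((q.1 : E), (q.2 : E)) := by
  fun_prop

theorem exists_bound_sphere {F : Type*} [SeminormedAddCommGroup F] {f : E × E → F}
    (hf : Continuous f) : ∃ C, ∀ q : S2 × S2, ‖f (q.1, q.2)‖ ≤ C := by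
  obtain ⟨C, hC⟩ := isCompact_univ.exists_bound_of_continuousOn
    (hf.comp continuous_coe_prod).continuousOn
  exact ⟨C, fun q => hC q (mem_univ q)⟩

theorem integrable_sphere_prod {f : E × E → ℝ} (hf : Continuous f) :
    Integrable (fun q : S2 × S2 => f (q.1, q.2)) (σ.prod σ) :=
  (hf.comp continuous_coe_prod).integrable_of_hasCompactSupport
    (HasCompactSupport.of_compactSpace _)

theorem norm_e (k : Fin 3) : ‖e k‖ = 1 := by simp [e]

/-- The bound is uniform in `c`, `c = 0` included, as dominated convergence requires. -/
theorem abs_sphereWeakReg_le (hψ : ContDiff ℝ ∞ ψ) :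
    ∃ C, ∀ c, 0 ≤ c → ∀ q : S2 × S2, |sphereWeakReg c ψ q| ≤ C := by
  choose C hC using fun k l => exists_bound_sphere (continuous_rotDeriv₂ hψ k l)
  refine ⟨∑ k, ∑ l, C k l, fun c hc q => ?_⟩
  refine (Finset.abs_sum_le_sum_abs _ _).trans (Finset.sum_le_sum fun k _ => ?_)
  refine (Finset.abs_sum_le_sum_abs _ _).trans (Finset.sum_le_sum fun l _ => ?_)
  rw [abs_mul]
  have h1 := abs_alphaReg_le hc (q.1 : E) q.2 (e k) (e l)
  rw [norm_e, norm_e, one_mul] at h1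
  exact (mul_le_of_le_one_left (abs_nonneg _) h1).trans (hC k l q)

theorem measurable_alphaReg (c : ℝ) (u v : E) :
    Measurable fun q : E × E => alphaReg c q.1 q.2 u v := by
  unfold alphaReg
  fun_prop

theorem measurable_sphereWeakReg (hψ : ContDiff ℝ ∞ ψ) (c : ℝ) :
    Measurable (sphereWeakReg c ψ) := by
  unfold sphereWeakReg
  refine Finset.measurable_fun_sum _ fun k _ => Finset.measurable_fun_sum _ fun l _ => ?_
  exact ((measurable_alphaReg c _ _).comp continuous_coe_prod.measurable).mul
    ((continuous_rotDeriv₂ hψ k l).comp continuous_coe_prod).measurable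

theorem integrable_sphereWeakReg (hψ : ContDiff ℝ ∞ ψ) {c : ℝ} (hc : 0 ≤ c) :
    Integrable (sphereWeakReg c ψ) (σ.prod σ) := by
  obtain ⟨C, hC⟩ := abs_sphereWeakReg_le hψ
  exact Integrable.of_bound (measurable_sphereWeakReg hψ c).aestronglyMeasurable C
    (Filter.Eventually.of_forall fun q => hC c hc q)

/-- Integration by parts in `x` turns the biform into `regFlux`; after Fubini, integration by parts
in `y` turns `regFlux` into the kernel. The two minus signs cancel. -/
theorem integral_sphereWeakReg (hψ : ContDiff ℝ ∞ ψ) {c : ℝ} (hc : 0 < c) :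
    ∫ q, sphereWeakReg c ψ q ∂(σ.prod σ)
      = ∫ x : S2, ∫ y : S2, (peak c x y - damping c x y) * ψ (x, y) ∂σ ∂σ := by
  have hreg : ∀ (x y : S2) (k l : Fin 3),
      alphaReg c x y (e k) (e l) = regField c (y : E) (e l) (x : E) k := fun x y k l => by
    rw [← inner_regField, inner_eq_coord]
    fin_cases k <;> simp
  have hlim : ∀ l, ContDiff ℝ 1 (rotDeriv ψ l) := contDiff_rotDeriv hψ
  have hcont : Continuous fun q : E × E =>
      ∑ l, regFlux c q.1 q.1 q.2 l * rotDeriv ψ l q := by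
    refine continuous_finsetSum _ fun l _ => Continuous.mul ?_ (hlim l).continuous
    exact (dx l).continuous.comp ((continuous_regFlux hc).comp
      (f := fun q : E × E => (q.1, q.1, q.2)) (by fun_prop))
  have hx : ∀ y : S2, ∫ x : S2, sphereWeakReg c ψ (x, y) ∂σ
      = -∫ x : S2, ∑ l, regFlux c (x : E) x y l * rotDeriv ψ l (x, y) ∂σ := by
    intro y
    have hsl : ∀ l, ContDiff ℝ 1 fun x' : E => rotDeriv ψ l (x', y) := fun l =>
      (hlim l).comp (contDiff_id.prodMk contDiff_const)
    have h1 : ∀ x : S2, sphereWeakReg c ψ (x, y) = ∑ l, ∑ k, regField c (y : E) (e l) (x : E) k *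
        fderiv ℝ (fun x' : E => rotDeriv ψ l (x', y)) x (cross (e k) x) := fun x => by
      rw [sphereWeakReg, Finset.sum_comm]
      simp only [hreg, fderiv_rotDeriv_slice hψ]
    simp only [h1]
    have hI1 : ∀ l, Integrable (fun x : S2 => ∑ k, regField c (y : E) (e l) (x : E) k *
        fderiv ℝ (fun x' : E => rotDeriv ψ l (x', y)) x (cross (e k) x)) σ := fun l => by
      refine integrable_sigma (Continuous.comp (g := fun x : E => ∑ k, regField c (y : E) (e l) x k *
        fderiv ℝ (fun x' : E => rotDeriv ψ l (x', y)) x (cross (e k) x)) ?_ continuous_subtype_val)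
      refine continuous_finsetSum _ fun k _ => Continuous.mul ?_ ?_
      · exact (dx k).continuous.comp (contDiff_regField hc (n := 1) _ _).continuous
      · exact ((hsl l).continuous_fderiv one_ne_zero).clm_apply
          (continuous_cross.comp (f := fun x => (e k, x)) (by fun_prop))
    have hI2 : ∀ l, Integrable (fun x : S2 => regFlux c (x : E) x y l * rotDeriv ψ l (x, y)) σ :=
      fun l => by
      refine integrable_sigma (Continuous.comp (g := fun x : E => regFlux c x x y l *
        rotDeriv ψ l (x, y)) ?_ continuous_subtype_val)
      refine Continuous.mul ?_ (hsl l).continuous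
      exact (dx l).continuous.comp ((continuous_regFlux hc).comp
        (f := fun x : E => (x, x, (y : E))) (by fun_prop))
    rw [integral_finsetSum _ fun l _ => hI1 l, integral_finsetSum _ fun l _ => hI2 l,
      ← Finset.sum_neg_distrib]
    refine Finset.sum_congr rfl fun l _ => ?_
    rw [integral_rotation_by_parts (hsl l) (contDiff_regField hc _ _)]
    congr 1
    refine integral_congr_ae (Filter.Eventually.of_forall fun x => ?_)
    simp only
    rw [real_inner_comm, inner_curl_regField c _ _ (norm_sq_add_pos hc _).ne', mul_comm]
    congr 1
    rw [inner_eq_coord]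
    fin_cases l <;> simp
  have hy : ∀ x : S2, ∫ y : S2, ∑ l, regFlux c (x : E) x y l * rotDeriv ψ l (x, y) ∂σ
      = -∫ y : S2, (peak c x y - damping c x y) * ψ (x, y) ∂σ := by
    intro x
    have hsl : ContDiff ℝ 1 fun y' : E => ψ (x, y') :=
      (hψ.of_le (by simp)).comp (contDiff_const.prodMk contDiff_id)
    have h1 := integral_rotation_by_parts hsl (contDiff_regFlux hc x x)
    simp only [rotDeriv_slice hψ] at h1
    rw [h1]
    congr 1
    refine integral_congr_ae (Filter.Eventually.of_forall fun y => ?_)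
    simp only
    rw [inner_curl_regFlux_sphere hc (norm_eq_of_mem_sphere x) (norm_eq_of_mem_sphere y), mul_comm]
  rw [integral_prod_symm _ (integrable_sphereWeakReg hψ hc.le)]
  simp only [hx]
  rw [integral_neg, integral_integral_swap]
  · simp only [hy]
    rw [integral_neg, neg_neg]
  · exact (integrable_sphere_prod hcont).swap

/-- The distributional form of `d₁ d₂ α` on `S² × S²`. -/
theorem sphere_distribution (hψ : ContDiff ℝ ∞ ψ) :
    Integrable (sphereWeakIntegrand ψ) (σ.prod σ) ∧
      ∫ q, sphereWeakIntegrand ψ q ∂(σ.prod σ) =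
        4 * Real.pi * (∫ x : S2, ψ ((x : E), (x : E)) ∂σ)
          - ∫ q : S2 × S2, ψ ((q.1 : E), (q.2 : E)) ∂(σ.prod σ) := by
  rw [sphereWeakIntegrand_eq hψ]
  refine ⟨integrable_sphereWeakReg hψ le_rfl, ?_⟩
  obtain ⟨C, hC⟩ := abs_sphereWeakReg_le hψ
  obtain ⟨C', hC'⟩ := exists_bound_sphere hψ.continuous
  have hcomp : Continuous fun q : S2 × S2 => ψ ((q.1 : E), (q.2 : E)) :=
    hψ.continuous.comp continuous_coe_prod
  have h1 : Filter.Tendsto (fun c => ∫ q, sphereWeakReg c ψ q ∂(σ.prod σ)) (𝓝[>] 0)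
      (𝓝 (∫ q, sphereWeakReg 0 ψ q ∂(σ.prod σ))) := by
    refine tendsto_integral_filter_of_dominated_convergence (fun _ => C)
      (Filter.Eventually.of_forall fun c => (measurable_sphereWeakReg hψ c).aestronglyMeasurable)
      ?_ (integrable_const C) (Filter.Eventually.of_forall fun q => ?_)
    · filter_upwards [self_mem_nhdsWithin] with c hc
      exact Filter.Eventually.of_forall fun q => hC c (le_of_lt hc) q
    · refine tendsto_finsetSum _ fun k _ => tendsto_finsetSum _ fun l _ => ?_
      rw [← alpha_apply]
      exact (tendsto_alphaReg _ _ _ _).mul_const _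
  have h2 := tendsto_integral_kernel MeasurableSet.univ hcomp.stronglyMeasurable
    (fun q => hC' q) (fun x _ => (hcomp.comp (by fun_prop : Continuous fun y : S2 =>
      (x, y))).continuousAt)
  simp only [Measure.restrict_univ] at h2
  rw [integral_prod _ (integrable_sphere_prod hψ.continuous)]
  -- The integrals for `c > 0` converge to the weak form of `α` by boundedness and to the right side
  -- by concentration of the kernel.
  refine tendsto_nhds_unique h1 (h2.congr' ?_)
  filter_upwards [self_mem_nhdsWithin] with c hc
  rw [integral_sphereWeakReg hψ hc]

end SphereDistribution

/-! ### The isoperimetric inequality -/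

section Isoperimetric

variable {Ω : Set S2}

/-- The boundary integrand of the regularized biform. -/
def bdryReg (c : ℝ) (Ω : Set S2) (q : S2 × S2) : ℝ :=
  alphaReg c q.1 q.2 (posTangent Ω q.1) (posTangent Ω q.2)

theorem bdryIntegrand_eq (Ω : Set S2) : bdryIntegrand Ω = bdryReg 0 Ω := by
  ext1 q
  rw [bdryIntegrand, bdryReg, alpha_apply]

theorem abs_bdryReg_le {c : ℝ} (hc : 0 ≤ c) (q : S2 × S2) : |bdryReg c Ω q| ≤ 1 := by
  refine (abs_alphaReg_le hc _ _ _ _).trans ?_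
  exact mul_le_one₀ (norm_posTangent_le Ω _) (norm_nonneg _) (norm_posTangent_le Ω _)

theorem aestronglyMeasurable_bdryReg (hΩ : IsSmoothDomain Ω) (c : ℝ) :
    AEStronglyMeasurable (bdryReg c Ω) ((arcLength Ω).prod (arcLength Ω)) := by
  have := isFiniteMeasure_arcLength hΩ
  have hτ := aestronglyMeasurable_posTangent hΩ
  have h1 : AEStronglyMeasurable (fun q : S2 × S2 => posTangent Ω q.1)
      ((arcLength Ω).prod (arcLength Ω)) := hτ.comp_fst
  have h2 : AEStronglyMeasurable (fun q : S2 × S2 => posTangent Ω q.2)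
      ((arcLength Ω).prod (arcLength Ω)) := hτ.comp_snd
  have hz : Continuous fun q : S2 × S2 => (q.1 : E) - q.2 := by fun_prop
  have h3 : Measurable fun q : S2 × S2 => 2 / (‖(q.1 : E) - q.2‖ ^ 2 + c) :=
    measurable_const.div ((hz.norm.pow 2).add continuous_const).measurable
  exact ((h3.aestronglyMeasurable.mul (hz.aestronglyMeasurable.inner h1)).mul
    (hz.aestronglyMeasurable.inner h2)).sub (h1.inner h2)

theorem integrable_bdryReg (hΩ : IsSmoothDomain Ω) {c : ℝ} (hc : 0 ≤ c) :
    Integrable (bdryReg c Ω) ((arcLength Ω).prod (arcLength Ω)) := by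
  have := isFiniteMeasure_arcLength hΩ
  exact Integrable.of_bound (aestronglyMeasurable_bdryReg hΩ c) 1
    (Filter.Eventually.of_forall fun q => abs_bdryReg_le hc q)

/-- Stokes' theorem is applied in `x` to `regField` with `v` the tangent at `y`, then in `y` to
`regFlux` with `N = x`. -/
theorem integral_bdryReg (hΩ : IsSmoothDomain Ω) {c : ℝ} (hc : 0 < c) :
    ∫ q, bdryReg c Ω q ∂((arcLength Ω).prod (arcLength Ω))
      = ∫ x in Ω, ∫ y in Ω, (peak c (x : E) y - damping c (x : E) y) ∂σ ∂σ := by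
  have := isFiniteMeasure_arcLength hΩ
  have hx : ∀ y : S2, ∫ x : S2, bdryReg c Ω (x, y) ∂(arcLength Ω)
      = ∫ x in Ω, ⟪regFlux c (x : E) x y, posTangent Ω y⟫ ∂σ := fun y => by
    have h := stokes hΩ (contDiff_regField hc (y : E) (posTangent Ω y))
    simp only [inner_regField] at h
    change ∫ x : S2, alphaReg c x y (posTangent Ω x) (posTangent Ω y) ∂(arcLength Ω) = _
    rw [← h]
    refine integral_congr_ae (Filter.Eventually.of_forall fun x => ?_)
    simp only
    rw [real_inner_comm, inner_curl_regField c _ _ (norm_sq_add_pos hc _).ne']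
  have hy : ∀ x : S2, ∫ y : S2, ⟪regFlux c (x : E) x y, posTangent Ω y⟫ ∂(arcLength Ω)
      = ∫ y in Ω, (peak c (x : E) y - damping c (x : E) y) ∂σ := fun x => by
    rw [← stokes hΩ (contDiff_regFlux hc (x : E) x)]
    refine integral_congr_ae (Filter.Eventually.of_forall fun y => ?_)
    exact inner_curl_regFlux_sphere hc (norm_eq_of_mem_sphere x) (norm_eq_of_mem_sphere y)
  rw [integral_prod_symm _ (integrable_bdryReg hΩ hc.le)]
  simp only [hx]
  rw [integral_integral_swap]
  · simp only [hy]
  · have hflux : Continuous fun q : E × E => regFlux c q.2 q.2 q.1 :=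
      (continuous_regFlux hc).comp (f := fun q : E × E => (q.2, q.2, q.1)) (by fun_prop)
    obtain ⟨C, hC⟩ := exists_bound_sphere hflux
    refine Integrable.of_bound (C := C) ?_ (Filter.Eventually.of_forall fun q => ?_)
    · exact (hflux.comp continuous_coe_prod).aestronglyMeasurable.inner
        (aestronglyMeasurable_posTangent hΩ).comp_fst
    · refine (norm_inner_le_norm _ _).trans ?_
      exact (mul_le_of_le_one_right (norm_nonneg _) (norm_posTangent_le Ω _)).trans (hC q)

theorem integral_bdryIntegrand (hΩ : IsSmoothDomain Ω) :
    ∫ q, bdryIntegrand Ω q ∂((arcLength Ω).prod (arcLength Ω))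
      = 4 * Real.pi * area Ω - area Ω * area Ω := by
  have := isFiniteMeasure_arcLength hΩ
  rw [bdryIntegrand_eq]
  have h1 : Filter.Tendsto (fun c => ∫ q, bdryReg c Ω q ∂((arcLength Ω).prod (arcLength Ω)))
      (𝓝[>] 0) (𝓝 (∫ q, bdryReg 0 Ω q ∂((arcLength Ω).prod (arcLength Ω)))) := by
    refine tendsto_integral_filter_of_dominated_convergence (fun _ => 1)
      (Filter.Eventually.of_forall fun c => aestronglyMeasurable_bdryReg hΩ c)
      ?_ (integrable_const 1) (Filter.Eventually.of_forall fun q => ?_)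
    · filter_upwards [self_mem_nhdsWithin] with c hc
      exact Filter.Eventually.of_forall fun q => abs_bdryReg_le (le_of_lt hc) q
    · simp only [bdryReg, ← alpha_apply]
      exact tendsto_alphaReg _ _ _ _
  have hmΩ := hΩ.1.measurableSet
  -- The indicator confines `y` to `Ω`. Since `Ω` is open it is continuous at every `x ∈ Ω`, which
  -- is all that is needed.
  have h2 := tendsto_integral_kernel hmΩ (f := fun q => Ω.indicator (fun _ => (1 : ℝ)) q.2) (C := 1)
    ((stronglyMeasurable_const.indicator hmΩ).comp_measurable measurable_snd)
    (fun q => by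
      simp only [indicator]
      split_ifs <;> simp)
    (fun x hx => by
      refine (continuousAt_const (y := (1 : ℝ))).congr ?_
      filter_upwards [hΩ.1.mem_nhds hx] with y hy
      exact (indicator_of_mem (M := ℝ) hy fun _ => (1 : ℝ)).symm)
  have e1 : ∫ x in Ω, Ω.indicator (fun _ => (1 : ℝ)) x ∂σ = area Ω := by
    rw [setIntegral_indicator hmΩ, inter_self, setIntegral_const, smul_eq_mul, mul_one]
    rfl
  have e2 : ∫ y, Ω.indicator (fun _ => (1 : ℝ)) y ∂σ = area Ω := by
    rw [integral_indicator hmΩ, setIntegral_const, smul_eq_mul, mul_one]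
    rfl
  simp only [e1, e2, setIntegral_const, smul_eq_mul] at h2
  refine tendsto_nhds_unique h1 (h2.congr' ?_)
  filter_upwards [self_mem_nhdsWithin] with c hc
  rw [integral_bdryReg hΩ hc]
  refine integral_congr_ae (Filter.Eventually.of_forall fun x => ?_)
  simp only
  rw [← integral_indicator hmΩ]
  refine integral_congr_ae (Filter.Eventually.of_forall fun y => ?_)
  by_cases hy : y ∈ Ω
  · simp only [indicator_of_mem hy, mul_one]
  · simp only [indicator_of_notMem hy, mul_zero]

theorem bdryLength_sq (hΩ : IsSmoothDomain Ω) :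
    ∫ _, (1 : ℝ) ∂((arcLength Ω).prod (arcLength Ω)) = bdryLength Ω ^ 2 := by
  have := isFiniteMeasure_arcLength hΩ
  rw [integral_const, smul_eq_mul, mul_one, measureReal_def, ← univ_prod_univ, Measure.prod_prod,
    ENNReal.toReal_mul, arcLength, Measure.restrict_apply_univ, bdryLength, sq]

theorem integral_bdryIntegrand_le (hΩ : IsSmoothDomain Ω) :
    ∫ q, bdryIntegrand Ω q ∂((arcLength Ω).prod (arcLength Ω)) ≤ bdryLength Ω ^ 2 := by
  have := isFiniteMeasure_arcLength hΩ
  rw [← bdryLength_sq hΩ, bdryIntegrand_eq]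
  exact integral_mono (integrable_bdryReg hΩ le_rfl) (integrable_const _)
    fun q => (le_abs_self _).trans (abs_bdryReg_le le_rfl q)

theorem isoperimetric (hΩ : IsSmoothDomain Ω) :
    (μH[1] : Measure S2) (frontier Ω) ≠ ⊤ ∧
      Integrable (bdryIntegrand Ω) ((arcLength Ω).prod (arcLength Ω)) ∧
      (∫ q, bdryIntegrand Ω q ∂((arcLength Ω).prod (arcLength Ω))) ≤ bdryLength Ω ^ 2 ∧
      (∫ q, bdryIntegrand Ω q ∂((arcLength Ω).prod (arcLength Ω))) =
        4 * Real.pi * area Ω - area Ω * area Ω ∧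
      (4 * Real.pi - area Ω) * area Ω ≤ bdryLength Ω ^ 2 := by
  refine ⟨(hausdorffMeasure_frontier_lt_top hΩ).ne, ?_, integral_bdryIntegrand_le hΩ,
    integral_bdryIntegrand hΩ, ?_⟩
  · rw [bdryIntegrand_eq]
    exact integrable_bdryReg hΩ le_rfl
  · have h := integral_bdryIntegrand_le hΩ
    rw [integral_bdryIntegrand hΩ] at h
    linarith

end Isoperimetric

/-! ### Spherical caps -/

/-- The open cap of `S²` above the height `c`. -/
def cap (c : ℝ) : Set S2 := {x | c < (x : E) 0}

/-- The defining function of the cap. -/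
def capFun (c : ℝ) (x : E) : ℝ := ⟪x, -e 0⟫ - -c

theorem capFun_eq (c : ℝ) (x : E) : capFun c x = c - x 0 := by
  rw [capFun, inner_neg_right, inner_eq_coord]
  simp
  ring

theorem continuous_height : Continuous fun x : S2 => (x : E) 0 :=
  (dx 0).continuous.comp continuous_subtype_val

theorem isOpen_cap (c : ℝ) : IsOpen (cap c) := isOpen_lt continuous_const continuous_height

theorem height_of_mem_frontier {c : ℝ} {x : S2} (hx : x ∈ frontier (cap c)) : (x : E) 0 = c :=
  (frontier_lt_subset_eq continuous_const continuous_height hx).symm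

theorem sphere_coord (x : S2) : (x : E) 0 ^ 2 + (x : E) 1 ^ 2 + (x : E) 2 ^ 2 = 1 := by
  rw [← norm_sq_eq_coord, norm_eq_of_mem_sphere x, one_pow]

theorem norm_cross_pole_sq (x : S2) : ‖cross (x : E) (-e 0)‖ ^ 2 = 1 - (x : E) 0 ^ 2 := by
  have h := sphere_coord x
  rw [norm_sq_eq_coord]
  simp
  linarith

theorem exists_chart_level {c : ℝ} (hc : c ^ 2 < 1) {p : S2} (hp : (p : E) 0 = c) :
    ∃ q Ψ δ O, IsChart (capFun c) q Ψ δ O ∧ (p : E) ∈ O := by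
  have hg := gradient_inner_const (-e 0) (-c) p
  have hne : cross (p : E) (-e 0) ≠ 0 := fun h => by
    have := norm_cross_pole_sq p
    rw [h, hp, norm_zero] at this
    nlinarith
  obtain ⟨Ψ, δ, O, hpO, -, hch⟩ := exists_isChart (contDiff_inner_const (-e 0) (-c))
    (norm_eq_of_mem_sphere p) (by have := capFun_eq c p; rw [hp, sub_self] at this; exact this)
    (by rwa [hg]) Filter.univ_mem
  exact ⟨_, Ψ, δ, O, hch, hpO⟩

theorem mem_cap_iff (c : ℝ) (x : S2) : x ∈ cap c ↔ capFun c x < 0 := by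
  rw [capFun_eq, sub_neg]; rfl

theorem isSmoothDomain_cap {c : ℝ} (hc : c ^ 2 < 1) : IsSmoothDomain (cap c) := by
  refine ⟨isOpen_cap c, fun p hp => ⟨capFun c, ?_⟩⟩
  obtain ⟨q, Ψ, δ, O, h, hpO⟩ := exists_chart_level hc (height_of_mem_frontier hp)
  refine ⟨h.contDiff, ?_, Filter.Eventually.of_forall fun x => mem_cap_iff c x,
    h.cross_ne_zero hpO⟩
  rw [capFun_eq, height_of_mem_frontier hp, sub_self]

theorem posTangent_cap {c : ℝ} (hc : c ^ 2 < 1) {p : S2} (hp : p ∈ frontier (cap c)) :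
    posTangent (cap c) p = (√(1 - c ^ 2))⁻¹ • cross (p : E) (-e 0) := by
  obtain ⟨q, Ψ, δ, O, h, hpO⟩ := exists_chart_level hc (height_of_mem_frontier hp)
  have hg : gradient (capFun c) p = -e 0 := gradient_inner_const (-e 0) (-c) p
  rw [h.posTangent_eq (isOpen_cap c) (fun x _ => mem_cap_iff c x) hpO hp, unitTangent, hg,
    ← height_of_mem_frontier hp, ← norm_cross_pole_sq, Real.sqrt_sq (norm_nonneg _)]

/-- Both tangents turn in the same sense around one circle, so the value is `1` with its sign and
the comass bound is attained. -/
theorem bdryIntegrand_cap {c : ℝ} (hc : c ^ 2 < 1) {x y : S2} (hx : x ∈ frontier (cap c))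
    (hy : y ∈ frontier (cap c)) (hxy : x ≠ y) : bdryIntegrand (cap c) (x, y) = 1 := by
  have hne : (x : E) ≠ y := fun h => hxy (Subtype.ext h)
  have hz := norm_sub_sq_of_sphere (norm_eq_of_mem_sphere x) (norm_eq_of_mem_sphere y)
  have hz0 : ‖(x : E) - y‖ ^ 2 ≠ 0 := pow_ne_zero 2 (norm_ne_zero_iff.2 (sub_ne_zero.2 hne))
  have hpos : 0 < 1 - c ^ 2 := by linarith
  have hs : √(1 - c ^ 2) ^ 2 = 1 - c ^ 2 := Real.sq_sqrt hpos.le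
  have hs0 : √(1 - c ^ 2) ≠ 0 := (Real.sqrt_pos.2 hpos).ne'
  have h1 := sphere_coord x
  have h2 := sphere_coord y
  have h3 := height_of_mem_frontier hx
  have h4 := height_of_mem_frontier hy
  rw [bdryIntegrand, posTangent_cap hc hx, posTangent_cap hc hy, alpha_apply, alphaReg, add_zero]
  have e1 : ⟪(x : E) - y, cross (x : E) (-e 0)⟫
      = (x : E) 2 * (y : E) 1 - (x : E) 1 * (y : E) 2 := by
    rw [inner_eq_coord]; simp; ring
  have e2 : ⟪(x : E) - y, cross (y : E) (-e 0)⟫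
      = (x : E) 2 * (y : E) 1 - (x : E) 1 * (y : E) 2 := by
    rw [inner_eq_coord]; simp; ring
  have e3 : ⟪cross (x : E) (-e 0), cross (y : E) (-e 0)⟫
      = (x : E) 1 * (y : E) 1 + (x : E) 2 * (y : E) 2 := by
    rw [inner_eq_coord]; simp; ring
  simp only [real_inner_smul_right, real_inner_smul_left, e1, e2, e3]
  rw [inner_eq_coord, h3, h4] at hz
  rw [h3] at h1
  rw [h4] at h2
  generalize √(1 - c ^ 2) = w at hs hs0
  generalize ‖(x : E) - y‖ ^ 2 = r at hz hz0 ⊢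
  generalize (x : E) 1 = a at *
  generalize (x : E) 2 = b at *
  generalize (y : E) 1 = a' at *
  generalize (y : E) 2 = b' at *
  have hab : a ^ 2 + b ^ 2 = w ^ 2 := by linarith
  have hab' : a' ^ 2 + b' ^ 2 = w ^ 2 := by linarith
  have hr : r = 2 * (w ^ 2 - (a * a' + b * b')) := by linarith
  -- Lagrange's identity in the plane of the circle, for two vectors of length `w`.
  have hD : (b * a' - a * b') ^ 2
      = (w ^ 2 - (a * a' + b * b')) * (w ^ 2 + (a * a' + b * b')) := by
    have : (w ^ 2 - (a * a' + b * b')) * (w ^ 2 + (a * a' + b * b'))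
        = w ^ 2 * w ^ 2 - (a * a' + b * b') ^ 2 := by ring
    rw [this]
    nth_rewrite 1 [← hab]
    rw [← hab']
    ring
  calc 2 / r * (w⁻¹ * (b * a' - a * b')) * (w⁻¹ * (b * a' - a * b'))
        - w⁻¹ * (w⁻¹ * (a * a' + b * b'))
      = (2 / r * (b * a' - a * b') ^ 2 - (a * a' + b * b')) / w ^ 2 := by
        field_simp
    _ = (r / r * (w ^ 2 + (a * a' + b * b')) - (a * a' + b * b')) / w ^ 2 := by
        rw [hD]
        congr 2
        conv_rhs => rw [div_mul_eq_mul_div, hr]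
        rw [hr]
        ring
    _ = 1 := by
        rw [div_self hz0, one_mul, add_sub_cancel_right, div_self (pow_ne_zero 2 hs0)]

/-- On the diagonal the first term of `alpha` is zero by convention and the integrand is not `1`;
the diagonal is null because points have no length. -/
theorem ae_ne_arcLength {Ω : Set S2} (hΩ : IsSmoothDomain Ω) :
    ∀ᵐ q ∂((arcLength Ω).prod (arcLength Ω)), q.1 ≠ q.2 := by
  have := isFiniteMeasure_arcLength hΩ
  have hm : MeasurableSet {q : S2 × S2 | q.1 = q.2} := (isClosed_eq continuous_fst
    continuous_snd).measurableSet
  rw [Filter.Eventually, mem_ae_iff]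
  simp only [compl_ofPred, not_not, ne_eq]
  rw [measure_prod_null hm]
  refine Filter.Eventually.of_forall fun x => ?_
  have : NullSingletonClass (μH[1] : Measure S2) := nullSingletonClass_hausdorff S2 one_pos
  refine measure_mono_null (t := {x}) (fun y hy => (show x = y from hy).symm) ?_
  exact Measure.absolutelyContinuous_of_le Measure.restrict_le_self (measure_singleton x)

/-- The boundary integrand equals `1` almost everywhere, so the double integral is the squared
length; neither the length nor the area of the cap is computed. -/
theorem bdryLength_cap {c : ℝ} (hc : c ^ 2 < 1) :
    bdryLength (cap c) ^ 2 = (4 * Real.pi - area (cap c)) * area (cap c) := by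
  have hΩ := isSmoothDomain_cap hc
  have := isFiniteMeasure_arcLength hΩ
  rw [← bdryLength_sq hΩ, sub_mul, ← integral_bdryIntegrand hΩ]
  refine integral_congr_ae ?_
  have hf : ∀ᵐ x ∂(arcLength (cap c)), x ∈ frontier (cap c) :=
    ae_restrict_mem isClosed_frontier.measurableSet
  filter_upwards [ae_ne_arcLength hΩ, Measure.quasiMeasurePreserving_fst.ae hf,
    Measure.quasiMeasurePreserving_snd.ae hf] with q hq h1 h2
  exact (bdryIntegrand_cap hc h1 h2 hq).symm

theorem eq_of_sq_height {x : S2} (h : 1 ≤ (x : E) 0 ^ 2) : (x : E) 1 = 0 ∧ (x : E) 2 = 0 := by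
  have := sphere_coord x
  constructor <;> nlinarith [sq_nonneg ((x : E) 1), sq_nonneg ((x : E) 2)]

/-- Levels with `c² < 1` are covered locally by zero sets in charts; every other level has at most
one point. -/
theorem sigma_level (c : ℝ) : σ {x : S2 | (x : E) 0 = c} = 0 := by
  by_cases hc : c ^ 2 < 1
  · refine measure_null_of_locally_null _ fun p hp => ?_
    obtain ⟨q, Ψ, δ, O, h, hpO⟩ := exists_chart_level hc hp
    refine ⟨{x : S2 | (x : E) ∈ O ∧ capFun c x = 0}, ?_, h.sigma_zero_set⟩
    filter_upwards [self_mem_nhdsWithin, nhdsWithin_le_nhds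
      ((h.isOpen.preimage continuous_subtype_val).mem_nhds hpO)] with x hx hxO
    exact ⟨hxO, by rw [capFun_eq, show (x : E) 0 = c from hx, sub_self]⟩
  · refine Set.Subsingleton.measure_zero (s := {x : S2 | (x : E) 0 = c}) (fun x hx y hy => ?_) σ
    have hx' := eq_of_sq_height (x := x) (by rw [show (x : E) 0 = c from hx]; exact not_lt.1 hc)
    have hy' := eq_of_sq_height (x := y) (by rw [show (y : E) 0 = c from hy]; exact not_lt.1 hc)
    refine Subtype.ext (ext_coord ?_ ?_ ?_)
    · exact (show (x : E) 0 = c from hx).trans (show (y : E) 0 = c from hy).symm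
    · rw [hx'.1, hy'.1]
    · rw [hx'.2, hy'.2]

/-- For fixed `x` the indicator of the cap is locally constant in the height except at the height of
`x`, and levels are null. -/
theorem continuous_area_cap : Continuous fun c => area (cap c) := by
  have h1 : ∀ c, area (cap c) = ∫ x, (cap c).indicator (fun _ => (1 : ℝ)) x ∂σ := fun c => by
    rw [integral_indicator (isOpen_cap c).measurableSet, setIntegral_const, smul_eq_mul, mul_one]
    rfl
  simp only [h1]
  refine continuous_iff_continuousAt.2 fun c => ?_
  refine continuousAt_of_dominated (bound := fun _ => 1) (Filter.Eventually.of_forall fun c => ?_)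
    (Filter.Eventually.of_forall fun c => Filter.Eventually.of_forall fun x => ?_)
    (integrable_const 1) ?_
  · exact (measurable_const.indicator (isOpen_cap c).measurableSet).aestronglyMeasurable
  · simp only [indicator]
    split_ifs <;> simp
  · have h2 : ∀ᵐ x : S2 ∂σ, (x : E) 0 ≠ c := by
      rw [ae_iff]; simpa using sigma_level c
    filter_upwards [h2] with x hx
    rcases lt_or_gt_of_ne hx with h | h
    · refine (continuousAt_const (y := (0 : ℝ))).congr ?_
      filter_upwards [lt_mem_nhds h] with c' hc'
      exact (indicator_of_notMem (M := ℝ) (s := cap c') (fun h' : c' < (x : E) 0 => lt_asymm h' hc') fun _ => (1 : ℝ)).symm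
    · refine (continuousAt_const (y := (1 : ℝ))).congr ?_
      filter_upwards [gt_mem_nhds h] with c' hc'
      exact (indicator_of_mem (s := cap c') (M := ℝ) hc' fun _ => (1 : ℝ)).symm

theorem area_cap_of_one_le {c : ℝ} (hc : 1 ≤ c) : area (cap c) = 0 := by
  have : cap c = ∅ := eq_empty_of_forall_notMem fun x (hx : c < (x : E) 0) => by
    nlinarith [sphere_coord x, sq_nonneg ((x : E) 1), sq_nonneg ((x : E) 2)]
  simp [area, this]

theorem area_cap_of_le_neg_one {c : ℝ} (hc : c ≤ -1) : area (cap c) = 4 * Real.pi := by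
  rw [area, ← sigma_real_univ, measureReal_def]
  congr 1
  refine measure_congr (ae_eq_univ.2 ?_)
  refine measure_mono_null (t := {x : S2 | (x : E) 0 = c}) (fun x hx => ?_) (sigma_level c)
  have h1 : (x : E) 0 ≤ c := not_lt.1 hx
  have h2 := sphere_coord x
  exact le_antisymm h1 (by nlinarith [sq_nonneg ((x : E) 1), sq_nonneg ((x : E) 2)])

/-- Intermediate value theorem between the empty cap `c = 1` and the cap of full area `c = -1`; an
area strictly in between forces `c² < 1`. -/
theorem exists_cap {A : ℝ} (h0 : 0 < A) (h4 : A < 4 * Real.pi) :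
    ∃ Ω : Set S2, IsSmoothDomain Ω ∧ area Ω = A ∧ bdryLength Ω ^ 2 = (4 * Real.pi - A) * A := by
  obtain ⟨c, hc⟩ := mem_range_of_exists_le_of_exists_ge continuous_area_cap
    ⟨1, (area_cap_of_one_le le_rfl).le.trans h0.le⟩
    ⟨-1, h4.le.trans (area_cap_of_le_neg_one le_rfl).ge⟩
  have hc : area (cap c) = A := hc
  have h1 : c < 1 := by
    by_contra! h
    rw [area_cap_of_one_le h] at hc
    exact h0.ne hc
  have h2 : -1 < c := by
    by_contra! h
    rw [area_cap_of_le_neg_one h] at hc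
    exact h4.ne hc.symm
  have h3 : c ^ 2 < 1 := by nlinarith
  exact ⟨cap c, isSmoothDomain_cap h3, hc, by rw [bdryLength_cap h3, hc]⟩

/-! ### The model integral in the plane -/

theorem norm_sq_eq_coord_plane (w : P) : ‖w‖ ^ 2 = w 0 ^ 2 + w 1 ^ 2 := by
  rw [EuclideanSpace.norm_sq_eq, Fin.sum_univ_two]
  simp

theorem sum_smul_f (w : P) : w = w 0 • f 0 + w 1 • f 1 := by
  ext i
  fin_cases i <;> simp [f]

theorem integrable_bubble : Integrable fun w : P => 4 / (‖w‖ ^ 2 + 1) ^ 2 := by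
  have h := (integrable_rpow_neg_one_add_norm_sq (μ := (volume : Measure P)) (r := 4)
    (by simp; norm_num)).const_mul 4
  refine h.congr (Filter.Eventually.of_forall fun w => ?_)
  simp only
  rw [show (-4 / 2 : ℝ) = ((-2 : ℤ) : ℝ) by norm_num, Real.rpow_intCast, zpow_neg, add_comm,
    div_eq_mul_inv]
  norm_cast

theorem integrable_bubble_mul {k : ℝ} (hk : 0 < k) :
    Integrable fun w : P => 4 / ((k * ‖w‖) ^ 2 + 1) ^ 2 := by
  have h := integrable_bubble.comp_smul hk.ne'
  simpa only [norm_smul, Real.norm_eq_abs, abs_of_pos hk] using h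

/-- In polar coordinates the radial integrand `4y/(y² + 1)²` has primitive `-2/(y² + 1)`; its
integral is `2`, to be multiplied by `2π`. -/
theorem integral_bubble : ∫ w : P, 4 / (‖w‖ ^ 2 + 1) ^ 2 = 4 * Real.pi := by
  have h := integral_fun_norm_addHaar (volume : Measure P) fun y : ℝ => 4 / (y ^ 2 + 1) ^ 2
  have hint := (integrable_fun_norm_addHaar (volume : Measure P)
    (f := fun y : ℝ => 4 / (y ^ 2 + 1) ^ 2)).1 integrable_bubble
  have hd : ∀ y : ℝ, HasDerivAt (fun y : ℝ => -2 / (y ^ 2 + 1)) (y * (4 / (y ^ 2 + 1) ^ 2)) y := by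
    intro y
    have h1 : HasDerivAt (fun y : ℝ => y ^ 2 + 1) (2 * y) y := by
      simpa using (hasDerivAt_pow 2 y).add_const 1
    have h2 := (hasDerivAt_const y (-2 : ℝ)).div h1 (by positivity)
    refine h2.congr_deriv ?_
    ring
  have hlim : Filter.Tendsto (fun y : ℝ => -2 / (y ^ 2 + 1)) Filter.atTop (𝓝 0) :=
    Filter.Tendsto.const_div_atTop
      (Filter.tendsto_atTop_add_const_right _ _ (Filter.tendsto_pow_atTop two_ne_zero)) _
  simp only [finrank_euclideanSpace, Fintype.card_fin, Nat.add_one_sub_one, pow_one,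
    smul_eq_mul] at h hint
  rw [h, integral_Ioi_of_hasDerivAt_of_tendsto' (fun y _ => hd y) hint hlim, measureReal_def,
    EuclideanSpace.volume_ball_fin_two]
  simp [ENNReal.toReal_ofReal Real.pi_pos.le]
  ring

theorem integral_comp_linearMap {T : P →ₗ[ℝ] P} (hT : LinearMap.det T ≠ 0) (g : P → ℝ) :
    ∫ w, g (T w) = |(LinearMap.det T)⁻¹| * ∫ w, g w := by
  have hemb : MeasurableEmbedding T :=
    (LinearMap.equivOfDetNeZero T hT).toContinuousLinearEquiv.toHomeomorph.measurableEmbedding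
  rw [← hemb.integral_map, map_linearMap_addHaar_eq_smul_addHaar _ hT, integral_smul_measure,
    ENNReal.toReal_ofReal (abs_nonneg _), smul_eq_mul]

theorem integral_bubble_linear {a b : E} (h : cross a b ≠ 0) :
    ∫ w : P, 4 / (‖w 0 • a + w 1 • b‖ ^ 2 + 1) ^ 2 = 4 * Real.pi / ‖cross a b‖ := by
  have ha : a ≠ 0 := by
    rintro rfl
    exact h (by simpa using cross_smul_left 0 (0 : E) b)
  have ha0 : ‖a‖ ≠ 0 := norm_ne_zero_iff.2 ha
  have hN0 : ‖cross a b‖ ≠ 0 := norm_ne_zero_iff.2 h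
  -- The triangular factor of the Gram matrix of `a`, `b`: an endomorphism of the plane with `|T w|
  -- = |w⁰ a + w¹ b|` and determinant `|a × b|`.
  let T : P →ₗ[ℝ] P := (!![‖a‖, ⟪a, b⟫ / ‖a‖; 0, ‖cross a b‖ / ‖a‖]).toLpLin 2 2
  have hdet : LinearMap.det T = ‖cross a b‖ := by
    rw [LinearMap.det_toLpLin, Matrix.det_fin_two_of]
    field_simp
    ring
  have hT : ∀ w : P, ‖T w‖ ^ 2 = ‖w 0 • a + w 1 • b‖ ^ 2 := fun w => by
    have h0 : T w 0 = ‖a‖ * w 0 + ⟪a, b⟫ / ‖a‖ * w 1 := by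
      simp [T, Matrix.toLpLin_apply, dotProduct]
    have h1 : T w 1 = ‖cross a b‖ / ‖a‖ * w 1 := by
      simp [T, Matrix.toLpLin_apply, dotProduct]
    rw [norm_sq_eq_coord_plane, h0, h1, norm_add_sq_real, norm_smul, norm_smul,
      real_inner_smul_left, real_inner_smul_right, mul_pow (‖cross a b‖ / ‖a‖), div_pow, norm_cross_sq, mul_pow _ ‖a‖,
      mul_pow _ ‖b‖]
    simp only [Real.norm_eq_abs, sq_abs]
    field_simp
    ring
  simp only [← hT]
  rw [integral_comp_linearMap (T := T) (by rwa [hdet]) fun w => 4 / (‖w‖ ^ 2 + 1) ^ 2,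
    integral_bubble, hdet, abs_of_nonneg (by positivity)]
  ring

/-! ### Compact pieces of a patch -/

/-- By compactness of `K × K` a local estimate suffices: at diagonal points from strict
differentiability and the immersion property, elsewhere from injectivity. -/
theorem exists_mul_norm_sub_le {φ : P → E} (hφ : ContDiff ℝ 1 φ) {K : Set P} (hK : IsCompact K)
    (hinj : InjOn φ K) (himm : ∀ s ∈ K, Function.Injective (fderiv ℝ φ s)) :
    ∃ k > 0, ∀ s ∈ K, ∀ t ∈ K, k * ‖s - t‖ ≤ ‖φ s - φ t‖ := by
  have key : ∃ k > 0, ∀ q ∈ K ×ˢ K, k * ‖q.1 - q.2‖ ≤ ‖φ q.1 - φ q.2‖ := by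
    refine (hK.prod hK).induction_on (p := fun A => ∃ k > 0, ∀ q ∈ A,
      k * ‖q.1 - q.2‖ ≤ ‖φ q.1 - φ q.2‖) ⟨1, one_pos, by simp⟩ ?_ ?_ ?_
    · rintro A B hAB ⟨k, hk, h⟩
      exact ⟨k, hk, fun q hq => h q (hAB hq)⟩
    · rintro A B ⟨k, hk, h⟩ ⟨k', hk', h'⟩
      refine ⟨min k k', lt_min hk hk', fun q hq => ?_⟩
      rcases hq with hq | hq
      · exact (mul_le_mul_of_nonneg_right (min_le_left _ _) (norm_nonneg _)).trans (h q hq)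
      · exact (mul_le_mul_of_nonneg_right (min_le_right _ _) (norm_nonneg _)).trans (h' q hq)
    · rintro ⟨s, t⟩ ⟨hs, ht⟩
      rcases eq_or_ne s t with rfl | hst
      · obtain ⟨κ, hκ, hanti⟩ := (fderiv ℝ φ s).toLinearMap.exists_antilipschitzWith
          (LinearMap.ker_eq_bot.2 (himm s hs))
        have hκ' : (0 : ℝ) < κ := hκ
        have hstrict := (hφ.contDiffAt.hasStrictFDerivAt (x := s) one_ne_zero).isLittleO
        -- Half of the lower bound `κ⁻¹` of the derivative is sacrificed to the error of
        -- linearization.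
        have hev := hstrict.def (c := (2 * (κ : ℝ))⁻¹) (by positivity)
        refine ⟨_, mem_nhdsWithin_of_mem_nhds hev, (2 * (κ : ℝ))⁻¹, by positivity, fun q hq => ?_⟩
        have h1 : ‖φ q.1 - φ q.2 - fderiv ℝ φ s (q.1 - q.2)‖ ≤ (2 * (κ : ℝ))⁻¹ * ‖q.1 - q.2‖ := hq
        have h2 : ‖q.1 - q.2‖ ≤ κ * ‖fderiv ℝ φ s (q.1 - q.2)‖ := by
          have := hanti.le_mul_dist (q.1 - q.2) 0
          simpa using this
        have h3 := norm_sub_norm_le (fderiv ℝ φ s (q.1 - q.2)) (φ q.1 - φ q.2)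
        rw [norm_sub_rev _ (φ q.1 - φ q.2)] at h3
        have h4 : (κ : ℝ)⁻¹ * ‖q.1 - q.2‖ ≤ ‖fderiv ℝ φ s (q.1 - q.2)‖ := by
          rwa [inv_mul_le_iff₀ hκ']
        have h5 : (κ : ℝ)⁻¹ = 2 * (2 * (κ : ℝ))⁻¹ := by field_simp
        rw [h5] at h4
        linarith
      · have hne : φ s ≠ φ t := fun h => hst (hinj hs ht h)
        have h1 : 0 < ‖s - t‖ := norm_pos_iff.2 (sub_ne_zero.2 hst)
        have h2 : 0 < ‖φ s - φ t‖ := norm_pos_iff.2 (sub_ne_zero.2 hne)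
        set k := ‖φ s - φ t‖ / (2 * ‖s - t‖) with hk
        have hk0 : 0 < k := by positivity
        have hlt : k * ‖s - t‖ < ‖φ s - φ t‖ := by
          rw [hk, div_mul_eq_mul_div, div_lt_iff₀ (by positivity)]
          nlinarith
        have hc1 : Continuous fun q : P × P => k * ‖q.1 - q.2‖ := by fun_prop
        have hc2 : Continuous fun q : P × P => ‖φ q.1 - φ q.2‖ :=
          ((hφ.continuous.comp continuous_fst).sub (hφ.continuous.comp continuous_snd)).norm
        exact ⟨_, mem_nhdsWithin_of_mem_nhds ((isOpen_lt hc1 hc2).mem_nhds hlt), k, hk0,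
          fun q hq => (show k * ‖q.1 - q.2‖ < _ from hq).le⟩
  obtain ⟨k, hk, h⟩ := key
  exact ⟨k, hk, fun s hs t ht => h (s, t) ⟨hs, ht⟩⟩

theorem exists_taylor_bound {φ : P → E} (hφ : ContDiff ℝ 2 φ) {K : Set P} (hK : IsCompact K) :
    ∃ C, 0 ≤ C ∧ ∀ s ∈ K, ∀ t ∈ K, ‖φ t - φ s - fderiv ℝ φ s (t - s)‖ ≤ C * ‖t - s‖ ^ 2 := by
  -- `K` is enlarged to a ball, whose convexity allows the mean value inequality to be used on
  -- segments.
  obtain ⟨R, hR⟩ := hK.isBounded.subset_closedBall 0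
  have hD : ContDiff ℝ 1 (fderiv ℝ φ) := hφ.fderiv_right (by norm_num)
  obtain ⟨C, hC⟩ := (isCompact_closedBall (0 : P) R).exists_bound_of_continuousOn
    (hD.continuous_fderiv one_ne_zero).continuousOn
  have hconv := convex_closedBall (0 : P) R
  refine ⟨|C|, abs_nonneg C, fun s hs t ht => ?_⟩
  have hs' := hR hs
  have ht' := hR ht
  rw [sq, ← mul_assoc]
  refine (convex_segment s t).norm_image_sub_le_of_norm_fderiv_le' (fun x _ =>
    hφ.differentiable two_ne_zero x) (fun x hx => ?_) (left_mem_segment ℝ s t)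
    (right_mem_segment ℝ s t)
  have hx' : x ∈ Metric.closedBall (0 : P) R := hconv.segment_subset hs' ht' hx
  refine (hconv.norm_image_sub_le_of_norm_fderiv_le (fun y _ =>
    hD.differentiable one_ne_zero y) (fun y hy => (hC y hy).trans (le_abs_self C)) hs' hx').trans ?_
  gcongr
  exact norm_sub_le_of_mem_segment hx

/-! ### Integration by parts on a surface patch -/

/-- The normal `∂₁φ × ∂₂φ` of a parametrized surface. -/
def normal (φ : P → E) (s : P) : E := cross (pd φ 0 s) (pd φ 1 s)

theorem contDiff_pd {φ : P → E} {n m : WithTop ℕ∞} (hφ : ContDiff ℝ n φ) (h : m + 1 ≤ n)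
    (a : Fin 2) : ContDiff ℝ m (pd φ a) :=
  (hφ.fderiv_right h).clm_apply contDiff_const

theorem contDiff_normal {φ : P → E} {n m : WithTop ℕ∞} (hφ : ContDiff ℝ n φ) (h : m + 1 ≤ n) :
    ContDiff ℝ m (normal φ) :=
  contDiff_cross.comp ((contDiff_pd hφ h 0).prodMk (contDiff_pd hφ h 1))

/-- The density of `dη ∧ γ^* G`, where `G` is read as a 1-form. -/
def wedgeGrad (γ : P → E) (G : E → E) (η : P → ℝ) (s : P) : ℝ :=
  ⟪G (γ s), pd γ 1 s⟫ * fderiv ℝ η s (f 0) - ⟪G (γ s), pd γ 0 s⟫ * fderiv ℝ η s (f 1)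

section ByParts

variable {γ : P → E} {G : E → E} {η : P → ℝ}

theorem contDiff_inner_pd (hγ : ContDiff ℝ 2 γ) (hG : ContDiff ℝ 1 G) (a : Fin 2) :
    ContDiff ℝ 1 fun s => ⟪G (γ s), pd γ a s⟫ :=
  (hG.comp (hγ.of_le one_le_two)).inner ℝ (contDiff_pd hγ (by norm_num) a)

theorem fderiv_inner_pd (hγ : ContDiff ℝ 2 γ) (hG : ContDiff ℝ 1 G) (a b : Fin 2) (s : P) :
    fderiv ℝ (fun s => ⟪G (γ s), pd γ a s⟫) s (f b)
      = ⟪G (γ s), fderiv ℝ (fderiv ℝ γ) s (f b) (f a)⟫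
        + ⟪fderiv ℝ G (γ s) (pd γ b s), pd γ a s⟫ := by
  have h1 : HasFDerivAt (fun s => G (γ s)) ((fderiv ℝ G (γ s)).comp (fderiv ℝ γ s)) s :=
    (hG.differentiable one_ne_zero _).hasFDerivAt.comp s
      (hγ.differentiable two_ne_zero s).hasFDerivAt
  have h2 : HasFDerivAt (fderiv ℝ γ) (fderiv ℝ (fderiv ℝ γ) s) s :=
    ((hγ.fderiv_right (m := 1) (by norm_num)).differentiable one_ne_zero s).hasFDerivAt
  have h3 : HasFDerivAt (pd γ a) ((fderiv ℝ (fderiv ℝ γ) s).flip (f a)) s :=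
    (h2.clm_apply (hasFDerivAt_const (f a) s)).congr_fderiv (by ext; simp)
  rw [fderiv_inner_apply ℝ h1.differentiableAt h3.differentiableAt, h1.fderiv, h3.fderiv]
  rfl

/-- The form `η γ^*G` has compact support, so its differential `dη ∧ γ^*G + η γ^*dG` has integral
zero; the second derivatives of `γ` cancel by symmetry. -/
theorem integral_wedgeGrad (hγ : ContDiff ℝ 2 γ) (hG : ContDiff ℝ 1 G) (hη : ContDiff ℝ 1 η)
    (hc : HasCompactSupport η) :
    ∫ s, wedgeGrad γ G η s = -∫ s, η s * ⟪curl G (γ s), normal γ s⟫ := by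
  have hh := contDiff_inner_pd hγ hG
  have hF : ∀ a, ContDiff ℝ 1 fun s => η s * ⟪G (γ s), pd γ a s⟫ := fun a => hη.mul (hh a)
  have hFc : ∀ a, HasCompactSupport fun s => η s * ⟪G (γ s), pd γ a s⟫ := fun a => hc.mul_right
  have e1 := integral_fderiv_eq_zero volume (hF 1) (hFc 1) (f 0)
  have e0 := integral_fderiv_eq_zero volume (hF 0) (hFc 0) (f 1)
  have hd : ∀ a b s, fderiv ℝ (fun s => η s * ⟪G (γ s), pd γ a s⟫) s (f b)
      = η s * fderiv ℝ (fun s => ⟪G (γ s), pd γ a s⟫) s (f b)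
        + ⟪G (γ s), pd γ a s⟫ * fderiv ℝ η s (f b) := fun a b s => by
    rw [fderiv_fun_mul (hη.differentiable one_ne_zero s) ((hh a).differentiable one_ne_zero s)]
    rfl
  have hsum : ∀ s, fderiv ℝ (fun s => η s * ⟪G (γ s), pd γ 1 s⟫) s (f 0)
      - fderiv ℝ (fun s => η s * ⟪G (γ s), pd γ 0 s⟫) s (f 1)
      = wedgeGrad γ G η s + η s * ⟪curl G (γ s), normal γ s⟫ := fun s => by
    have hsymm : fderiv ℝ (fderiv ℝ γ) s (f 0) (f 1) = fderiv ℝ (fderiv ℝ γ) s (f 1) (f 0) :=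
      (hγ.contDiffAt (x := s)).isSymmSndFDerivAt (by simp) (f 0) (f 1)
    rw [hd, hd, fderiv_inner_pd hγ hG, fderiv_inner_pd hγ hG, hsymm, normal, inner_curl_cross,
      wedgeGrad]
    ring
  have hcont : Continuous fun s => η s * ⟪curl G (γ s), normal γ s⟫ :=
    hη.continuous.mul (((continuous_curl hG).comp hγ.continuous).inner
      (contDiff_normal hγ (m := 1) (by norm_num)).continuous)
  have hi : Integrable fun s => η s * ⟪curl G (γ s), normal γ s⟫ :=
    hcont.integrable_of_hasCompactSupport hc.mul_right
  have i1 := integrable_fderiv_apply volume (hF 1) (hFc 1) (f 0)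
  have i0 := integrable_fderiv_apply volume (hF 0) (hFc 0) (f 1)
  have hw : ∀ s, wedgeGrad γ G η s = (fderiv ℝ (fun s => η s * ⟪G (γ s), pd γ 1 s⟫) s (f 0)
      - fderiv ℝ (fun s => η s * ⟪G (γ s), pd γ 0 s⟫) s (f 1))
      - η s * ⟪curl G (γ s), normal γ s⟫ := fun s => by rw [hsum]; ring
  have i10 : Integrable fun s => fderiv ℝ (fun s => η s * ⟪G (γ s), pd γ 1 s⟫) s (f 0)
      - fderiv ℝ (fun s => η s * ⟪G (γ s), pd γ 0 s⟫) s (f 1) := i1.sub i0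
  simp only [hw]
  rw [integral_sub i10 hi, integral_sub i1 i0, e1, e0]
  ring

theorem integrable_wedgeGrad (hγ : ContDiff ℝ 2 γ) (hG : ContDiff ℝ 1 G) (hη : ContDiff ℝ 1 η)
    (hc : HasCompactSupport η) : Integrable (wedgeGrad γ G η) := by
  have hh := contDiff_inner_pd hγ hG
  have h : ∀ a b, Integrable fun s => ⟪G (γ s), pd γ a s⟫ * fderiv ℝ η s (f b) := fun a b =>
    ((hh a).continuous.mul ((hη.continuous_fderiv one_ne_zero).clm_apply
      continuous_const)).integrable_of_hasCompactSupport (hc.fderiv_apply (𝕜 := ℝ) (f b)).mul_left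
  exact (h 1 0).sub (h 0 1)

end ByParts

/-! ### The weak form on a patch -/

section Patch

variable {φ : P → E} {ψ : P × P → ℝ}

/-- The partial derivative of `ψ` in the second variable. -/
def secondPartial (ψ : P × P → ℝ) (b : Fin 2) (q : P × P) : ℝ := fderiv ℝ ψ q (0, f b)

theorem contDiff_secondPartial (hψ : ContDiff ℝ ∞ ψ) (b : Fin 2) :
    ContDiff ℝ 1 (secondPartial ψ b) :=
  ((hψ.of_le two_le_infty).fderiv_right (m := 1) (by norm_num)).clm_apply contDiff_const

theorem hasCompactSupport_secondPartial (hc : HasCompactSupport ψ) (b : Fin 2) :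
    HasCompactSupport (secondPartial ψ b) := hc.fderiv_apply (𝕜 := ℝ) _

theorem mixedPartial_eq (hψ : ContDiff ℝ ∞ ψ) (a b : Fin 2) (s t : P) :
    mixedPartial ψ a b s t = fderiv ℝ (secondPartial ψ b) (s, t) (f a, 0) := by
  have h : ∀ s', fderiv ℝ (fun t' => ψ (s', t')) t (f b) = secondPartial ψ b (s', t) := fun s' =>
    fderiv_slice_right (hψ.differentiable (by simp) _) _
  simp only [mixedPartial, h]
  exact fderiv_slice_left ((contDiff_secondPartial hψ b).differentiable one_ne_zero _) _

theorem continuous_mixedPartial (hψ : ContDiff ℝ ∞ ψ) (a b : Fin 2) :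
    Continuous fun q : P × P => mixedPartial ψ a b q.1 q.2 := by
  simp only [mixedPartial_eq hψ]
  exact ((contDiff_secondPartial hψ b).continuous_fderiv one_ne_zero).clm_apply continuous_const

theorem mixedPartial_eq_zero (hψ : ContDiff ℝ ∞ ψ) (a b : Fin 2) {q : P × P}
    (hq : q ∉ tsupport ψ) : mixedPartial ψ a b q.1 q.2 = 0 := by
  rw [mixedPartial_eq hψ]
  have h1 : tsupport (secondPartial ψ b) ⊆ tsupport ψ := tsupport_fderiv_apply_subset ℝ _
  have h2 : tsupport (fun q => fderiv ℝ (secondPartial ψ b) q (f a, 0))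
      ⊆ tsupport (secondPartial ψ b) := tsupport_fderiv_apply_subset ℝ _
  exact image_eq_zero_of_notMem_tsupport
    (f := fun q => fderiv ℝ (secondPartial ψ b) q (f a, 0)) fun h => hq (h1 (h2 h))

/-- The coefficients of the pull-back of the regularized biform. -/
def regCoeff (c : ℝ) (φ : P → E) (a b : Fin 2) (q : P × P) : ℝ :=
  alphaReg c (φ q.1) (φ q.2) (pd φ a q.1) (pd φ b q.2)

/-- The weak form for the regularized biform. -/
def patchWeakReg (c : ℝ) (φ : P → E) (ψ : P × P → ℝ) (q : P × P) : ℝ :=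
  regCoeff c φ 1 1 q * mixedPartial ψ 0 0 q.1 q.2 - regCoeff c φ 1 0 q * mixedPartial ψ 0 1 q.1 q.2
    - regCoeff c φ 0 1 q * mixedPartial ψ 1 0 q.1 q.2
    + regCoeff c φ 0 0 q * mixedPartial ψ 1 1 q.1 q.2

theorem patchWeakIntegrand_eq : patchWeakIntegrand φ ψ = patchWeakReg 0 φ ψ := by
  ext1 q
  simp only [patchWeakIntegrand, patchWeakReg, pullCoeff, regCoeff, alpha_apply]

theorem measurable_regCoeff (hφ : ContDiff ℝ 1 φ) (c : ℝ) (a b : Fin 2) :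
    Measurable (regCoeff c φ a b) := by
  have h1 : Continuous fun q : P × P => φ q.1 - φ q.2 :=
    (hφ.continuous.comp continuous_fst).sub (hφ.continuous.comp continuous_snd)
  have hpd : ∀ a, Continuous (pd φ a) := fun a => (contDiff_pd hφ (m := 0) (by simp) a).continuous
  have h2 : Continuous fun q : P × P => pd φ a q.1 := (hpd a).comp continuous_fst
  have h3 : Continuous fun q : P × P => pd φ b q.2 := (hpd b).comp continuous_snd
  exact (((measurable_const.div ((h1.norm.pow 2).add continuous_const).measurable).mul
    (h1.inner h2).measurable).mul (h1.inner h3).measurable).sub (h2.inner h3).measurable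

theorem abs_regCoeff_le {c : ℝ} (hc : 0 ≤ c) (a b : Fin 2) (q : P × P) :
    |regCoeff c φ a b q| ≤ ‖pd φ a q.1‖ * ‖pd φ b q.2‖ := abs_alphaReg_le hc _ _ _ _

/-- An integrable majorant of the weak forms. -/
def weakBound (φ : P → E) (ψ : P × P → ℝ) (q : P × P) : ℝ :=
  ‖pd φ 1 q.1‖ * ‖pd φ 1 q.2‖ * |mixedPartial ψ 0 0 q.1 q.2|
    + ‖pd φ 1 q.1‖ * ‖pd φ 0 q.2‖ * |mixedPartial ψ 0 1 q.1 q.2|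
    + ‖pd φ 0 q.1‖ * ‖pd φ 1 q.2‖ * |mixedPartial ψ 1 0 q.1 q.2|
    + ‖pd φ 0 q.1‖ * ‖pd φ 0 q.2‖ * |mixedPartial ψ 1 1 q.1 q.2|

theorem abs_patchWeakReg_le {c : ℝ} (hc : 0 ≤ c) (q : P × P) :
    |patchWeakReg c φ ψ q| ≤ weakBound φ ψ q := by
  have h : ∀ a b a' b', |regCoeff c φ a b q * mixedPartial ψ a' b' q.1 q.2|
      ≤ ‖pd φ a q.1‖ * ‖pd φ b q.2‖ * |mixedPartial ψ a' b' q.1 q.2| := fun a b a' b' => by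
    rw [abs_mul]
    exact mul_le_mul_of_nonneg_right (abs_regCoeff_le hc a b q) (abs_nonneg _)
  refine (abs_add_le _ _).trans (add_le_add ((abs_sub _ _).trans (add_le_add
    ((abs_sub _ _).trans (add_le_add ?_ ?_)) ?_)) ?_) <;> exact h _ _ _ _

theorem integrable_weakBound (hφ : ContDiff ℝ 1 φ) (hψ : ContDiff ℝ ∞ ψ)
    (hcψ : HasCompactSupport ψ) : Integrable (weakBound φ ψ) := by
  have hpd : ∀ a, Continuous (pd φ a) := fun a => (contDiff_pd hφ (m := 0) (by simp) a).continuous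
  have h1 : ∀ a, Continuous fun q : P × P => pd φ a q.1 := fun a => (hpd a).comp continuous_fst
  have h2 : ∀ a, Continuous fun q : P × P => pd φ a q.2 := fun a => (hpd a).comp continuous_snd
  have h3 := continuous_mixedPartial hψ
  refine Continuous.integrable_of_hasCompactSupport ?_ (HasCompactSupport.intro hcψ fun q hq => ?_)
  · unfold weakBound
    exact (((((h1 1).norm.mul (h2 1).norm).mul (h3 0 0).abs).add
      (((h1 1).norm.mul (h2 0).norm).mul (h3 0 1).abs)).add
      (((h1 0).norm.mul (h2 1).norm).mul (h3 1 0).abs)).add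
      (((h1 0).norm.mul (h2 0).norm).mul (h3 1 1).abs)
  · simp only [weakBound, mixedPartial_eq_zero hψ _ _ hq, abs_zero, mul_zero, add_zero]

theorem measurable_patchWeakReg (hφ : ContDiff ℝ 1 φ) (hψ : ContDiff ℝ ∞ ψ) (c : ℝ) :
    Measurable (patchWeakReg c φ ψ) := by
  have h1 := measurable_regCoeff hφ c
  have h3 := fun a b => (continuous_mixedPartial hψ a b).measurable
  exact ((((h1 1 1).mul (h3 0 0)).sub ((h1 1 0).mul (h3 0 1))).sub
    ((h1 0 1).mul (h3 1 0))).add ((h1 0 0).mul (h3 1 1))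

theorem integrable_patchWeakReg (hφ : ContDiff ℝ 1 φ) (hψ : ContDiff ℝ ∞ ψ)
    (hcψ : HasCompactSupport ψ) {c : ℝ} (hc : 0 ≤ c) : Integrable (patchWeakReg c φ ψ) :=
  (integrable_weakBound hφ hψ hcψ).mono' (measurable_patchWeakReg hφ hψ c).aestronglyMeasurable
    (Filter.Eventually.of_forall fun q => abs_patchWeakReg_le hc q)

theorem tendsto_integral_patchWeakReg (hφ : ContDiff ℝ 1 φ) (hψ : ContDiff ℝ ∞ ψ)
    (hcψ : HasCompactSupport ψ) :
    Filter.Tendsto (fun c => ∫ q, patchWeakReg c φ ψ q) (𝓝[>] 0)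
      (𝓝 (∫ q, patchWeakReg 0 φ ψ q)) := by
  refine tendsto_integral_filter_of_dominated_convergence (weakBound φ ψ)
    (Filter.Eventually.of_forall fun c => (measurable_patchWeakReg hφ hψ c).aestronglyMeasurable)
    ?_ (integrable_weakBound hφ hψ hcψ) (Filter.Eventually.of_forall fun q => ?_)
  · filter_upwards [self_mem_nhdsWithin] with c hc
    exact Filter.Eventually.of_forall fun q => abs_patchWeakReg_le (le_of_lt hc) q
  · have h : ∀ a b, Filter.Tendsto (fun c => regCoeff c φ a b q) (𝓝[>] 0)
        (𝓝 (regCoeff 0 φ a b q)) := fun a b => by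
      simp only [regCoeff, ← alpha_apply]
      exact tendsto_alphaReg _ _ _ _
    exact ((((h 1 1).mul_const _).sub ((h 1 0).mul_const _)).sub ((h 0 1).mul_const _)).add
      ((h 0 0).mul_const _)

/-- The kernel of `d₁ d₂` of the regularized biform on the patch. -/
def regKernel (c : ℝ) (φ : P → E) (q : P × P) : ℝ :=
  4 * c * ⟪normal φ q.1, normal φ q.2⟫ / (‖φ q.1 - φ q.2‖ ^ 2 + c) ^ 2
    + 4 * ⟪φ q.1 - φ q.2, normal φ q.1⟫ * ⟪φ q.1 - φ q.2, normal φ q.2⟫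
      / (‖φ q.1 - φ q.2‖ ^ 2 + c) ^ 2

theorem inner_curl_regFlux_patch {c : ℝ} (hc : 0 < c) (s t : P) :
    ⟪curl (regFlux c (φ s) (normal φ s)) (φ t), normal φ t⟫ = regKernel c φ (s, t) := by
  rw [curl_regFlux c _ (norm_sq_add_pos hc _).ne', inner_add_left, real_inner_smul_left,
    real_inner_smul_left, regKernel]
  ring

/-- As on the sphere: by parts in `s`, Fubini, by parts in `t`, with the kernel now expressed
through the normals of the patch. -/
theorem integral_patchWeakReg (hφ : ContDiff ℝ ∞ φ) (hψ : ContDiff ℝ ∞ ψ)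
    (hcψ : HasCompactSupport ψ) {c : ℝ} (hc : 0 < c) :
    ∫ q, patchWeakReg c φ ψ q = ∫ s, ∫ t, ψ (s, t) * regKernel c φ (s, t) := by
  have hφ2 : ContDiff ℝ 2 φ := hφ.of_le two_le_infty
  have hφ1 : ContDiff ℝ 1 φ := hφ2.of_le one_le_two
  have hsp := contDiff_secondPartial hψ
  have hx : ∀ t, ∫ s, patchWeakReg c φ ψ (s, t)
      = -∫ s, wedgeGrad φ (regFlux c (φ s) (normal φ s)) (fun t => ψ (s, t)) t := by
    intro t
    have hsl : ∀ b, ContDiff ℝ 1 fun s => secondPartial ψ b (s, t) := fun b =>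
      (hsp b).comp (contDiff_id.prodMk contDiff_const)
    have hslc : ∀ b, HasCompactSupport fun s => secondPartial ψ b (s, t) := fun b =>
      hasCompactSupport_slice_left (hasCompactSupport_secondPartial hcψ b) t
    have hG : ∀ b, ContDiff ℝ 1 (regField c (φ t) (pd φ b t)) := fun b => contDiff_regField hc _ _
    -- For fixed `t` the four terms group into two wedge products in `s`, one for each component in
    -- `t`.
    have h1 : ∀ s, patchWeakReg c φ ψ (s, t)
        = wedgeGrad φ (regField c (φ t) (pd φ 1 t)) (fun s => secondPartial ψ 0 (s, t)) s
          - wedgeGrad φ (regField c (φ t) (pd φ 0 t)) (fun s => secondPartial ψ 1 (s, t)) s := by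
      intro s
      have h2 : ∀ a b, fderiv ℝ (fun s => secondPartial ψ b (s, t)) s (f a)
          = mixedPartial ψ a b s t := fun a b => by
        rw [mixedPartial_eq hψ]
        exact fderiv_slice_left ((hsp b).differentiable one_ne_zero _) _
      simp only [wedgeGrad, h2, inner_regField, patchWeakReg, regCoeff]
      ring
    have h3 : ∀ b s, ⟪curl (regField c (φ t) (pd φ b t)) (φ s), normal φ s⟫
        = ⟪regFlux c (φ s) (normal φ s) (φ t), pd φ b t⟫ := fun b s =>
      inner_curl_regField c _ _ (norm_sq_add_pos hc _).ne'
    have h4 : ∀ b s, fderiv ℝ (fun t => ψ (s, t)) t (f b) = secondPartial ψ b (s, t) := fun b s =>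
      fderiv_slice_right (hψ.differentiable (by simp) _) _
    have hflux : ∀ b, Continuous fun s => ⟪regFlux c (φ s) (normal φ s) (φ t), pd φ b t⟫ :=
      fun b => ((continuous_regFlux hc).comp (hφ.continuous.prodMk
        ((contDiff_normal hφ2 (m := 1) (by norm_num)).continuous.prodMk
          continuous_const))).inner continuous_const
    have hI : ∀ a b, Integrable fun s => secondPartial ψ b (s, t) *
        ⟪regFlux c (φ s) (normal φ s) (φ t), pd φ a t⟫ := fun a b =>
      ((hsl b).continuous.mul (hflux a)).integrable_of_hasCompactSupport (hslc b).mul_right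
    simp only [h1]
    rw [integral_sub (integrable_wedgeGrad hφ2 (hG 1) (hsl 0) (hslc 0))
      (integrable_wedgeGrad hφ2 (hG 0) (hsl 1) (hslc 1)),
      integral_wedgeGrad hφ2 (hG 1) (hsl 0) (hslc 0), integral_wedgeGrad hφ2 (hG 0) (hsl 1) (hslc 1)]
    simp only [h3, wedgeGrad, h4]
    rw [neg_sub_neg, ← neg_sub, ← integral_sub (hI 1 0) (hI 0 1)]
    congr 1
    refine integral_congr_ae (Filter.Eventually.of_forall fun s => ?_)
    simp only
    ring
  have hy : ∀ s, ∫ t, wedgeGrad φ (regFlux c (φ s) (normal φ s)) (fun t => ψ (s, t)) t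
      = -∫ t, ψ (s, t) * regKernel c φ (s, t) := fun s => by
    have hsl : ContDiff ℝ 1 fun t => ψ (s, t) :=
      (hψ.of_le (by simp)).comp (contDiff_const.prodMk contDiff_id)
    rw [integral_wedgeGrad hφ2 (contDiff_regFlux hc _ _) hsl
      (hasCompactSupport_slice_right hcψ s)]
    simp only [inner_curl_regFlux_patch hc]
  rw [volume_eq_prod, integral_prod_symm _ (integrable_patchWeakReg hφ1 hψ hcψ hc.le)]
  simp only [hx]
  rw [integral_neg, integral_integral_swap]
  · simp only [hy]
    rw [integral_neg, neg_neg]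
  · have hflux : Continuous fun q : P × P => regFlux c (φ q.2) (normal φ q.2) (φ q.1) :=
      (continuous_regFlux hc).comp (f := fun q : P × P => (φ q.2, normal φ q.2, φ q.1))
        ((hφ.continuous.comp continuous_snd).prodMk
          (((contDiff_normal hφ2 (m := 1) (by norm_num)).continuous.comp continuous_snd).prodMk
          (hφ.continuous.comp continuous_fst)))
    have hpd : ∀ a, Continuous fun q : P × P => pd φ a q.1 := fun a =>
      (contDiff_pd hφ2 (m := 1) (by norm_num) a).continuous.comp continuous_fst
    have hsw : ∀ b, Continuous fun q : P × P => secondPartial ψ b (q.2, q.1) := fun b =>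
      (hsp b).continuous.comp continuous_swap
    have h4 : ∀ b (q : P × P), fderiv ℝ (fun t => ψ (q.2, t)) q.1 (f b)
        = secondPartial ψ b (q.2, q.1) := fun b q =>
      fderiv_slice_right (hψ.differentiable (by simp) _) _
    change Integrable (fun q : P × P => wedgeGrad φ (regFlux c (φ q.2) (normal φ q.2))
      (fun t => ψ (q.2, t)) q.1) _
    simp only [wedgeGrad, h4]
    have hsupp : ∀ b, HasCompactSupport fun q : P × P => secondPartial ψ b (q.2, q.1) := fun b =>
      (hasCompactSupport_secondPartial hcψ b).comp_homeomorph (Homeomorph.prodComm P P)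
    have hI : ∀ a b, Integrable (fun q : P × P => ⟪regFlux c (φ q.2) (normal φ q.2) (φ q.1),
        pd φ a q.1⟫ * secondPartial ψ b (q.2, q.1)) (volume.prod volume) := fun a b =>
      ((hflux.inner (hpd a)).mul (hsw b)).integrable_of_hasCompactSupport (hsupp b).mul_left
    exact (hI 1 0).sub (hI 0 1)

end Patch

/-! ### The limit on a patch -/

theorem fderiv_eq_pd (φ : P → E) (s w : P) : fderiv ℝ φ s w = w 0 • pd φ 0 s + w 1 • pd φ 1 s := by
  conv_lhs => rw [sum_smul_f w]
  rw [map_add, map_smul, map_smul]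
  rfl

theorem inner_fderiv_normal (φ : P → E) (s w : P) : ⟪fderiv ℝ φ s w, normal φ s⟫ = 0 := by
  rw [fderiv_eq_pd, normal, inner_add_left, real_inner_smul_left, real_inner_smul_left,
    inner_cross_left, inner_cross_right, mul_zero, mul_zero, add_zero]

theorem normal_ne_zero {φ : P → E} {s : P} (h : Function.Injective (fderiv ℝ φ s)) :
    normal φ s ≠ 0 := fun h0 => by
  have h1 := norm_sq_smul_of_cross_eq_zero h0
  have h2 : ‖pd φ 1 s‖ ^ 2 • f 0 = ⟪pd φ 0 s, pd φ 1 s⟫ • f 1 :=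
    h (by rw [map_smul, map_smul]; exact h1)
  have h3 := congrArg (fun w : P => w 0) h2
  simp [f] at h3
  have h4 : f 1 = 0 := h (by rw [map_zero]; exact h3)
  have h5 := congrArg (fun w : P => w 1) h4
  simp [f] at h5

section PatchLimit

variable {φ : P → E} {ψ : P × P → ℝ} {K : Set P}

/-- A surface leaves its tangent plane only to second order, and the chord is comparable to the
distance of parameters. Applied at both ends of the chord, this bounds the regular part up to the
diagonal. -/
theorem exists_inner_normal_bound (hφ : ContDiff ℝ 2 φ) (hK : IsCompact K) (hinj : InjOn φ K)
    (himm : ∀ s ∈ K, Function.Injective (fderiv ℝ φ s)) :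
    ∃ M, 0 ≤ M ∧ ∀ s ∈ K, ∀ t ∈ K, |⟪φ t - φ s, normal φ s⟫| ≤ M * ‖φ t - φ s‖ ^ 2 := by
  obtain ⟨k, hk, hlow⟩ := exists_mul_norm_sub_le (hφ.of_le one_le_two) hK hinj himm
  obtain ⟨C, hC0, hC⟩ := exists_taylor_bound hφ hK
  obtain ⟨B, hB⟩ := hK.exists_bound_of_continuousOn
    (contDiff_normal hφ (m := 1) (by norm_num)).continuous.continuousOn
  refine ⟨C * |B| / k ^ 2, by positivity, fun s hs t ht => ?_⟩
  have h1 : ⟪φ t - φ s, normal φ s⟫ = ⟪φ t - φ s - fderiv ℝ φ s (t - s), normal φ s⟫ := by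
    rw [inner_sub_left (φ t - φ s), inner_fderiv_normal, sub_zero]
  have h2 := hlow t ht s hs
  calc |⟪φ t - φ s, normal φ s⟫|
      ≤ ‖φ t - φ s - fderiv ℝ φ s (t - s)‖ * ‖normal φ s‖ := by
        rw [h1]; exact abs_real_inner_le_norm _ _
    _ ≤ C * ‖t - s‖ ^ 2 * |B| := by
        gcongr
        · exact hC s hs t ht
        · exact (hB s hs).trans (le_abs_self B)
    _ = C * |B| / k ^ 2 * (k * ‖t - s‖) ^ 2 := by
        field_simp
    _ ≤ C * |B| / k ^ 2 * ‖φ t - φ s‖ ^ 2 := by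
        gcongr

/-- The regular part of the regularized weak form. -/
def regTerm (φ : P → E) (ψ : P × P → ℝ) (c : ℝ) (q : P × P) : ℝ :=
  ψ q * (4 * ⟪φ q.1 - φ q.2, normal φ q.1⟫ * ⟪φ q.1 - φ q.2, normal φ q.2⟫
    / (‖φ q.1 - φ q.2‖ ^ 2 + c) ^ 2)

/-- The concentrating part of the regularized weak form. -/
def peakTerm (φ : P → E) (ψ : P × P → ℝ) (c : ℝ) (q : P × P) : ℝ :=
  ψ q * (4 * c * ⟪normal φ q.1, normal φ q.2⟫ / (‖φ q.1 - φ q.2‖ ^ 2 + c) ^ 2)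

/-- The concentrating part in rescaled variables. -/
def scaledPeak (φ : P → E) (ψ : P × P → ℝ) (c : ℝ) (q : P × P) : ℝ :=
  ψ (q.1, q.1 + √c • q.2) * (4 * ⟪normal φ q.1, normal φ (q.1 + √c • q.2)⟫
    / (‖(√c)⁻¹ • (φ (q.1 + √c • q.2) - φ q.1)‖ ^ 2 + 1) ^ 2)

/-- The limit of the concentrating part. -/
def limitPeak (φ : P → E) (ψ : P × P → ℝ) (q : P × P) : ℝ :=
  ψ (q.1, q.1) * (4 * ⟪normal φ q.1, normal φ q.1⟫ / (‖fderiv ℝ φ q.1 q.2‖ ^ 2 + 1) ^ 2)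

theorem patchRegularIntegrand_eq : patchRegularIntegrand φ ψ = regTerm φ ψ 0 := by
  ext1 q
  rw [patchRegularIntegrand, regularPart_eq, regTerm, add_zero]
  rfl

theorem continuous_normal (hφ : ContDiff ℝ 2 φ) : Continuous (normal φ) :=
  (contDiff_normal hφ (m := 1) (by norm_num)).continuous

theorem exists_bound_regTerm (hφ : ContDiff ℝ 2 φ) (hK : IsCompact K) (hinj : InjOn φ K)
    (himm : ∀ s ∈ K, Function.Injective (fderiv ℝ φ s)) (hψK : tsupport ψ ⊆ K ×ˢ K) :
    ∃ M, ∀ c, 0 ≤ c → ∀ q, |regTerm φ ψ c q| ≤ M * |ψ q| := by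
  obtain ⟨M, hM0, hM⟩ := exists_inner_normal_bound hφ hK hinj himm
  refine ⟨4 * M * M, fun c hc q => ?_⟩
  by_cases hq : q ∈ tsupport ψ
  · obtain ⟨hs, ht⟩ := hψK hq
    have h1 := hM q.1 hs q.2 ht
    have h2 := hM q.2 ht q.1 hs
    rw [← neg_sub, inner_neg_left, abs_neg, norm_neg] at h1
    rw [regTerm, abs_mul, mul_comm]
    refine mul_le_mul_of_nonneg_right ?_ (abs_nonneg _)
    rw [abs_div, abs_mul, abs_mul, abs_of_pos (four_pos (α := ℝ)),
      abs_of_nonneg (sq_nonneg (‖φ q.1 - φ q.2‖ ^ 2 + c))]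
    refine div_le_of_le_mul₀ (by positivity) (by positivity) ?_
    calc 4 * |⟪φ q.1 - φ q.2, normal φ q.1⟫| * |⟪φ q.1 - φ q.2, normal φ q.2⟫|
        ≤ 4 * (M * ‖φ q.1 - φ q.2‖ ^ 2) * (M * ‖φ q.1 - φ q.2‖ ^ 2) := by gcongr
      _ = 4 * M * M * (‖φ q.1 - φ q.2‖ ^ 2) ^ 2 := by ring
      _ ≤ 4 * M * M * (‖φ q.1 - φ q.2‖ ^ 2 + c) ^ 2 := by gcongr; linarith
  · rw [regTerm, image_eq_zero_of_notMem_tsupport hq]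
    simp

theorem measurable_regTerm (hφ : ContDiff ℝ 2 φ) (hψ : Continuous ψ) (c : ℝ) :
    Measurable (regTerm φ ψ c) := by
  have h1 : Continuous fun q : P × P => φ q.1 - φ q.2 :=
    (hφ.continuous.comp continuous_fst).sub (hφ.continuous.comp continuous_snd)
  have hN := continuous_normal hφ
  have h2 := h1.inner (𝕜 := ℝ) (hN.comp continuous_fst)
  have h3 := h1.inner (𝕜 := ℝ) (hN.comp continuous_snd)
  exact hψ.measurable.mul (((continuous_const.mul h2).mul h3).measurable.div
    (((h1.norm.pow 2).add continuous_const).pow 2).measurable)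

theorem integrable_regTerm (hφ : ContDiff ℝ 2 φ) (hK : IsCompact K) (hinj : InjOn φ K)
    (himm : ∀ s ∈ K, Function.Injective (fderiv ℝ φ s)) (hψ : Continuous ψ)
    (hcψ : HasCompactSupport ψ) (hψK : tsupport ψ ⊆ K ×ˢ K) {c : ℝ} (hc : 0 ≤ c) :
    Integrable (regTerm φ ψ c) := by
  obtain ⟨M, hM⟩ := exists_bound_regTerm hφ hK hinj himm hψK
  exact ((hψ.integrable_of_hasCompactSupport hcψ).abs.const_mul M).mono'
    (measurable_regTerm hφ hψ c).aestronglyMeasurable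
    (Filter.Eventually.of_forall fun q => hM c hc q)

theorem tendsto_integral_regTerm (hφ : ContDiff ℝ 2 φ) (hK : IsCompact K) (hinj : InjOn φ K)
    (himm : ∀ s ∈ K, Function.Injective (fderiv ℝ φ s)) (hψ : Continuous ψ)
    (hcψ : HasCompactSupport ψ) (hψK : tsupport ψ ⊆ K ×ˢ K) :
    Filter.Tendsto (fun c => ∫ q, regTerm φ ψ c q) (𝓝[>] 0) (𝓝 (∫ q, regTerm φ ψ 0 q)) := by
  obtain ⟨M, hM⟩ := exists_bound_regTerm hφ hK hinj himm hψK
  refine tendsto_integral_filter_of_dominated_convergence (fun q => M * |ψ q|)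
    (Filter.Eventually.of_forall fun c => (measurable_regTerm hφ hψ c).aestronglyMeasurable)
    ?_ ((hψ.integrable_of_hasCompactSupport hcψ).abs.const_mul M)
    (Filter.Eventually.of_forall fun q => ?_)
  · filter_upwards [self_mem_nhdsWithin] with c hc
    exact Filter.Eventually.of_forall fun q => hM c (le_of_lt hc) q
  · refine Filter.Tendsto.mono_left ?_ nhdsWithin_le_nhds
    by_cases hz : φ q.1 - φ q.2 = 0
    · simp only [regTerm, hz, inner_zero_left, mul_zero, zero_div]
      exact tendsto_const_nhds
    · have hne : (‖φ q.1 - φ q.2‖ ^ 2 + 0) ^ 2 ≠ 0 := by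
        have := norm_pos_iff.2 hz
        positivity
      have : ContinuousAt (fun c => regTerm φ ψ c q) 0 := by
        unfold regTerm
        exact continuousAt_const.mul (continuousAt_const.div (by fun_prop) hne)
      exact this

theorem integrable_peakTerm (hφ : ContDiff ℝ 2 φ) (hψ : Continuous ψ)
    (hcψ : HasCompactSupport ψ) {c : ℝ} (hc : 0 < c) : Integrable (peakTerm φ ψ c) := by
  have h1 : Continuous fun q : P × P => φ q.1 - φ q.2 :=
    (hφ.continuous.comp continuous_fst).sub (hφ.continuous.comp continuous_snd)
  have hN := continuous_normal hφ
  have h2 := (hN.comp continuous_fst).inner (𝕜 := ℝ) (hN.comp (continuous_snd (X := P)))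
  have h3 : Continuous fun q : P × P => 4 * c * ⟪normal φ q.1, normal φ q.2⟫
      / (‖φ q.1 - φ q.2‖ ^ 2 + c) ^ 2 :=
    (continuous_const.mul h2).div (((h1.norm.pow 2).add continuous_const).pow 2)
      fun q => pow_ne_zero 2 (norm_sq_add_pos hc _).ne'
  exact (hψ.mul h3).integrable_of_hasCompactSupport hcψ.mul_right

/-- Substitution `t = s + √c w`. The Jacobian `c` and the factor `c` of the peak together scale
`(|z|² + c)²` to `(|z|²/c + 1)²`. -/
theorem integral_peakTerm_slice {c : ℝ} (hc : 0 < c) (s : P) :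
    ∫ t, peakTerm φ ψ c (s, t) = ∫ w, scaledPeak φ ψ c (s, w) := by
  have h1 := integral_comp_smul (volume : Measure P) (fun u => peakTerm φ ψ c (s, s + u)) √c
  rw [integral_add_left_eq_self (fun t => peakTerm φ ψ c (s, t)) s, finrank_euclideanSpace,
    Fintype.card_fin, Real.sq_sqrt hc.le, abs_of_pos (inv_pos.2 hc), smul_eq_mul,
    eq_inv_mul_iff_mul_eq₀ hc.ne', ← integral_const_mul] at h1
  rw [← h1]
  refine integral_congr_ae (Filter.Eventually.of_forall fun w => ?_)
  have h2 : ‖(√c)⁻¹ • (φ (s + √c • w) - φ s)‖ ^ 2 = ‖φ s - φ (s + √c • w)‖ ^ 2 / c := by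
    rw [norm_smul, mul_pow, norm_inv, Real.norm_eq_abs, inv_pow, sq_abs, Real.sq_sqrt hc.le,
      norm_sub_rev]
    ring
  have h3 := (norm_sq_add_pos hc (φ s - φ (s + √c • w))).ne'
  simp only [peakTerm, scaledPeak, h2]
  have h4 : ‖φ s - φ (s + √c • w)‖ ^ 2 / c + 1 = (‖φ s - φ (s + √c • w)‖ ^ 2 + c) / c := by
    field_simp
  rw [h4]
  field_simp

/-- The chord bound `exists_mul_norm_sub_le` gives a rescaled chord of length at least `k|w|`, so an
integrable bubble in `w`, cut off to `K` in `s`, dominates for every `c`. -/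
theorem exists_bound_scaledPeak (hφ : ContDiff ℝ 2 φ) (hK : IsCompact K) (hinj : InjOn φ K)
    (himm : ∀ s ∈ K, Function.Injective (fderiv ℝ φ s)) (hψ : Continuous ψ)
    (hcψ : HasCompactSupport ψ) (hψK : tsupport ψ ⊆ K ×ˢ K) :
    ∃ g : P × P → ℝ, Integrable g ∧ ∀ c, 0 < c → ∀ q, |scaledPeak φ ψ c q| ≤ g q := by
  obtain ⟨k, hk, hlow⟩ := exists_mul_norm_sub_le (hφ.of_le one_le_two) hK hinj himm
  obtain ⟨B, hB⟩ := hK.exists_bound_of_continuousOn (continuous_normal hφ).continuousOn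
  obtain ⟨C, hC⟩ := hψ.bounded_above_of_compact_support hcψ
  have hK1 : Integrable (K.indicator fun _ => |C| * (|B| * |B|)) (volume : Measure P) :=
    (integrable_indicator_iff hK.measurableSet).2
      (integrableOn_const hK.measure_lt_top.ne)
  refine ⟨fun q => K.indicator (fun _ => |C| * (|B| * |B|)) q.1
    * (4 / ((k * ‖q.2‖) ^ 2 + 1) ^ 2), hK1.mul_prod (integrable_bubble_mul hk),
    fun c hc q => ?_⟩
  have hc' : 0 < √c := Real.sqrt_pos.2 hc
  by_cases hq : (q.1, q.1 + √c • q.2) ∈ tsupport ψ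
  · obtain ⟨hs, ht⟩ := hψK hq
    simp only at hs ht
    have h1 : k * ‖q.2‖ ≤ ‖(√c)⁻¹ • (φ (q.1 + √c • q.2) - φ q.1)‖ := by
      have := hlow _ ht _ hs
      rw [add_sub_cancel_left, norm_smul, Real.norm_eq_abs, abs_of_pos hc'] at this
      rw [norm_smul, norm_inv, Real.norm_eq_abs, abs_of_pos hc', le_inv_mul_iff₀ hc']
      linarith
    have h2 : |⟪normal φ q.1, normal φ (q.1 + √c • q.2)⟫| ≤ |B| * |B| :=
      (abs_real_inner_le_norm _ _).trans (mul_le_mul ((hB _ hs).trans (le_abs_self B))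
        ((hB _ ht).trans (le_abs_self B)) (norm_nonneg _) (abs_nonneg _))
    simp only
    rw [indicator_of_mem hs, scaledPeak, abs_mul, abs_div, abs_mul,
      abs_of_pos (four_pos (α := ℝ)), abs_sq, mul_comm (4 : ℝ), mul_div_assoc, mul_assoc |C|]
    have h3 : 4 / (‖(√c)⁻¹ • (φ (q.1 + √c • q.2) - φ q.1)‖ ^ 2 + 1) ^ 2
        ≤ 4 / ((k * ‖q.2‖) ^ 2 + 1) ^ 2 := by gcongr
    have h4 : |ψ (q.1, q.1 + √c • q.2)| ≤ |C| := (hC _).trans (le_abs_self C)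
    gcongr
  · rw [scaledPeak, image_eq_zero_of_notMem_tsupport hq, zero_mul, abs_zero]
    exact mul_nonneg (indicator_nonneg (fun _ _ => by positivity) _) (by positivity)

theorem tendsto_scaledPeak (hφ : ContDiff ℝ 2 φ) (hψ : Continuous ψ) (q : P × P) :
    Filter.Tendsto (fun c => scaledPeak φ ψ c q) (𝓝[>] 0) (𝓝 (limitPeak φ ψ q)) := by
  have hsqrt : Filter.Tendsto (fun c : ℝ => √c) (𝓝[>] 0) (𝓝[>] 0) := by
    refine tendsto_nhdsWithin_iff.2 ⟨?_, ?_⟩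
    · have := Real.continuous_sqrt.tendsto 0
      rw [Real.sqrt_zero] at this
      exact this.mono_left nhdsWithin_le_nhds
    · filter_upwards [self_mem_nhdsWithin] with c hc using Real.sqrt_pos.2 hc
  have h0 : Filter.Tendsto (fun ε : ℝ => q.1 + ε • q.2) (𝓝[>] 0) (𝓝 q.1) := by
    have : Continuous fun ε : ℝ => q.1 + ε • q.2 := by fun_prop
    have h := this.tendsto 0
    rw [zero_smul, add_zero] at h
    exact h.mono_left nhdsWithin_le_nhds
  have hψt : Filter.Tendsto (fun ε : ℝ => ψ (q.1, q.1 + ε • q.2)) (𝓝[>] 0) (𝓝 (ψ (q.1, q.1))) :=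
    (hψ.tendsto (q.1, q.1)).comp (tendsto_const_nhds.prodMk_nhds h0)
  have hNt : Filter.Tendsto (fun ε : ℝ => normal φ (q.1 + ε • q.2)) (𝓝[>] 0)
      (𝓝 (normal φ q.1)) := ((continuous_normal hφ).tendsto q.1).comp h0
  have hslope : Filter.Tendsto (fun ε : ℝ => ε⁻¹ • (φ (q.1 + ε • q.2) - φ q.1)) (𝓝[>] 0)
      (𝓝 (fderiv ℝ φ q.1 q.2)) := by
    -- The rescaled chord is a difference quotient of `φ` at `s` in the direction `w`.
    have h1 := ((hφ.differentiable two_ne_zero q.1).hasFDerivAt.hasLineDerivAt q.2)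
    have h2 := HasDerivAt.tendsto_slope_zero_right h1
    simpa using h2
  have hden : (‖fderiv ℝ φ q.1 q.2‖ ^ 2 + 1) ^ 2 ≠ 0 := by positivity
  have h := hψt.mul (((tendsto_const_nhds (x := normal φ q.1)).inner hNt).const_mul 4 |>.div
    (((hslope.norm.pow 2).add_const 1).pow 2) hden)
  exact h.comp hsqrt

theorem measurable_limitPeak (hφ : ContDiff ℝ 2 φ) (hψ : Continuous ψ) :
    Measurable (limitPeak φ ψ) := by
  have hN := (continuous_normal hφ).comp (continuous_fst (Y := P))
  have hD : Continuous fun q : P × P => fderiv ℝ φ q.1 q.2 :=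
    ((hφ.continuous_fderiv two_ne_zero).comp continuous_fst).clm_apply continuous_snd
  have hd : Continuous fun q : P × P => ψ (q.1, q.1) := hψ.comp (by fun_prop)
  exact hd.measurable.mul (((hN.inner (𝕜 := ℝ) hN).const_mul 4).measurable.div
    (((hD.norm.pow 2).add continuous_const).pow 2).measurable)

theorem measurable_scaledPeak (hφ : ContDiff ℝ 2 φ) (hψ : Continuous ψ) (c : ℝ) :
    Measurable (scaledPeak φ ψ c) := by
  have hs : Continuous fun q : P × P => q.1 + √c • q.2 := by fun_prop
  have hN1 := (continuous_normal hφ).comp (continuous_fst (Y := P))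
  have hN2 := (continuous_normal hφ).comp hs
  have hD : Continuous fun q : P × P => (√c)⁻¹ • (φ (q.1 + √c • q.2) - φ q.1) :=
    ((hφ.continuous.comp hs).sub (hφ.continuous.comp continuous_fst)).const_smul (√c)⁻¹
  have hd : Continuous fun q : P × P => ψ (q.1, q.1 + √c • q.2) :=
    hψ.comp (continuous_fst.prodMk hs)
  exact hd.measurable.mul (((hN1.inner (𝕜 := ℝ) hN2).const_mul 4).measurable.div
    (((hD.norm.pow 2).add continuous_const).pow 2).measurable)

theorem patchDiracIntegrand_eq (s : P) : patchDiracIntegrand φ ψ s = ψ (s, s) * ‖normal φ s‖ := by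
  rw [patchDiracIntegrand, areaBracket_eq, real_inner_self_eq_norm_sq, normal]
  rcases eq_or_ne ‖cross (pd φ 0 s) (pd φ 1 s)‖ 0 with h | h
  · simp [h]
  · field_simp

theorem integrable_patchDiracIntegrand (hφ : ContDiff ℝ 2 φ) (hψ : Continuous ψ)
    (hcψ : HasCompactSupport ψ) : Integrable (patchDiracIntegrand φ ψ) := by
  have h1 : patchDiracIntegrand φ ψ = fun s => ψ (s, s) * ‖normal φ s‖ :=
    funext patchDiracIntegrand_eq
  have hd : Continuous fun s : P => ψ (s, s) := hψ.comp (by fun_prop)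
  rw [h1]
  refine (hd.mul (continuous_normal hφ).norm).integrable_of_hasCompactSupport ?_
  refine HasCompactSupport.intro (hcψ.image continuous_fst) fun s hs => ?_
  change ψ (s, s) * ‖normal φ s‖ = 0
  rw [image_eq_zero_of_notMem_tsupport fun h => hs ⟨_, h, rfl⟩, zero_mul]

/-- In the tangent plane the integral is `4π|N|²/|N|` with `N` the normal, and `|N|` is exactly the
density of the bracket `areaBracket` divided by `J`. -/
theorem integral_limitPeak_slice (himm : ∀ s ∈ K, Function.Injective (fderiv ℝ φ s))
    (hψK : tsupport ψ ⊆ K ×ˢ K) (s : P) :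
    ∫ w, limitPeak φ ψ (s, w) = 4 * Real.pi * patchDiracIntegrand φ ψ s := by
  rw [patchDiracIntegrand_eq]
  by_cases hs : (s, s) ∈ tsupport ψ
  · have hN : normal φ s ≠ 0 := normal_ne_zero (himm s (hψK hs).1)
    have h1 : ∀ w, limitPeak φ ψ (s, w) = ψ (s, s) * ‖normal φ s‖ ^ 2
        * (4 / (‖w 0 • pd φ 0 s + w 1 • pd φ 1 s‖ ^ 2 + 1) ^ 2) := fun w => by
      rw [limitPeak, fderiv_eq_pd, real_inner_self_eq_norm_sq]
      ring
    simp only [h1]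
    rw [integral_const_mul, integral_bubble_linear hN, ← normal]
    have := norm_ne_zero_iff.2 hN
    field_simp
  · have h0 := image_eq_zero_of_notMem_tsupport hs
    simp only [limitPeak, h0, zero_mul, integral_zero, mul_zero]

theorem tendsto_integral_peakTerm (hφ : ContDiff ℝ 2 φ) (hK : IsCompact K) (hinj : InjOn φ K)
    (himm : ∀ s ∈ K, Function.Injective (fderiv ℝ φ s)) (hψ : Continuous ψ)
    (hcψ : HasCompactSupport ψ) (hψK : tsupport ψ ⊆ K ×ˢ K) :
    Filter.Tendsto (fun c => ∫ q, peakTerm φ ψ c q) (𝓝[>] 0)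
      (𝓝 (4 * Real.pi * ∫ s, patchDiracIntegrand φ ψ s)) := by
  obtain ⟨g, hg, hgb⟩ := exists_bound_scaledPeak hφ hK hinj himm hψ hcψ hψK
  have hlim : Integrable (limitPeak φ ψ) := by
    refine hg.mono' (measurable_limitPeak hφ hψ).aestronglyMeasurable
      (Filter.Eventually.of_forall fun q => ?_)
    refine le_of_tendsto (tendsto_scaledPeak hφ hψ q).abs ?_
    filter_upwards [self_mem_nhdsWithin] with c hc using hgb c hc q
  have h1 : Filter.Tendsto (fun c => ∫ q, scaledPeak φ ψ c q) (𝓝[>] 0)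
      (𝓝 (∫ q, limitPeak φ ψ q)) := by
    refine tendsto_integral_filter_of_dominated_convergence g
      (Filter.Eventually.of_forall fun c => (measurable_scaledPeak hφ hψ c).aestronglyMeasurable)
      ?_ hg (Filter.Eventually.of_forall fun q => tendsto_scaledPeak hφ hψ q)
    filter_upwards [self_mem_nhdsWithin] with c hc
    exact Filter.Eventually.of_forall fun q => hgb c hc q
  have h2 : ∫ q, limitPeak φ ψ q = 4 * Real.pi * ∫ s, patchDiracIntegrand φ ψ s := by
    rw [volume_eq_prod, integral_prod _ hlim]
    simp only [integral_limitPeak_slice himm hψK]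
    exact integral_const_mul _ _
  rw [← h2]
  refine h1.congr' ?_
  filter_upwards [self_mem_nhdsWithin] with c hc
  have hsc : Integrable (scaledPeak φ ψ c) := hg.mono'
    (measurable_scaledPeak hφ hψ c).aestronglyMeasurable
    (Filter.Eventually.of_forall fun q => hgb c hc q)
  rw [volume_eq_prod, integral_prod _ hsc, integral_prod _ (integrable_peakTerm hφ hψ hcψ hc)]
  simp only [integral_peakTerm_slice hc]

theorem integral_patchWeakIntegrand (hφ : ContDiff ℝ ∞ φ) (hK : IsCompact K) (hinj : InjOn φ K)
    (himm : ∀ s ∈ K, Function.Injective (fderiv ℝ φ s)) (hψ : ContDiff ℝ ∞ ψ)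
    (hcψ : HasCompactSupport ψ) (hψK : tsupport ψ ⊆ K ×ˢ K) :
    ∫ q, patchWeakIntegrand φ ψ q =
      4 * Real.pi * (∫ s, patchDiracIntegrand φ ψ s) + ∫ q, patchRegularIntegrand φ ψ q := by
  have hφ2 : ContDiff ℝ 2 φ := hφ.of_le two_le_infty
  rw [patchWeakIntegrand_eq, patchRegularIntegrand_eq]
  refine tendsto_nhds_unique
    (tendsto_integral_patchWeakReg (hφ2.of_le one_le_two) hψ hcψ) ?_
  refine ((tendsto_integral_peakTerm hφ2 hK hinj himm hψ.continuous hcψ hψK).add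
    (tendsto_integral_regTerm hφ2 hK hinj himm hψ.continuous hcψ hψK)).congr' ?_
  filter_upwards [self_mem_nhdsWithin] with c hc
  have i1 := integrable_peakTerm hφ2 hψ.continuous hcψ hc
  have i2 := integrable_regTerm hφ2 hK hinj himm hψ.continuous hcψ hψK (le_of_lt hc)
  have h1 : ∀ q : P × P, ψ q * regKernel c φ q = peakTerm φ ψ c q + regTerm φ ψ c q := fun q => by
    rw [regKernel, peakTerm, regTerm]; ring
  have i3 : Integrable (fun q => ψ q * regKernel c φ q) := by
    simp only [h1]
    exact i1.add i2
  rw [integral_patchWeakReg hφ hψ hcψ hc, ← integral_add i1 i2]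
  simp only [← h1]
  rw [volume_eq_prod] at i3 ⊢
  exact integral_prod _ i3

end PatchLimit

/-- A cut-off equal to one near `K` yields a map smooth on the whole plane. Injectivity and
immersion survive only on `K`, which is all that the preceding limits use. -/
theorem IsPatch.exists_extension {U : Set P} {φ : P → E} (h : IsPatch U φ) {K : Set P}
    (hK : IsCompact K) (hKU : K ⊆ U) : ∃ φ' : P → E, ContDiff ℝ ∞ φ' ∧ ∀ s ∈ K, φ' =ᶠ[𝓝 s] φ := by
  obtain ⟨V, hVo, hKV, hVU, -⟩ := exists_open_between_and_isCompact_closure hK h.isOpen hKU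
  obtain ⟨χ, h1, h0, -⟩ := exists_contMDiffMap_one_nhds_of_subset_interior
    (modelWithCornersSelf ℝ P) (n := ⊤) hK.isClosed (hVo.interior_eq.symm ▸ hKV : K ⊆ interior V)
  refine ⟨fun s => χ s • φ s, ?_, fun s hs => ?_⟩
  · refine contDiff_of_contDiffOn_of_eq_zero h.isOpen isClosed_closure hVU
      (χ.contMDiff.contDiff.contDiffOn.smul h.smooth) fun s hs => ?_
    rw [h0 s fun hs' => hs (subset_closure hs'), zero_smul]
  · filter_upwards [Filter.Eventually.filter_mono (nhds_le_nhdsSet hs) h1] with t ht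
    simp only [ht, one_smul]

/-- The distributional form of `d₁ d₂ α` on a surface patch. -/
theorem IsPatch.distribution {U : Set P} {φ : P → E} (h : IsPatch U φ) {ψ : P × P → ℝ}
    (hψ : ContDiff ℝ ∞ ψ) (hcψ : HasCompactSupport ψ) (hψU : tsupport ψ ⊆ U ×ˢ U) :
    Integrable (patchWeakIntegrand φ ψ) ∧ Integrable (patchDiracIntegrand φ ψ) ∧
      Integrable (patchRegularIntegrand φ ψ) ∧
      ∫ q, patchWeakIntegrand φ ψ q =
        4 * Real.pi * (∫ s, patchDiracIntegrand φ ψ s) + ∫ q, patchRegularIntegrand φ ψ q := by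
  -- Both projections are joined so that the support of `ψ` lies in the square of one compact subset
  -- of `U`.
  set K : Set P := Prod.fst '' tsupport ψ ∪ Prod.snd '' tsupport ψ with hKdef
  have hK : IsCompact K := (hcψ.image continuous_fst).union (hcψ.image continuous_snd)
  have hψK : tsupport ψ ⊆ K ×ˢ K := fun q hq => ⟨Or.inl ⟨q, hq, rfl⟩, Or.inr ⟨q, hq, rfl⟩⟩
  have hKU : K ⊆ U := union_subset (image_subset_iff.2 fun q hq => (hψU hq).1)
    (image_subset_iff.2 fun q hq => (hψU hq).2)
  obtain ⟨φ', hφ', heq⟩ := h.exists_extension hK hKU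
  have hpd : ∀ s ∈ K, ∀ a, pd φ a s = pd φ' a s := fun s hs a => by
    rw [pd, pd, (heq s hs).fderiv_eq]
  have hval : ∀ s ∈ K, φ s = φ' s := fun s hs => (heq s hs).eq_of_nhds.symm
  have hinj : InjOn φ' K := fun s hs t ht hst =>
    h.injOn (hKU hs) (hKU ht) (by rw [hval s hs, hval t ht, hst])
  have himm : ∀ s ∈ K, Function.Injective (fderiv ℝ φ' s) := fun s hs => by
    rw [(heq s hs).fderiv_eq]
    exact h.immersion s (hKU hs)
  have e1 : patchWeakIntegrand φ ψ = patchWeakIntegrand φ' ψ := by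
    ext1 q
    by_cases hq : q ∈ tsupport ψ
    · obtain ⟨hs, ht⟩ := hψK hq
      simp only [patchWeakIntegrand, pullCoeff, hpd _ hs, hpd _ ht, hval _ hs, hval _ ht]
    · simp only [patchWeakIntegrand, mixedPartial_eq_zero hψ _ _ hq, mul_zero]
  have e2 : patchRegularIntegrand φ ψ = patchRegularIntegrand φ' ψ := by
    ext1 q
    by_cases hq : q ∈ tsupport ψ
    · obtain ⟨hs, ht⟩ := hψK hq
      simp only [patchRegularIntegrand, hpd _ hs, hpd _ ht, hval _ hs, hval _ ht]
    · simp only [patchRegularIntegrand, image_eq_zero_of_notMem_tsupport hq, zero_mul]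
  have e3 : patchDiracIntegrand φ ψ = patchDiracIntegrand φ' ψ := by
    ext1 s
    by_cases hq : (s, s) ∈ tsupport ψ
    · simp only [patchDiracIntegrand, hpd _ (hψK hq).1]
    · simp only [patchDiracIntegrand, image_eq_zero_of_notMem_tsupport hq, zero_mul]
  have hφ2 : ContDiff ℝ 2 φ' := hφ'.of_le two_le_infty
  rw [e1, e2, e3]
  refine ⟨?_, integrable_patchDiracIntegrand hφ2 hψ.continuous hcψ, ?_,
    integral_patchWeakIntegrand hφ' hK hinj himm hψ hcψ hψK⟩
  · rw [patchWeakIntegrand_eq]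
    exact integrable_patchWeakReg (hφ2.of_le one_le_two) hψ hcψ le_rfl
  · rw [patchRegularIntegrand_eq]
    exact integrable_regTerm hφ2 hK hinj himm hψ.continuous hcψ hψK le_rfl

end SphIso

end

open SphIso
theorem mainTheorem4 :
    -- (i) the comass of `α` is one
    (∀ x y : E, x ≠ y → ‖alpha x y‖ = 1) ∧
    -- (ii) so is that of its restriction to `C × C` for every circle `C`, whose tangent lines have
    -- just two unit vectors each
    (∀ (c u v : E) (r : ℝ), ‖u‖ = 1 → ‖v‖ = 1 → ⟪u, v⟫ = 0 → 0 < r →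
      ∀ s t : ℝ, circlePoint c u v r s ≠ circlePoint c u v r t →
        ∀ τ ∈ circleTangent u v s, ∀ τ' ∈ circleTangent u v t, ‖τ‖ = 1 → ‖τ'‖ = 1 →
          |alpha (circlePoint c u v r s) (circlePoint c u v r t) τ τ'| = 1) ∧
    -- (iii) `d₁ d₂ α` off the diagonal of `ℝ³ × ℝ³`
    ContDiffOn ℝ ∞ (fun q : E × E => alpha q.1 q.2) {q | q.1 ≠ q.2} ∧
    (∀ x y : E, x ≠ y → ∀ u u' v v' : E,
      d1d2 alpha x y u u' v v' = regularPart x y u u' v v') ∧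
    -- (iii) `d₁ d₂ α`, with its Dirac term, in the sense of distributions on surfaces
    (∀ (U : Set P) (φ : P → E), IsPatch U φ →
      ∀ ψ : P × P → ℝ, ContDiff ℝ ∞ ψ → HasCompactSupport ψ → tsupport ψ ⊆ U ×ˢ U →
        Integrable (patchWeakIntegrand φ ψ) ∧
        Integrable (patchDiracIntegrand φ ψ) ∧
        Integrable (patchRegularIntegrand φ ψ) ∧
        ∫ q, patchWeakIntegrand φ ψ q =
          4 * Real.pi * (∫ s, patchDiracIntegrand φ ψ s) + ∫ q, patchRegularIntegrand φ ψ q) ∧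
    -- the restriction to `S² × S²`, off the diagonal
    (∀ x y : S2, x ≠ y → ∀ u u' v v' : E,
      ⟪(x : E), u⟫ = 0 → ⟪(x : E), u'⟫ = 0 → ⟪(y : E), v⟫ = 0 → ⟪(y : E), v'⟫ = 0 →
        d1d2 alpha x y u u' v v' = -(areaForm x u u' * areaForm y v v')) ∧
    -- the restriction to `S² × S²`, in the sense of distributions
    (∀ ψ : E × E → ℝ, ContDiff ℝ ∞ ψ →
      Integrable (sphereWeakIntegrand ψ) (σ.prod σ) ∧
      ∫ q, sphereWeakIntegrand ψ q ∂(σ.prod σ) =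
        4 * Real.pi * (∫ x : S2, ψ ((x : E), (x : E)) ∂σ)
          - ∫ q : S2 × S2, ψ ((q.1 : E), (q.2 : E)) ∂(σ.prod σ)) ∧
    -- the isoperimetric inequality
    (∀ Ω : Set S2, IsSmoothDomain Ω →
      (μH[1] : Measure S2) (frontier Ω) ≠ ⊤ ∧
      Integrable (bdryIntegrand Ω) ((arcLength Ω).prod (arcLength Ω)) ∧
      (∫ q, bdryIntegrand Ω q ∂((arcLength Ω).prod (arcLength Ω))) ≤ bdryLength Ω ^ 2 ∧
      (∫ q, bdryIntegrand Ω q ∂((arcLength Ω).prod (arcLength Ω))) =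
        4 * Real.pi * area Ω - area Ω * area Ω ∧
      (4 * Real.pi - area Ω) * area Ω ≤ bdryLength Ω ^ 2) ∧
    -- its sharpness, for every value of the area
    (∀ A : ℝ, 0 < A → A < 4 * Real.pi → ∃ Ω : Set S2, IsSmoothDomain Ω ∧ area Ω = A ∧
      bdryLength Ω ^ 2 = (4 * Real.pi - A) * A) := by
  exact ⟨fun _ _ h => norm_alpha h,
    fun c u v r hu hv huv _ s t hne τ hτ τ' hτ' h1 h1' =>
      abs_alpha_circle hu hv huv hne hτ hτ' h1 h1',
    contDiffOn_alpha,
    fun _ _ h u u' v v' => d1d2_alpha h u u' v v',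
    fun _ _ h _ hψ hcψ hψU => h.distribution hψ hcψ hψU,
    fun _ _ h _ _ _ _ hu hu' hv hv' => d1d2_alpha_sphere h hu hu' hv hv',
    fun _ hψ => sphere_distribution hψ,
    fun _ hΩ => isoperimetric hΩ,
    fun _ h0 h4 => exists_cap h0 h4⟩
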